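/- Let $n\ge 3$, let $(M^n,g)$ be a smooth Riemannian manifold, $F:M\to\mathbb R$ smooth and $\rho\in\mathbb R$ with $R_{ij}=\nabla_i\nabla_jF+\rho g_{ij}$ (a gradient Ricci soliton: shrinking if $\rho>0$, steady if $\rho=0$, expanding if $\rho<0$). Let $R$ denote the scalar curvature and let $$W_{ijkl}=R_{ijkl}-\tfrac1{n-2}(g_{ik}R_{jl}-g_{il}R_{jk}-g_{jk}R_{il}+g_{jl}R_{ik})+\tfrac{R}{(n-1)(n-2)}(g_{ik}g_{jl}-g_{il}g_{jk}),$$ $$C_{ijk}=\nabla_kR_{ij}-\nabla_jR_{ik}-\tfrac1{2(n-1)}(g_{ij}\nabla_kR-g_{ik}\nabla_jR)$$ be the Weyl and Cotton tensors, where $R_{ijkl}=\langle(\nabla_i\nabla_j-\nabla_j\nabla_i)\partial_l,\partial_k\rangle$. Put $G=|\nabla F|^2$. Near a point where $dF\ne0$ the level set $\Sigma$ of $F$ through that point is a hypersurface with unit normal $\nu=\nabla F/|\nabla F|$, second fundamental form $h(X,Y)=\langle\nabla_X\nu,Y\rangle$ and mean curvature $H=\operatorname{tr}_{\Sigma}h$.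 Assume $W=0$ on $M$. Then: 1. At every point where $dF\neq0$ (in particular on $\Sigma_c=\{F=c\}$ for every regular value $c$ of $F$), $$|C_{ijk}|^2=\frac{2G^2}{(n-2)^2}\Big|h_{ab}-\frac{H}{n-1}g_{ab}\Big|^2+\frac1{2(n-1)(n-2)}|\nabla_aG|^2,$$ where $i,j,k$ run over a frame of $TM$, $a,b$ run over a frame of $T\Sigma$, and norms are full contractions (so $|\nabla_aG|^2$ is the squared norm of the gradient of $G$ along $\Sigma$). 2. Suppose moreover that $(M,g)$ is locally conformally flat, meaning, given $W=0$, that $C=0$ on $M$ in case $n=3$ (no further condition if $n\ge4$). Then at every point where $dF\ne0$ there are $\lambda,\mu\in\mathbb R$ such that, for the Ricci tensor viewed as an endomorphism, $\operatorname{Rc}(\nabla F)=\lambda\nabla F$ and $\operatorname{Rc}(X)=\mu X$ for all $X$ tangent to $\Sigma$; and $h_{ab}=\frac{H}{n-1}g_{ab}$. Furthermore $G$, $R$ and $H$ are constant on every connected set of points of $\{F=c\}$ at which $dF\neq0$, for every $c\in\mathbb R$; in particular they are constant on each connected component of $\Sigma_c$ for every regular value $c$. -/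

import Mathlib

open scoped Manifold ContDiff

noncomputable section

namespace RicciSoliton

/-! ## Riemannian geometry in local coordinates

Throughout, `γ : ℝⁿ → Matrix` is the matrix `(g_ij)` of a Riemannian metric in a coordinate chart,
`f` is the coordinate expression of a function, `y` is a point of the coordinate domain. -/

/-- The coordinate partial derivative `∂_i f (y)`. -/
def pd {n : ℕ} (i : Fin n) (f : EuclideanSpace ℝ (Fin n) → ℝ) (y : EuclideanSpace ℝ (Fin n)) : ℝ :=
  fderiv ℝ f y (EuclideanSpace.single i 1)

/-- `T(X, Y) = ∑ T_ij X^i Y^j`. -/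
def form {n : ℕ} (T : Fin n → Fin n → ℝ) (X Y : Fin n → ℝ) : ℝ :=
  ∑ i, ∑ j, T i j * X i * Y j

/-- Christoffel symbols `Γ^k_ij = ½ g^{kl} (∂_i g_jl + ∂_j g_il - ∂_l g_ij)` of the Levi-Civita
connection. -/
def christoffel {n : ℕ} (γ : EuclideanSpace ℝ (Fin n) → Matrix (Fin n) (Fin n) ℝ)
    (k i j : Fin n) (y : EuclideanSpace ℝ (Fin n)) : ℝ :=
  (1 / 2) * ∑ l, (γ y)⁻¹ k l *
    (pd i (fun z => γ z j l) y + pd j (fun z => γ z i l) y - pd l (fun z => γ z i j) y)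

/-- The components of the curvature operator:
`(∇_i ∇_j - ∇_j ∇_i) ∂_k = ∑ m, curvOp m i j k • ∂_m`. -/
def curvOp {n : ℕ} (γ : EuclideanSpace ℝ (Fin n) → Matrix (Fin n) (Fin n) ℝ)
    (m i j k : Fin n) (y : EuclideanSpace ℝ (Fin n)) : ℝ :=
  pd i (christoffel γ m j k) y - pd j (christoffel γ m i k) y
    + ∑ s, (christoffel γ m i s y * christoffel γ s j k y
      - christoffel γ m j s y * christoffel γ s i k y)

/-- The Riemann tensor `R_ijkl = ⟨(∇_i ∇_j - ∇_j ∇_i) ∂_l, ∂_k⟩`; the sign is such that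
`R_ijij > 0` (for `i ≠ j`) on round spheres. -/
def riem {n : ℕ} (γ : EuclideanSpace ℝ (Fin n) → Matrix (Fin n) (Fin n) ℝ)
    (i j k l : Fin n) (y : EuclideanSpace ℝ (Fin n)) : ℝ :=
  ∑ m, γ y k m * curvOp γ m i j l y

/-- The Ricci tensor `R_ik = g^{jl} R_ijkl`. -/
def ric {n : ℕ} (γ : EuclideanSpace ℝ (Fin n) → Matrix (Fin n) (Fin n) ℝ)
    (i k : Fin n) (y : EuclideanSpace ℝ (Fin n)) : ℝ :=
  ∑ j, ∑ l, (γ y)⁻¹ j l * riem γ i j k l y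

/-- The scalar curvature `R = g^{ik} R_ik`. -/
def scal {n : ℕ} (γ : EuclideanSpace ℝ (Fin n) → Matrix (Fin n) (Fin n) ℝ)
    (y : EuclideanSpace ℝ (Fin n)) : ℝ :=
  ∑ i, ∑ k, (γ y)⁻¹ i k * ric γ i k y

/-- The Weyl tensor `W_ijkl`. -/
def weyl {n : ℕ} (γ : EuclideanSpace ℝ (Fin n) → Matrix (Fin n) (Fin n) ℝ)
    (i j k l : Fin n) (y : EuclideanSpace ℝ (Fin n)) : ℝ :=
  riem γ i j k l y
    - 1 / ((n : ℝ) - 2) * (γ y i k * ric γ j l y - γ y i l * ric γ j k y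
        - γ y j k * ric γ i l y + γ y j l * ric γ i k y)
    + scal γ y / (((n : ℝ) - 1) * ((n : ℝ) - 2)) * (γ y i k * γ y j l - γ y i l * γ y j k)

/-- The covariant derivative `∇_k R_ij` of the Ricci tensor. -/
def covRic {n : ℕ} (γ : EuclideanSpace ℝ (Fin n) → Matrix (Fin n) (Fin n) ℝ)
    (k i j : Fin n) (y : EuclideanSpace ℝ (Fin n)) : ℝ :=
  pd k (ric γ i j) y
    - ∑ m, (christoffel γ m k i y * ric γ m j y + christoffel γ m k j y * ric γ i m y)

/-- The Cotton tensor
`C_ijk = ∇_k R_ij - ∇_j R_ik - (g_ij ∇_k R - g_ik ∇_j R) / (2 (n - 1))`. -/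
def cotton {n : ℕ} (γ : EuclideanSpace ℝ (Fin n) → Matrix (Fin n) (Fin n) ℝ)
    (i j k : Fin n) (y : EuclideanSpace ℝ (Fin n)) : ℝ :=
  covRic γ k i j y - covRic γ j i k y
    - 1 / (2 * ((n : ℝ) - 1)) * (γ y i j * pd k (scal γ) y - γ y i k * pd j (scal γ) y)

/-- `|C|² = g^{ia} g^{jb} g^{kc} C_ijk C_abc`, all indices being summed. -/
def cottonNormSq {n : ℕ} (γ : EuclideanSpace ℝ (Fin n) → Matrix (Fin n) (Fin n) ℝ)
    (y : EuclideanSpace ℝ (Fin n)) : ℝ :=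
  ∑ i, ∑ j, ∑ k, ∑ a, ∑ b, ∑ c,
    (γ y)⁻¹ i a * (γ y)⁻¹ j b * (γ y)⁻¹ k c * cotton γ i j k y * cotton γ a b c y

/-- The Hessian `∇_i ∇_j f = ∂_i ∂_j f - Γ^k_ij ∂_k f`. -/
def hess {n : ℕ} (γ : EuclideanSpace ℝ (Fin n) → Matrix (Fin n) (Fin n) ℝ)
    (f : EuclideanSpace ℝ (Fin n) → ℝ) (i j : Fin n) (y : EuclideanSpace ℝ (Fin n)) : ℝ :=
  pd i (pd j f) y - ∑ k, christoffel γ k i j y * pd k f y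

/-- The gradient vector field `(∇f)^i = g^{ij} ∂_j f`. -/
def grad {n : ℕ} (γ : EuclideanSpace ℝ (Fin n) → Matrix (Fin n) (Fin n) ℝ)
    (f : EuclideanSpace ℝ (Fin n) → ℝ) (i : Fin n) (y : EuclideanSpace ℝ (Fin n)) : ℝ :=
  ∑ j, (γ y)⁻¹ i j * pd j f y

/-- `G = |∇f|²`. -/
def gradNormSq {n : ℕ} (γ : EuclideanSpace ℝ (Fin n) → Matrix (Fin n) (Fin n) ℝ)
    (f : EuclideanSpace ℝ (Fin n) → ℝ) (y : EuclideanSpace ℝ (Fin n)) : ℝ :=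
  form (γ y) (fun i => grad γ f i y) (fun i => grad γ f i y)

/-- The unit normal field `ν = ∇f / |∇f|` of the level sets of `f`. -/
def unitNormal {n : ℕ} (γ : EuclideanSpace ℝ (Fin n) → Matrix (Fin n) (Fin n) ℝ)
    (f : EuclideanSpace ℝ (Fin n) → ℝ) (k : Fin n) (y : EuclideanSpace ℝ (Fin n)) : ℝ :=
  grad γ f k y / Real.sqrt (gradNormSq γ f y)

/-- The covariant derivative `(∇_i ν)^k = ∂_i ν^k + Γ^k_ij ν^j` of the unit normal field. -/
def covNormal {n : ℕ} (γ : EuclideanSpace ℝ (Fin n) → Matrix (Fin n) (Fin n) ℝ)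
    (f : EuclideanSpace ℝ (Fin n) → ℝ) (i k : Fin n) (y : EuclideanSpace ℝ (Fin n)) : ℝ :=
  pd i (unitNormal γ f k) y + ∑ j, christoffel γ k i j y * unitNormal γ f j y

/-- `v` is tangent to the level set of `f` through `y`. -/
def IsTangent {n : ℕ} (f : EuclideanSpace ℝ (Fin n) → ℝ) (y : EuclideanSpace ℝ (Fin n))
    (v : Fin n → ℝ) : Prop :=
  ∑ i, v i * pd i f y = 0

/-- The second fundamental form `h(X, Y) = ⟨∇_X ν, Y⟩` (for `X`, `Y` tangent to the level set of
`f` through `y`). -/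
def secondForm {n : ℕ} (γ : EuclideanSpace ℝ (Fin n) → Matrix (Fin n) (Fin n) ℝ)
    (f : EuclideanSpace ℝ (Fin n) → ℝ) (y : EuclideanSpace ℝ (Fin n)) (X Y : Fin n → ℝ) : ℝ :=
  form (γ y) (fun k => ∑ i, X i * covNormal γ f i k y) Y

/-- `e` is an orthonormal basis of the tangent space at `y` of the level set of `f` through `y`
(at a point where `df ≠ 0`, so that this tangent space has dimension `n - 1`). -/
def IsTangentFrame {n : ℕ} (γ : EuclideanSpace ℝ (Fin n) → Matrix (Fin n) (Fin n) ℝ)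
    (f : EuclideanSpace ℝ (Fin n) → ℝ) (y : EuclideanSpace ℝ (Fin n))
    (e : Fin (n - 1) → Fin n → ℝ) : Prop :=
  (∀ a, IsTangent f y (e a)) ∧ ∀ a b, form (γ y) (e a) (e b) = if a = b then 1 else 0

/-- The mean curvature `H = ∑ h(e_a, e_a)`, for `e` an orthonormal basis of the tangent space of
the level set. -/
def meanCurv {n : ℕ} (γ : EuclideanSpace ℝ (Fin n) → Matrix (Fin n) (Fin n) ℝ)
    (f : EuclideanSpace ℝ (Fin n) → ℝ) (y : EuclideanSpace ℝ (Fin n))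
    (e : Fin (n - 1) → Fin n → ℝ) : ℝ :=
  ∑ a, secondForm γ f y (e a) (e a)

/-- `|h_ab - H/(n-1) g_ab|²` on the level set, computed in the orthonormal basis `e`. -/
def tracelessNormSq {n : ℕ} (γ : EuclideanSpace ℝ (Fin n) → Matrix (Fin n) (Fin n) ℝ)
    (f : EuclideanSpace ℝ (Fin n) → ℝ) (y : EuclideanSpace ℝ (Fin n))
    (e : Fin (n - 1) → Fin n → ℝ) : ℝ :=
  ∑ a, ∑ b, (secondForm γ f y (e a) (e b)
    - meanCurv γ f y e / ((n : ℝ) - 1) * form (γ y) (e a) (e b)) ^ 2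

/-- `|∇_a G|²`, the squared norm of the gradient of `G = |∇f|²` along the level set, computed in
the orthonormal basis `e`. -/
def tangentialGradNormSq {n : ℕ} (γ : EuclideanSpace ℝ (Fin n) → Matrix (Fin n) (Fin n) ℝ)
    (f : EuclideanSpace ℝ (Fin n) → ℝ) (y : EuclideanSpace ℝ (Fin n))
    (e : Fin (n - 1) → Fin n → ℝ) : ℝ :=
  ∑ a, (∑ i, e a i * pd i (gradNormSq γ f) y) ^ 2

/-! ## Riemannian manifolds -/

/-- Smooth Riemannian metrics on the `n`-dimensional smooth manifold `M`. -/
abbrev Metric (n : ℕ) (M : Type*) [TopologicalSpace M] [ChartedSpace (EuclideanSpace ℝ (Fin n)) M]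
    [IsManifold (𝓡 n) ∞ M] :=
  Bundle.ContMDiffRiemannianMetric (𝓡 n) ∞ (EuclideanSpace ℝ (Fin n))
    (fun x : M => TangentSpace (𝓡 n) x)

/-- The components `g_ij = g(∂_i, ∂_j)` of the metric in the chart `φ`, as functions of the
coordinates; the coordinate vector field `∂_i` is the image of the `i`-th basis vector under the
differential of `φ⁻¹`. -/
def metricInChart {n : ℕ} {M : Type*} [TopologicalSpace M]
    [ChartedSpace (EuclideanSpace ℝ (Fin n)) M] [IsManifold (𝓡 n) ∞ M] (g : Metric n M)
    (φ : OpenPartialHomeomorph M (EuclideanSpace ℝ (Fin n)))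
    (y : EuclideanSpace ℝ (Fin n)) : Matrix (Fin n) (Fin n) ℝ :=
  fun i j => g.inner (φ.symm y)
    (mfderiv (𝓡 n) (𝓡 n) φ.symm y (EuclideanSpace.single i (1 : ℝ)))
    (mfderiv (𝓡 n) (𝓡 n) φ.symm y (EuclideanSpace.single j (1 : ℝ)))

/-- `(M, g, F)` is a gradient Ricci soliton: `F` is smooth and `R_ij = ∇_i ∇_j F + ρ g_ij`, in all
smooth local coordinates. It is shrinking for `ρ > 0`, steady for `ρ = 0`, expanding for `ρ < 0`. -/
structure IsGradientSoliton {n : ℕ} {M : Type*} [TopologicalSpace M]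
    [ChartedSpace (EuclideanSpace ℝ (Fin n)) M] [IsManifold (𝓡 n) ∞ M] (g : Metric n M)
    (F : M → ℝ) (ρ : ℝ) : Prop where
  smooth : ContMDiff (𝓡 n) 𝓘(ℝ, ℝ) ∞ F
  eqn : ∀ φ ∈ IsManifold.maximalAtlas (𝓡 n) ∞ M, ∀ p ∈ φ.source, ∀ i j,
    ric (metricInChart g φ) i j (φ p) =
      hess (metricInChart g φ) (F ∘ φ.symm) i j (φ p) + ρ * metricInChart g φ (φ p) i j

/-- The Weyl tensor of `g` vanishes identically. -/
def WeylVanishes {n : ℕ} {M : Type*} [TopologicalSpace M]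
    [ChartedSpace (EuclideanSpace ℝ (Fin n)) M] [IsManifold (𝓡 n) ∞ M] (g : Metric n M) : Prop :=
  ∀ φ ∈ IsManifold.maximalAtlas (𝓡 n) ∞ M, ∀ p ∈ φ.source, ∀ i j k l,
    weyl (metricInChart g φ) i j k l (φ p) = 0

/-- The Cotton tensor of `g` vanishes identically. -/
def CottonVanishes {n : ℕ} {M : Type*} [TopologicalSpace M]
    [ChartedSpace (EuclideanSpace ℝ (Fin n)) M] [IsManifold (𝓡 n) ∞ M] (g : Metric n M) : Prop :=
  ∀ φ ∈ IsManifold.maximalAtlas (𝓡 n) ∞ M, ∀ p ∈ φ.source, ∀ i j k,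
    cotton (metricInChart g φ) i j k (φ p) = 0

end RicciSoliton

end

open RicciSoliton

/-! Write `λ = Rc(∇F, ∇F) / |∇F|²` (`radialRic`) and `s = |∇F|`. Since the metric is parallel, `∇Rc
= ∇³F`, so the Ricci identity turns the antisymmetrized part of `∇Rc` into curvature contracted with
`∇F`. If `W = 0`, the curvature is the Kulkarni–Nomizu product of `g` with the Schouten tensor. The
contracted second Bianchi identity then makes the Cotton tensor trace free, which gives `∇R = -2
Rc(∇F)`, and shows that `(n - 3) C = 0`. Together these make `C` an explicit expression in `Rc`,
`dF` and `g` (`IsFlatSolitonOn.cotton_eq`).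

For the norm formula, evaluate this expression in an orthonormal frame of `ν` and tangent vectors
`e_a` (`sum_sq_cotton_frame`). Only two quantities survive: the trace-free part of `Rc` on the level
set and the mixed components `Rc(e_a, ν)`. The former is `s` times the trace-free part of `h`,
because `h = ∇²F / s` on tangent vectors and `ρ g` is pure trace. The latter are `∇_a G / (2 s)`,
because `∇G = 2 ∇²F(∇F)`.

If `C = 0`, contracting the expression with `∇F` forces `Rc(∇F) = λ ∇F` and `Rc = μ g + κ dF ⊗ dF`
with `μ = (R - λ) / (n - 1)`, so the level sets are umbilic. Moreover `dG = 2 (λ - ρ) dF` and `dR =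
-2 λ dF`, while `d(dG) = 0` gives `dλ ∧ dF = 0`. Hence `G`, `R` and `λ` are locally constant along
level sets, and `H` is a function of these three.

To pass from charts to connected sets, `G`, `R` and `λ` must not depend on the chart. By the soliton
equation, `R` and `λ` are expressed through `∇²F`, so it is enough that the Hessian is a tensor; no
transformation law for curvature is needed. -/

namespace RicciSoliton

/-! ## Calculus of partial derivatives -/

section Calculus

variable {n : ℕ} {U : Set (EuclideanSpace ℝ (Fin n))} {y : EuclideanSpace ℝ (Fin n)}
  {f g : EuclideanSpace ℝ (Fin n) → ℝ}

theorem differentiableAt_of_smooth (hU : IsOpen U) (hf : ContDiffOn ℝ ∞ f U) (hy : y ∈ U) :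
    DifferentiableAt ℝ f y :=
  (hf.contDiffAt (hU.mem_nhds hy)).differentiableAt (by simp)

theorem smooth_pd (hU : IsOpen U) (hf : ContDiffOn ℝ ∞ f U) (i : Fin n) :
    ContDiffOn ℝ ∞ (pd i f) U :=
  (hf.fderiv_of_isOpen hU (by simp)).clm_apply contDiffOn_const

theorem pd_congr (h : f =ᶠ[nhds y] g) (i : Fin n) : pd i f y = pd i g y := by
  simp only [pd, h.fderiv_eq]

theorem pd_congr_on (hU : IsOpen U) (hy : y ∈ U) (h : ∀ z ∈ U, f z = g z) (i : Fin n) :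
    pd i f y = pd i g y :=
  pd_congr (Filter.eventually_of_mem (hU.mem_nhds hy) h) i

theorem pd_const (c : ℝ) (i : Fin n) : pd i (fun _ => c) y = 0 := by
  simp [pd]

theorem pd_add (hf : DifferentiableAt ℝ f y) (hg : DifferentiableAt ℝ g y) (i : Fin n) :
    pd i (fun z => f z + g z) y = pd i f y + pd i g y := by
  simp only [pd, fderiv_fun_add hf hg, _root_.add_apply]

theorem pd_sub (hf : DifferentiableAt ℝ f y) (hg : DifferentiableAt ℝ g y) (i : Fin n) :
    pd i (fun z => f z - g z) y = pd i f y - pd i g y := by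
  simp only [pd, fderiv_fun_sub hf hg, _root_.sub_apply]

theorem pd_mul (hf : DifferentiableAt ℝ f y) (hg : DifferentiableAt ℝ g y) (i : Fin n) :
    pd i (fun z => f z * g z) y = pd i f y * g y + f y * pd i g y := by
  simp only [pd, fderiv_fun_mul hf hg, _root_.add_apply,
    _root_.smul_apply, smul_eq_mul]
  ring

theorem pd_const_mul (c : ℝ) (hf : DifferentiableAt ℝ f y) (i : Fin n) :
    pd i (fun z => c * f z) y = c * pd i f y := by
  rw [pd_mul (differentiableAt_const c) hf, pd_const]; ring

theorem pd_sum {ι : Type*} {s : Finset ι} {u : ι → EuclideanSpace ℝ (Fin n) → ℝ}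
    (h : ∀ a ∈ s, DifferentiableAt ℝ (u a) y) (i : Fin n) :
    pd i (fun z => ∑ a ∈ s, u a z) y = ∑ a ∈ s, pd i (u a) y := by
  simp only [pd, fderiv_fun_sum h, _root_.sum_apply]

theorem pd_comm (hU : IsOpen U) (hf : ContDiffOn ℝ ∞ f U) (hy : y ∈ U) (i j : Fin n) :
    pd i (pd j f) y = pd j (pd i f) y := by
  have hc : ContDiffAt ℝ ∞ f y := hf.contDiffAt (hU.mem_nhds hy)
  have hd : DifferentiableAt ℝ (fderiv ℝ f) y :=
    (hc.fderiv_right (m := ∞) (by simp)).differentiableAt (by simp)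
  have key : ∀ a b : Fin n, pd a (pd b f) y
      = fderiv ℝ (fderiv ℝ f) y (EuclideanSpace.single a 1) (EuclideanSpace.single b 1) := by
    intro a b
    unfold pd
    rw [fderiv_clm_apply hd (differentiableAt_const _)]
    simp
  rw [key, key]
  exact (hc.isSymmSndFDerivAt (by simpa using ENat.LEInfty.out)) _ _

theorem fderiv_eq_sum_pd (v : EuclideanSpace ℝ (Fin n)) :
    fderiv ℝ f y v = ∑ i, v i * pd i f y := by
  have hv : v = ∑ i, v i • EuclideanSpace.single i (1 : ℝ) := by
    ext j
    simp [Pi.single_apply]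
  conv_lhs => rw [hv]
  simp [pd]

theorem pd_comp {m : ℕ} {τ : EuclideanSpace ℝ (Fin m) → EuclideanSpace ℝ (Fin n)}
    {x : EuclideanSpace ℝ (Fin m)} (hf : DifferentiableAt ℝ f (τ x)) (hτ : DifferentiableAt ℝ τ x)
    (a : Fin m) :
    pd a (fun z => f (τ z)) x = ∑ i, pd a (fun z => τ z i) x * pd i f (τ x) := by
  have h := fderiv_comp x hf hτ
  have h1 : pd a (fun z => f (τ z)) x = fderiv ℝ f (τ x) (fderiv ℝ τ x (EuclideanSpace.single a 1)) := by
    change fderiv ℝ (f ∘ τ) x _ = _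
    rw [h]; rfl
  rw [h1, fderiv_eq_sum_pd]
  refine Finset.sum_congr rfl fun i _ => ?_
  congr 1
  have := ((EuclideanSpace.proj (𝕜 := ℝ) i).hasFDerivAt.comp x hτ.hasFDerivAt).fderiv
  change _ = fderiv ℝ (EuclideanSpace.proj (𝕜 := ℝ) i ∘ τ) x _
  rw [this]; rfl

/-! ### Calculus of matrix-valued functions. -/

/-- The entrywise partial derivative of a matrix-valued function. -/
noncomputable def mpd (p : Fin n) (A : EuclideanSpace ℝ (Fin n) → Matrix (Fin n) (Fin n) ℝ)
    (y : EuclideanSpace ℝ (Fin n)) : Matrix (Fin n) (Fin n) ℝ :=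
  Matrix.of fun i j => pd p (fun z => A z i j) y

/-- Entrywise smoothness of a matrix-valued function. -/
def SmoothMat (U : Set (EuclideanSpace ℝ (Fin n)))
    (A : EuclideanSpace ℝ (Fin n) → Matrix (Fin n) (Fin n) ℝ) : Prop :=
  ∀ i j, ContDiffOn ℝ ∞ (fun y => A y i j) U

variable {A B : EuclideanSpace ℝ (Fin n) → Matrix (Fin n) (Fin n) ℝ}

theorem SmoothMat.mul (hA : SmoothMat U A) (hB : SmoothMat U B) :
    SmoothMat U (fun y => A y * B y) := by
  intro i j
  simp only [Matrix.mul_apply]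
  exact ContDiffOn.sum fun k _ => (hA i k).mul (hB k j)

theorem SmoothMat.add (hA : SmoothMat U A) (hB : SmoothMat U B) :
    SmoothMat U (fun y => A y + B y) := fun i j => (hA i j).add (hB i j)

theorem SmoothMat.sub (hA : SmoothMat U A) (hB : SmoothMat U B) :
    SmoothMat U (fun y => A y - B y) := fun i j => (hA i j).sub (hB i j)

theorem SmoothMat.mpd (hU : IsOpen U) (hA : SmoothMat U A) (p : Fin n) :
    SmoothMat U (mpd p A) := fun i j => smooth_pd hU (hA i j) p

theorem SmoothMat.det (hA : SmoothMat U A) : ContDiffOn ℝ ∞ (fun y => (A y).det) U := by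
  simp only [Matrix.det_apply]
  exact ContDiffOn.sum fun σ _ => (contDiffOn_prod fun i _ => hA _ _).const_smul _

/-- Cramer's rule: an entry of the inverse is a determinant with one row replaced by a unit vector,
divided by the full determinant. -/
theorem SmoothMat.inv (hA : SmoothMat U A) (hdet : ∀ y ∈ U, (A y).det ≠ 0) :
    SmoothMat U (fun y => (A y)⁻¹) := by
  intro i j
  simp only [Matrix.inv_def, Ring.inverse_eq_inv', Matrix.smul_apply, Matrix.adjugate_apply,
    smul_eq_mul]
  refine (hA.det.inv hdet).mul (SmoothMat.det (A := fun y => (A y).updateRow j (Pi.single i 1)) ?_)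
  intro k l
  by_cases hk : k = j
  · subst hk; simp only [Matrix.updateRow_self]; exact contDiffOn_const
  · simp only [Matrix.updateRow_ne hk]; exact hA k l

theorem mpd_mul (hU : IsOpen U) (hA : SmoothMat U A) (hB : SmoothMat U B) (hy : y ∈ U)
    (p : Fin n) :
    mpd p (fun z => A z * B z) y = mpd p A y * B y + A y * mpd p B y := by
  ext i j
  simp only [mpd, Matrix.mul_apply, Matrix.of_apply, Matrix.add_apply]
  have hdA := fun a b => differentiableAt_of_smooth hU (hA a b) hy
  have hdB := fun a b => differentiableAt_of_smooth hU (hB a b) hy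
  rw [pd_sum (u := fun k z => A z i k * B z k j) fun k _ => (hdA i k).mul (hdB k j), ← Finset.sum_add_distrib]
  exact Finset.sum_congr rfl fun k _ => pd_mul (hdA i k) (hdB k j) p

theorem mpd_add (hU : IsOpen U) (hA : SmoothMat U A) (hB : SmoothMat U B) (hy : y ∈ U)
    (p : Fin n) : mpd p (fun z => A z + B z) y = mpd p A y + mpd p B y := by
  ext i j
  exact pd_add (differentiableAt_of_smooth hU (hA i j) hy)
    (differentiableAt_of_smooth hU (hB i j) hy) p

theorem mpd_sub (hU : IsOpen U) (hA : SmoothMat U A) (hB : SmoothMat U B) (hy : y ∈ U)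
    (p : Fin n) : mpd p (fun z => A z - B z) y = mpd p A y - mpd p B y := by
  ext i j
  exact pd_sub (differentiableAt_of_smooth hU (hA i j) hy)
    (differentiableAt_of_smooth hU (hB i j) hy) p

theorem mpd_comm (hU : IsOpen U) (hA : SmoothMat U A) (hy : y ∈ U) (p q : Fin n) :
    mpd p (mpd q A) y = mpd q (mpd p A) y := by
  ext i j
  exact pd_comm hU (hA i j) hy p q

theorem mpd_congr_on (hU : IsOpen U) (hy : y ∈ U) (h : ∀ z ∈ U, A z = B z) (p : Fin n) :
    mpd p A y = mpd p B y := by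
  ext i j
  exact pd_congr_on hU hy (fun z hz => by rw [h z hz]) p

theorem mpd_const (C : Matrix (Fin n) (Fin n) ℝ) (p : Fin n) :
    mpd p (fun _ => C) y = 0 := by
  ext i j
  exact pd_const _ p

end Calculus

/-- A function whose differential is everywhere proportional to that of `f` is locally constant
on the level sets of `f`. -/
theorem eventually_eq_of_fderiv_proportional {E : Type*} [NormedAddCommGroup E] [NormedSpace ℝ E]
    [CompleteSpace E] {f u : E → ℝ} {x : E} (hf : ContDiffAt ℝ 1 f x) (hfx : fderiv ℝ f x ≠ 0)
    (hu : ∀ᶠ y in nhds x, DifferentiableAt ℝ u y ∧ ∃ a : ℝ, fderiv ℝ u y = a • fderiv ℝ f y) :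
    ∀ᶠ y in nhds x, f y = f x → u y = u x := by
  set L := fderiv ℝ f x with hL
  obtain ⟨v, hv⟩ : ∃ v, L v = 1 := by
    obtain ⟨w, hw⟩ : ∃ w, L w ≠ 0 := by
      by_contra! h
      exact hfx (ContinuousLinearMap.ext h)
    exact ⟨(L w)⁻¹ • w, by simp [hw]⟩
  -- A shear along `v`, chosen so that `L ∘ Φ = f` while the derivative of `Φ` at `x` is the
  -- identity. Its local inverse straightens the level sets of `f` into hyperplanes parallel to `ker
  -- L`.
  set Φ : E → E := fun y => y + (f y - L y) • v with hΦ
  have hΦc : ContDiffAt ℝ 1 Φ x :=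
    contDiffAt_id.add ((hf.sub L.contDiff.contDiffAt).smul contDiffAt_const)
  have hLΦ : ∀ y, L (Φ y) = f y := by
    intro y; simp [hΦ, hv]
  have hΦd : HasFDerivAt Φ ((ContinuousLinearEquiv.refl ℝ E : E ≃L[ℝ] E) : E →L[ℝ] E) x := by
    have h1 := (hf.differentiableAt (by simp)).hasFDerivAt
    have h2 := (hasFDerivAt_id x).add ((h1.sub L.hasFDerivAt).smul_const v)
    refine h2.congr_fderiv ?_
    ext w
    simp [hL]
  set Ψ := hΦc.toOpenPartialHomeomorph Φ hΦd (by simp) with hΨ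
  have hΨe : (Ψ : E → E) = Φ := rfl
  have hxs : x ∈ Ψ.source := hΦc.mem_toOpenPartialHomeomorph_source hΦd (by simp)
  have hxt : Φ x ∈ Ψ.target := Ψ.map_source hxs
  have hsx : Ψ.symm (Φ x) = x := Ψ.left_inv hxs
  have hinv : ContDiffAt ℝ 1 Ψ.symm (Φ x) := hΦc.to_localInverse hΦd (by simp)
  have hfe : ∀ᶠ y in nhds x, DifferentiableAt ℝ f y :=
    (hf.eventually (by simp)).mono fun y h => h.differentiableAt (by simp)
  have hcont : Filter.Tendsto Ψ.symm (nhds (Φ x)) (nhds x) := by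
    have := hinv.continuousAt.tendsto
    rwa [hsx] at this
  have hgood : ∀ᶠ w in nhds (Φ x), w ∈ Ψ.target ∧ DifferentiableAt ℝ Ψ.symm w ∧
      DifferentiableAt ℝ f (Ψ.symm w) ∧ DifferentiableAt ℝ u (Ψ.symm w) ∧
      ∃ a : ℝ, fderiv ℝ u (Ψ.symm w) = a • fderiv ℝ f (Ψ.symm w) := by
    filter_upwards [Ψ.open_target.mem_nhds hxt, hinv.eventually (by simp), hcont.eventually hfe,
      hcont.eventually hu] with w h1 h2 h3 h4
    exact ⟨h1, h2.differentiableAt (by simp), h3, h4.1, h4.2⟩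
  obtain ⟨r, hr, hball⟩ := Metric.eventually_nhds_iff_ball.mp hgood
  have hfL : ∀ w ∈ Metric.ball (Φ x) r, f (Ψ.symm w) = L w := by
    intro w hw
    rw [← hLΦ, ← hΨe, Ψ.right_inv (hball w hw).1]
  -- In the straightened coordinates `f` becomes `L`, so the differential of `u` becomes a multiple
  -- of the fixed functional `L`; the factor may vary with `w`.
  have hcomp : ∀ w ∈ Metric.ball (Φ x) r, ∃ a : ℝ,
      HasFDerivAt (fun w => u (Ψ.symm w)) (a • L) w := by
    intro w hw
    obtain ⟨_, h2, h3, h4, a, ha⟩ := hball w hw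
    refine ⟨a, ?_⟩
    have h5 := h4.hasFDerivAt.comp w h2.hasFDerivAt
    have h6 := h3.hasFDerivAt.comp w h2.hasFDerivAt
    have h7 : HasFDerivAt (fun w => f (Ψ.symm w)) L w := by
      refine L.hasFDerivAt.congr_of_eventuallyEq ?_
      filter_upwards [Metric.isOpen_ball.mem_nhds hw] with z hz using hfL z hz
    have h8 := h6.unique h7
    rw [ha, ContinuousLinearMap.smul_comp, h8] at h5
    exact h5
  have hcontΦ : ∀ᶠ y in nhds x, Φ y ∈ Metric.ball (Φ x) r :=
    hΦc.continuousAt.eventually (Metric.ball_mem_nhds _ hr)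
  filter_upwards [hcontΦ, Ψ.open_source.mem_nhds hxs] with y hy hys hfy
  set d := Φ y - Φ x with hd
  have hLd : L d = 0 := by rw [hd, map_sub, hLΦ, hLΦ, hfy, sub_self]
  have hseg : ∀ t ∈ Set.Icc (0 : ℝ) 1, Φ x + t • d ∈ Metric.ball (Φ x) r := by
    intro t ht
    have := (convex_ball (Φ x) r).add_smul_sub_mem (Metric.mem_ball_self hr) hy ht
    exact this
  -- Since `L d = 0`, every multiple of `L` kills the direction of the segment, which stays in the
  -- ball by convexity.
  have hderiv : ∀ t ∈ Set.Icc (0 : ℝ) 1,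
      HasDerivAt (fun t : ℝ => u (Ψ.symm (Φ x + t • d))) 0 t := by
    intro t ht
    obtain ⟨a, ha⟩ := hcomp _ (hseg t ht)
    have h1 : HasDerivAt (fun t : ℝ => Φ x + t • d) d t := by
      simpa using ((hasDerivAt_id t).smul_const d).const_add (Φ x)
    have h2 := ha.comp_hasDerivAt t h1
    rw [_root_.smul_apply, hLd, smul_zero] at h2
    exact h2
  have hconst := constant_of_has_deriv_right_zero
    (f := fun t : ℝ => u (Ψ.symm (Φ x + t • d))) (a := 0) (b := 1)
    (fun t ht => (hderiv t ht).continuousAt.continuousWithinAt)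
    (fun t ht => (hderiv t ⟨ht.1, ht.2.le⟩).hasDerivWithinAt) 1 (by simp)
  have hsy : Ψ.symm (Φ y) = y := Ψ.left_inv hys
  simpa [hd, hsy, hsx] using hconst

/-! ## Riemannian geometry on an open set of `ℝⁿ` -/

/-- `γ` is a smooth Riemannian metric on the open set `U`. -/
structure IsMetricOn {n : ℕ} (γ : EuclideanSpace ℝ (Fin n) → Matrix (Fin n) (Fin n) ℝ)
    (U : Set (EuclideanSpace ℝ (Fin n))) : Prop where
  isOpen : IsOpen U
  smooth : SmoothMat U γ
  posDef : ∀ y ∈ U, (γ y).PosDef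

section Coordinates

variable {n : ℕ} {γ : EuclideanSpace ℝ (Fin n) → Matrix (Fin n) (Fin n) ℝ}
  {U : Set (EuclideanSpace ℝ (Fin n))} {y : EuclideanSpace ℝ (Fin n)}
  {f : EuclideanSpace ℝ (Fin n) → ℝ}

theorem IsMetricOn.symm (h : IsMetricOn γ U) (hy : y ∈ U) (i j : Fin n) : γ y i j = γ y j i := by
  simpa using (h.posDef y hy).isHermitian.apply j i

theorem IsMetricOn.transpose (h : IsMetricOn γ U) (hy : y ∈ U) : (γ y).transpose = γ y := by
  ext i j; exact h.symm hy j i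

theorem IsMetricOn.det_ne_zero (h : IsMetricOn γ U) (hy : y ∈ U) : (γ y).det ≠ 0 :=
  (h.posDef y hy).det_pos.ne'

theorem IsMetricOn.mul_inv (h : IsMetricOn γ U) (hy : y ∈ U) : γ y * (γ y)⁻¹ = 1 :=
  Matrix.mul_nonsing_inv _ (h.det_ne_zero hy).isUnit

theorem IsMetricOn.inv_mul (h : IsMetricOn γ U) (hy : y ∈ U) : (γ y)⁻¹ * γ y = 1 :=
  Matrix.nonsing_inv_mul _ (h.det_ne_zero hy).isUnit

theorem IsMetricOn.inv_transpose (h : IsMetricOn γ U) (hy : y ∈ U) :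
    ((γ y)⁻¹).transpose = (γ y)⁻¹ := by
  rw [Matrix.transpose_nonsing_inv, h.transpose hy]

theorem IsMetricOn.inv_symm (h : IsMetricOn γ U) (hy : y ∈ U) (i j : Fin n) :
    (γ y)⁻¹ i j = (γ y)⁻¹ j i :=
  congrFun (congrFun (h.inv_transpose hy) j) i

theorem IsMetricOn.smooth_inv (h : IsMetricOn γ U) : SmoothMat U (fun z => (γ z)⁻¹) :=
  h.smooth.inv fun _ hy => h.det_ne_zero hy

theorem IsMetricOn.pd_symm (h : IsMetricOn γ U) (hy : y ∈ U) (p i j : Fin n) :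
    pd p (fun z => γ z i j) y = pd p (fun z => γ z j i) y :=
  pd_congr_on h.isOpen hy (fun _ hz => h.symm hz i j) p

theorem IsMetricOn.smooth_christoffel (h : IsMetricOn γ U) (k i j : Fin n) :
    ContDiffOn ℝ ∞ (christoffel γ k i j) U := by
  unfold christoffel
  refine contDiffOn_const.mul (ContDiffOn.sum fun l _ => (h.smooth_inv k l).mul ?_)
  exact ((smooth_pd h.isOpen (h.smooth j l) i).add (smooth_pd h.isOpen (h.smooth i l) j)).sub
    (smooth_pd h.isOpen (h.smooth i j) l)

theorem IsMetricOn.christoffel_symm (h : IsMetricOn γ U) (hy : y ∈ U) (k i j : Fin n) :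
    christoffel γ k i j y = christoffel γ k j i y := by
  unfold christoffel
  congr 1
  refine Finset.sum_congr rfl fun l _ => ?_
  rw [h.pd_symm hy l i j]
  ring

/-! ### The Levi-Civita connection in matrix form. -/

/-- The connection matrix `(A_p)^m_l = Γ^m_pl`. -/
noncomputable def connMat (γ : EuclideanSpace ℝ (Fin n) → Matrix (Fin n) (Fin n) ℝ) (p : Fin n)
    (y : EuclideanSpace ℝ (Fin n)) : Matrix (Fin n) (Fin n) ℝ :=
  Matrix.of fun m l => christoffel γ m p l y

theorem IsMetricOn.smooth_connMat (h : IsMetricOn γ U) (p : Fin n) : SmoothMat U (connMat γ p) :=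
  fun m l => h.smooth_christoffel m p l

theorem IsMetricOn.metric_mul_connMat (h : IsMetricOn γ U) (hy : y ∈ U) (p k l : Fin n) :
    (γ y * connMat γ p y) k l = 1 / 2 * (pd p (fun z => γ z l k) y + pd l (fun z => γ z p k) y
      - pd k (fun z => γ z p l) y) := by
  set b : Fin n → ℝ := fun k => pd p (fun z => γ z l k) y + pd l (fun z => γ z p k) y
      - pd k (fun z => γ z p l) y with hb
  have h1 : (fun m => christoffel γ m p l y) = (1 / 2 : ℝ) • ((γ y)⁻¹.mulVec b) := by
    ext m
    simp [christoffel, Matrix.mulVec, dotProduct, hb]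
  have h2 : (γ y * connMat γ p y) k l = (γ y).mulVec (fun m => christoffel γ m p l y) k := by
    simp [Matrix.mul_apply, Matrix.mulVec, dotProduct, connMat]
  rw [h2, h1, Matrix.mulVec_smul, Matrix.mulVec_mulVec, h.mul_inv hy, Matrix.one_mulVec]
  simp [hb]

/-- This is `∇g = 0` in matrix form; it follows by adding the Koszul formula to its transpose. -/
theorem IsMetricOn.mpd_metric (h : IsMetricOn γ U) (hy : y ∈ U) (p : Fin n) :
    mpd p γ y = (connMat γ p y).transpose * γ y + γ y * connMat γ p y := by
  have h1 : (connMat γ p y).transpose * γ y = (γ y * connMat γ p y).transpose := by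
    rw [Matrix.transpose_mul, h.transpose hy]
  ext i j
  rw [h1, Matrix.add_apply, Matrix.transpose_apply, h.metric_mul_connMat hy,
    h.metric_mul_connMat hy, h.pd_symm hy p j i]
  simp only [mpd, Matrix.of_apply]
  ring

/-- The inverse metric is parallel too: differentiate `γ⁻¹ γ = 1`. -/
theorem IsMetricOn.mpd_inv (h : IsMetricOn γ U) (hy : y ∈ U) (p : Fin n) :
    mpd p (fun z => (γ z)⁻¹) y =
      -((γ y)⁻¹ * (connMat γ p y).transpose + connMat γ p y * (γ y)⁻¹) := by
  have h1 : mpd p (fun z => (γ z)⁻¹ * γ z) y = 0 := by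
    rw [mpd_congr_on (B := fun _ => 1) h.isOpen hy (fun z hz => h.inv_mul hz), mpd_const]
  rw [mpd_mul h.isOpen h.smooth_inv h.smooth hy, h.mpd_metric hy] at h1
  have h2 : mpd p (fun z => (γ z)⁻¹) y * γ y * (γ y)⁻¹
      = -((γ y)⁻¹ * ((connMat γ p y).transpose * γ y + γ y * connMat γ p y)) * (γ y)⁻¹ := by
    rw [eq_neg_of_add_eq_zero_left h1]
  rw [Matrix.mul_assoc, h.mul_inv hy, Matrix.mul_one] at h2
  rw [h2, Matrix.mul_add, ← Matrix.mul_assoc, ← Matrix.mul_assoc, h.inv_mul hy, Matrix.one_mul,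
    Matrix.neg_mul, Matrix.add_mul, Matrix.mul_assoc _ (γ y), h.mul_inv hy, Matrix.mul_one]

/-! ### Curvature and the second Bianchi identity -/

/-- The curvature matrix `(K_ij)^m_l`. -/
noncomputable def curvMat (γ : EuclideanSpace ℝ (Fin n) → Matrix (Fin n) (Fin n) ℝ) (i j : Fin n)
    (y : EuclideanSpace ℝ (Fin n)) : Matrix (Fin n) (Fin n) ℝ :=
  Matrix.of fun m l => curvOp γ m i j l y

/-- The matrix `(R_ij)_kl` of the Riemann tensor. -/
noncomputable def riemMat (γ : EuclideanSpace ℝ (Fin n) → Matrix (Fin n) (Fin n) ℝ) (i j : Fin n)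
    (y : EuclideanSpace ℝ (Fin n)) : Matrix (Fin n) (Fin n) ℝ :=
  Matrix.of fun k l => riem γ i j k l y

theorem curvMat_eq (γ : EuclideanSpace ℝ (Fin n) → Matrix (Fin n) (Fin n) ℝ) (i j : Fin n)
    (y : EuclideanSpace ℝ (Fin n)) :
    curvMat γ i j y = mpd i (connMat γ j) y - mpd j (connMat γ i) y
      + (connMat γ i y * connMat γ j y - connMat γ j y * connMat γ i y) := by
  ext m l
  simp only [curvMat, curvOp, Matrix.of_apply, Matrix.add_apply, Matrix.sub_apply,
    Matrix.mul_apply, mpd, connMat, Finset.sum_sub_distrib]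

theorem riemMat_eq (γ : EuclideanSpace ℝ (Fin n) → Matrix (Fin n) (Fin n) ℝ) (i j : Fin n)
    (y : EuclideanSpace ℝ (Fin n)) : riemMat γ i j y = γ y * curvMat γ i j y := by
  ext k l
  simp [riemMat, riem, curvMat, Matrix.mul_apply]

theorem curvMat_antisymm (γ : EuclideanSpace ℝ (Fin n) → Matrix (Fin n) (Fin n) ℝ) (i j : Fin n)
    (y : EuclideanSpace ℝ (Fin n)) : curvMat γ j i y = -curvMat γ i j y := by
  rw [curvMat_eq, curvMat_eq]; abel

theorem riem_antisymm (γ : EuclideanSpace ℝ (Fin n) → Matrix (Fin n) (Fin n) ℝ)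
    (i j k l : Fin n) (y : EuclideanSpace ℝ (Fin n)) : riem γ j i k l y = -riem γ i j k l y := by
  have h : riemMat γ j i y = -riemMat γ i j y := by
    rw [riemMat_eq, riemMat_eq, curvMat_antisymm, Matrix.mul_neg]
  exact congrFun (congrFun h k) l

theorem IsMetricOn.smooth_curvMat (h : IsMetricOn γ U) (i j : Fin n) :
    SmoothMat U (curvMat γ i j) := by
  have e : curvMat γ i j = fun y => mpd i (connMat γ j) y - mpd j (connMat γ i) y
      + (connMat γ i y * connMat γ j y - connMat γ j y * connMat γ i y) :=
    funext fun y => curvMat_eq γ i j y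
  rw [e]
  have hA := h.smooth_connMat
  exact (((hA j).mpd h.isOpen i).sub ((hA i).mpd h.isOpen j)).add
    (((hA i).mul (hA j)).sub ((hA j).mul (hA i)))

theorem IsMetricOn.mpd_curvMat (h : IsMetricOn γ U) (hy : y ∈ U) (p i j : Fin n) :
    mpd p (curvMat γ i j) y = mpd p (mpd i (connMat γ j)) y - mpd p (mpd j (connMat γ i)) y
      + (mpd p (connMat γ i) y * connMat γ j y + connMat γ i y * mpd p (connMat γ j) y
        - (mpd p (connMat γ j) y * connMat γ i y + connMat γ j y * mpd p (connMat γ i) y)) := by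
  have e : curvMat γ i j = fun y => mpd i (connMat γ j) y - mpd j (connMat γ i) y
      + (connMat γ i y * connMat γ j y - connMat γ j y * connMat γ i y) :=
    funext fun y => curvMat_eq γ i j y
  have hA := h.smooth_connMat
  have hU := h.isOpen
  rw [e, mpd_add hU (((hA j).mpd hU i).sub ((hA i).mpd hU j))
    (((hA i).mul (hA j)).sub ((hA j).mul (hA i))) hy,
    mpd_sub hU ((hA j).mpd hU i) ((hA i).mpd hU j) hy,
    mpd_sub hU ((hA i).mul (hA j)) ((hA j).mul (hA i)) hy, mpd_mul hU (hA i) (hA j) hy,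
    mpd_mul hU (hA j) (hA i) hy]

/-- With `K = dA + A ∧ A`, this is `dK + [A, K] = 0`: second derivatives of the connection matrices
cancel since partial derivatives commute, and what remains cancels by associativity. -/
theorem IsMetricOn.bianchi_curvMat (h : IsMetricOn γ U) (hy : y ∈ U) (p i j : Fin n) :
    (mpd p (curvMat γ i j) y + connMat γ p y * curvMat γ i j y - curvMat γ i j y * connMat γ p y)
    + (mpd i (curvMat γ j p) y + connMat γ i y * curvMat γ j p y
        - curvMat γ j p y * connMat γ i y)
    + (mpd j (curvMat γ p i) y + connMat γ j y * curvMat γ p i y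
        - curvMat γ p i y * connMat γ j y) = 0 := by
  have hA := h.smooth_connMat
  rw [h.mpd_curvMat hy, h.mpd_curvMat hy, h.mpd_curvMat hy,
    mpd_comm h.isOpen (hA j) hy p i, mpd_comm h.isOpen (hA i) hy p j,
    mpd_comm h.isOpen (hA p) hy i j]
  simp only [curvMat_eq]
  noncomm_ring

/-- The covariant derivative of a tensor with two lower indices. -/
noncomputable def covMat (γ : EuclideanSpace ℝ (Fin n) → Matrix (Fin n) (Fin n) ℝ)
    (T : EuclideanSpace ℝ (Fin n) → Matrix (Fin n) (Fin n) ℝ) (p : Fin n)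
    (y : EuclideanSpace ℝ (Fin n)) : Matrix (Fin n) (Fin n) ℝ :=
  mpd p T y - ((connMat γ p y).transpose * T y + T y * connMat γ p y)

theorem covMat_apply (T : EuclideanSpace ℝ (Fin n) → Matrix (Fin n) (Fin n) ℝ) (p i j : Fin n) :
    covMat γ T p y i j = pd p (fun z => T z i j) y
      - ∑ m, (christoffel γ m p i y * T y m j + christoffel γ m p j y * T y i m) := by
  simp only [covMat, mpd, connMat, Matrix.sub_apply, Matrix.add_apply, Matrix.mul_apply,
    Matrix.transpose_apply, Matrix.of_apply, Finset.sum_add_distrib]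
  simp only [mul_comm]

/-- Lowering an index commutes with covariant differentiation because the metric is parallel. Here
`i`, `j` are labels only; their Christoffel terms enter in `covRiem`. -/
theorem IsMetricOn.covMat_riemMat (h : IsMetricOn γ U) (hy : y ∈ U) (p i j : Fin n) :
    covMat γ (riemMat γ i j) p y = γ y * (mpd p (curvMat γ i j) y
      + connMat γ p y * curvMat γ i j y - curvMat γ i j y * connMat γ p y) := by
  have e : riemMat γ i j = fun z => γ z * curvMat γ i j z := funext fun z => riemMat_eq γ i j z
  rw [covMat, e, mpd_mul h.isOpen h.smooth (h.smooth_curvMat i j) hy, h.mpd_metric hy]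
  noncomm_ring

theorem IsMetricOn.bianchi_covMat (h : IsMetricOn γ U) (hy : y ∈ U) (p i j : Fin n) :
    covMat γ (riemMat γ i j) p y + covMat γ (riemMat γ j p) i y + covMat γ (riemMat γ p i) j y
      = 0 := by
  rw [h.covMat_riemMat hy, h.covMat_riemMat hy, h.covMat_riemMat hy, ← Matrix.mul_add,
    ← Matrix.mul_add, h.bianchi_curvMat hy, Matrix.mul_zero]

/-- The covariant derivative `∇_p R_ijkl` of the Riemann tensor. -/
noncomputable def covRiem (γ : EuclideanSpace ℝ (Fin n) → Matrix (Fin n) (Fin n) ℝ)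
    (p i j k l : Fin n) (y : EuclideanSpace ℝ (Fin n)) : ℝ :=
  covMat γ (riemMat γ i j) p y k l
    - ∑ s, (christoffel γ s p i y * riem γ s j k l y + christoffel γ s p j y * riem γ i s k l y)

/-- The second Bianchi identity. -/
theorem IsMetricOn.bianchi (h : IsMetricOn γ U) (hy : y ∈ U) (p i j k l : Fin n) :
    covRiem γ p i j k l y + covRiem γ i j p k l y + covRiem γ j p i k l y = 0 := by
  have h1 := congrFun (congrFun (h.bianchi_covMat hy p i j) k) l
  simp only [Matrix.add_apply, Matrix.zero_apply] at h1
  -- The connection is torsion free and the curvature is antisymmetric in its first pair, so the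
  -- Christoffel terms for that pair cancel in the cyclic sum.
  have h2 : ∀ a b c : Fin n, ∑ s, christoffel γ s a b y * riem γ s c k l y
      = -∑ s, christoffel γ s b a y * riem γ c s k l y := by
    intro a b c
    rw [← Finset.sum_neg_distrib]
    refine Finset.sum_congr rfl fun s _ => ?_
    rw [h.christoffel_symm hy s a b, riem_antisymm γ c s]
    ring
  simp only [covRiem, Finset.sum_add_distrib]
  rw [h2 p i j, h2 i j p, h2 j p i]
  linarith

theorem IsMetricOn.pd_metric (h : IsMetricOn γ U) (hy : y ∈ U) (p i j : Fin n) :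
    pd p (fun z => γ z i j) y
      = ∑ s, (christoffel γ s p i y * γ y s j + christoffel γ s p j y * γ y i s) := by
  have h1 := congrFun (congrFun (h.mpd_metric hy p) i) j
  simp only [mpd, connMat, Matrix.add_apply, Matrix.mul_apply,
    Matrix.transpose_apply, Matrix.of_apply] at h1
  rw [h1, ← Finset.sum_add_distrib]
  exact Finset.sum_congr rfl fun s _ => by ring

/-- If the Riemann tensor is the Kulkarni–Nomizu product of the metric with `S`, then its
covariant derivative is the product of the metric with that of `S`. -/
theorem IsMetricOn.covRiem_of_kulkarniNomizu (h : IsMetricOn γ U) (hy : y ∈ U)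
    {S : EuclideanSpace ℝ (Fin n) → Matrix (Fin n) (Fin n) ℝ} (hS : SmoothMat U S)
    (hR : ∀ z ∈ U, ∀ i j k l, riem γ i j k l z
      = γ z i k * S z j l - γ z i l * S z j k - γ z j k * S z i l + γ z j l * S z i k)
    (p i j k l : Fin n) :
    covRiem γ p i j k l y = γ y i k * covMat γ S p y j l - γ y i l * covMat γ S p y j k
      - γ y j k * covMat γ S p y i l + γ y j l * covMat γ S p y i k := by
  have hdγ := fun a b => differentiableAt_of_smooth h.isOpen (h.smooth a b) hy
  have hdS := fun a b => differentiableAt_of_smooth h.isOpen (hS a b) hy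
  have hd : pd p (fun z => riem γ i j k l z) y
      = pd p (fun z => γ z i k) y * S y j l + γ y i k * pd p (fun z => S z j l) y
        - (pd p (fun z => γ z i l) y * S y j k + γ y i l * pd p (fun z => S z j k) y)
        - (pd p (fun z => γ z j k) y * S y i l + γ y j k * pd p (fun z => S z i l) y)
        + (pd p (fun z => γ z j l) y * S y i k + γ y j l * pd p (fun z => S z i k) y) := by
    rw [pd_congr_on h.isOpen hy (fun z hz => hR z hz i j k l),
      pd_add ((((hdγ i k).fun_mul (hdS j l)).fun_sub ((hdγ i l).fun_mul (hdS j k))).fun_sub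
        ((hdγ j k).fun_mul (hdS i l))) ((hdγ j l).fun_mul (hdS i k)),
      pd_sub (((hdγ i k).fun_mul (hdS j l)).fun_sub ((hdγ i l).fun_mul (hdS j k))) ((hdγ j k).fun_mul (hdS i l)),
      pd_sub ((hdγ i k).fun_mul (hdS j l)) ((hdγ i l).fun_mul (hdS j k)),
      pd_mul (hdγ _ _) (hdS _ _), pd_mul (hdγ _ _) (hdS _ _), pd_mul (hdγ _ _) (hdS _ _),
      pd_mul (hdγ _ _) (hdS _ _)]
  simp only [covRiem, covMat_apply, riemMat, Matrix.of_apply]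
  rw [hd]
  simp only [h.pd_metric hy, hR y hy]
  rw [sub_sub, ← Finset.sum_add_distrib]
  simp only [mul_sub, Finset.sum_mul, Finset.mul_sum]
  -- Separates the terms where `S` is differentiated, which already agree, from those coming from
  -- `∂g`, which have to cancel against the Christoffel sums.
  have e : ∀ a1 a2 a3 a4 s1 s2 s3 s4 t u1 u2 u3 u4 : ℝ,
      s1 - s2 - s3 + s4 - t = - u1 + u2 + u3 - u4 →
      s1 + a1 - (s2 + a2) - (s3 + a3) + (s4 + a4) - t
        = a1 - u1 - (a2 - u2) - (a3 - u3) + (a4 - u4) := by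
    intros; linarith
  apply e
  simp only [← Finset.sum_add_distrib, ← Finset.sum_sub_distrib, ← Finset.sum_neg_distrib]
  exact Finset.sum_congr rfl fun s _ => by ring

/-! ### The Hessian and the Ricci identity -/

theorem IsMetricOn.hess_symm (h : IsMetricOn γ U) (hf : ContDiffOn ℝ ∞ f U) (hy : y ∈ U)
    (i j : Fin n) : hess γ f i j y = hess γ f j i y := by
  unfold hess
  rw [pd_comm h.isOpen hf hy]
  congr 1
  exact Finset.sum_congr rfl fun k _ => by rw [h.christoffel_symm hy]

/-- The matrix of the Hessian. -/
noncomputable def hessMat (γ : EuclideanSpace ℝ (Fin n) → Matrix (Fin n) (Fin n) ℝ)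
    (f : EuclideanSpace ℝ (Fin n) → ℝ) (y : EuclideanSpace ℝ (Fin n)) :
    Matrix (Fin n) (Fin n) ℝ :=
  Matrix.of fun i j => hess γ f i j y

theorem IsMetricOn.smooth_hessMat (h : IsMetricOn γ U) (hf : ContDiffOn ℝ ∞ f U) :
    SmoothMat U (hessMat γ f) := fun i j =>
  (smooth_pd h.isOpen (smooth_pd h.isOpen hf j) i).sub
    (ContDiffOn.sum fun k _ => (h.smooth_christoffel k i j).mul (smooth_pd h.isOpen hf k))

/-- The Ricci identity for the Hessian of a function. -/
theorem IsMetricOn.covMat_hess_sub (h : IsMetricOn γ U) (hf : ContDiffOn ℝ ∞ f U) (hy : y ∈ U)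
    (i j k : Fin n) :
    covMat γ (hessMat γ f) k y i j - covMat γ (hessMat γ f) j y i k
      = -∑ t, curvOp γ t k j i y * pd t f y := by
  have hU := h.isOpen
  have hpd : ∀ a b c : Fin n, pd a (fun z => hess γ f b c z) y = pd a (pd b (pd c f)) y
      - ∑ s, (pd a (christoffel γ s b c) y * pd s f y
        + christoffel γ s b c y * pd a (pd s f) y) := by
    intro a b c
    have h1 : ∀ s, DifferentiableAt ℝ (christoffel γ s b c) y := fun s =>
      differentiableAt_of_smooth hU (h.smooth_christoffel s b c) hy
    have h2 : ∀ s, DifferentiableAt ℝ (pd s f) y := fun s =>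
      differentiableAt_of_smooth hU (smooth_pd hU hf s) hy
    unfold hess
    rw [pd_sub (differentiableAt_of_smooth hU (smooth_pd hU (smooth_pd hU hf c) b) hy)
      (DifferentiableAt.fun_sum fun s _ => (h1 s).fun_mul (h2 s)),
      pd_sum (u := fun s z => christoffel γ s b c z * pd s f z) (fun s _ => (h1 s).fun_mul (h2 s))]
    congr 1
    exact Finset.sum_congr rfl fun s _ => pd_mul (h1 s) (h2 s) a
  -- The third derivatives drop out; what is left is `∂Γ` and `ΓΓ` applied to `df`, which is the
  -- curvature.
  have h3 : pd k (pd i (pd j f)) y = pd j (pd i (pd k f)) y := by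
    rw [pd_congr_on hU hy (fun z hz => pd_comm hU hf hz i j),
      pd_comm hU (smooth_pd hU hf i) hy k j,
      pd_congr_on hU hy (fun z hz => pd_comm hU hf hz k i)]
  have h4 : ∀ m, hess γ f m j y = pd j (pd m f) y - ∑ s, christoffel γ s j m y * pd s f y := by
    intro m; rw [h.hess_symm hf hy]; rfl
  have h5 : ∀ m, hess γ f m k y = pd k (pd m f) y - ∑ s, christoffel γ s k m y * pd s f y := by
    intro m; rw [h.hess_symm hf hy]; rfl
  have hc1 : ∀ s, pd k (christoffel γ s i j) y = pd k (christoffel γ s j i) y := fun s =>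
    pd_congr_on hU hy (fun z hz => h.christoffel_symm hz s i j) k
  have hc2 : ∀ s, pd j (christoffel γ s i k) y = pd j (christoffel γ s k i) y := fun s =>
    pd_congr_on hU hy (fun z hz => h.christoffel_symm hz s i k) j
  have hc3 : ∑ m, christoffel γ m k j y * hess γ f i m y
      = ∑ m, christoffel γ m j k y * hess γ f i m y :=
    Finset.sum_congr rfl fun m _ => by rw [h.christoffel_symm hy]
  have hswap : ∀ a b : Fin n, ∑ t, (∑ s, christoffel γ t a s y * christoffel γ s b i y) * pd t f y
      = ∑ m, christoffel γ m b i y * ∑ s, christoffel γ s a m y * pd s f y := by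
    intro a b
    simp only [Finset.sum_mul, Finset.mul_sum]
    rw [Finset.sum_comm]
    exact Finset.sum_congr rfl fun m _ => Finset.sum_congr rfl fun t _ => by ring
  simp only [covMat_apply, hessMat, Matrix.of_apply, hpd, curvOp, Finset.sum_add_distrib, hc3]
  simp only [h3, h4, h5, hc1, hc2, h.christoffel_symm hy _ i j, h.christoffel_symm hy _ i k,
    add_mul, sub_mul, mul_sub, Finset.sum_add_distrib, Finset.sum_sub_distrib, hswap]
  ring

end Coordinates

/-! ## Gradients and level sets -/

section Gradient

variable {n : ℕ} {γ : EuclideanSpace ℝ (Fin n) → Matrix (Fin n) (Fin n) ℝ}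
  {U : Set (EuclideanSpace ℝ (Fin n))} {y : EuclideanSpace ℝ (Fin n)}
  {f : EuclideanSpace ℝ (Fin n) → ℝ}

theorem form_eq_sum_left (T : Fin n → Fin n → ℝ) (X Y : Fin n → ℝ) :
    form T X Y = ∑ i, X i * ∑ j, T i j * Y j := by
  simp only [form, Finset.mul_sum]
  exact Finset.sum_congr rfl fun i _ => Finset.sum_congr rfl fun j _ => by ring

theorem form_eq_sum_right (T : Fin n → Fin n → ℝ) (X Y : Fin n → ℝ) :
    form T X Y = ∑ j, Y j * ∑ i, T i j * X i := by
  simp only [form, Finset.mul_sum]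
  rw [Finset.sum_comm]
  exact Finset.sum_congr rfl fun i _ => Finset.sum_congr rfl fun j _ => by ring

theorem form_matrix_eq_sum_left (T : Matrix (Fin n) (Fin n) ℝ) (X Y : Fin n → ℝ) :
    form T X Y = ∑ i, X i * ∑ j, T i j * Y j := form_eq_sum_left _ X Y

theorem form_matrix_eq_sum_right (T : Matrix (Fin n) (Fin n) ℝ) (X Y : Fin n → ℝ) :
    form T X Y = ∑ j, Y j * ∑ i, T i j * X i := form_eq_sum_right _ X Y

theorem grad_eq_mulVec (γ : EuclideanSpace ℝ (Fin n) → Matrix (Fin n) (Fin n) ℝ)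
    (f : EuclideanSpace ℝ (Fin n) → ℝ) (y : EuclideanSpace ℝ (Fin n)) :
    (fun i => grad γ f i y) = (γ y)⁻¹.mulVec (fun j => pd j f y) := by
  ext i; simp [grad, Matrix.mulVec, dotProduct]

theorem IsMetricOn.smooth_grad (h : IsMetricOn γ U) (hf : ContDiffOn ℝ ∞ f U) (i : Fin n) :
    ContDiffOn ℝ ∞ (grad γ f i) U :=
  ContDiffOn.sum fun j _ => (h.smooth_inv i j).mul (smooth_pd h.isOpen hf j)

theorem IsMetricOn.smooth_gradNormSq (h : IsMetricOn γ U) (hf : ContDiffOn ℝ ∞ f U) :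
    ContDiffOn ℝ ∞ (gradNormSq γ f) U := by
  unfold gradNormSq form
  exact ContDiffOn.sum fun i _ => ContDiffOn.sum fun j _ =>
    ((h.smooth i j).mul (h.smooth_grad hf i)).mul (h.smooth_grad hf j)

theorem IsMetricOn.metric_grad (h : IsMetricOn γ U) (hy : y ∈ U) (i : Fin n) :
    ∑ j, γ y i j * grad γ f j y = pd i f y := by
  have h1 : (γ y).mulVec (fun i => grad γ f i y) = fun j => pd j f y := by
    rw [grad_eq_mulVec, Matrix.mulVec_mulVec, h.mul_inv hy, Matrix.one_mulVec]
  exact congrFun h1 i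

theorem IsMetricOn.form_grad (h : IsMetricOn γ U) (hy : y ∈ U) (X : Fin n → ℝ) :
    form (γ y) X (fun i => grad γ f i y) = ∑ i, X i * pd i f y := by
  simp only [form_matrix_eq_sum_left, h.metric_grad hy]

theorem IsMetricOn.form_symm (h : IsMetricOn γ U) (hy : y ∈ U) (X Y : Fin n → ℝ) :
    form (γ y) X Y = form (γ y) Y X := by
  rw [form_matrix_eq_sum_left, form_matrix_eq_sum_right]
  simp only [h.symm hy]

theorem IsMetricOn.gradNormSq_eq (h : IsMetricOn γ U) (hy : y ∈ U) :
    gradNormSq γ f y = ∑ i, grad γ f i y * pd i f y :=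
  h.form_grad hy _

theorem form_eq_dotProduct (T : Matrix (Fin n) (Fin n) ℝ) (X Y : Fin n → ℝ) :
    form T X Y = dotProduct X (T.mulVec Y) := by
  simp [form_matrix_eq_sum_left, dotProduct, Matrix.mulVec]

theorem IsMetricOn.gradNormSq_pos (h : IsMetricOn γ U) (hy : y ∈ U) {i : Fin n}
    (hi : pd i f y ≠ 0) : 0 < gradNormSq γ f y := by
  have hN : (fun i => grad γ f i y) ≠ 0 := by
    intro h0
    apply hi
    rw [← h.metric_grad hy]
    exact Finset.sum_eq_zero fun j _ => by rw [show grad γ f j y = 0 from congrFun h0 j, mul_zero]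
  have := (h.posDef y hy).dotProduct_mulVec_pos hN
  rw [gradNormSq, form_eq_dotProduct]
  simpa using this

theorem exists_pd_ne_zero_of_gradNormSq_ne_zero (h : gradNormSq γ f y ≠ 0) :
    ∃ i, pd i f y ≠ 0 := by
  by_contra! h0
  exact h (by simp [gradNormSq, form, grad, h0])

/-- The covariant derivative of `∇f` is the Hessian with an index raised, the inverse metric being
parallel. -/
theorem IsMetricOn.cov_grad (h : IsMetricOn γ U) (hf : ContDiffOn ℝ ∞ f U) (hy : y ∈ U)
    (i k : Fin n) :
    pd i (grad γ f k) y + ∑ j, christoffel γ k i j y * grad γ f j y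
      = ∑ j, (γ y)⁻¹ k j * hess γ f i j y := by
  have hU := h.isOpen
  have h1 : pd i (grad γ f k) y = ∑ j, (mpd i (fun z => (γ z)⁻¹) y k j * pd j f y
      + (γ y)⁻¹ k j * pd i (pd j f) y) := by
    unfold grad
    have hP := fun j => differentiableAt_of_smooth hU (h.smooth_inv k j) hy
    have hd := fun j => differentiableAt_of_smooth hU (smooth_pd hU hf j) hy
    rw [pd_sum (u := fun j z => (γ z)⁻¹ k j * pd j f z) fun j _ => (hP j).fun_mul (hd j)]
    exact Finset.sum_congr rfl fun j _ => pd_mul (hP j) (hd j) i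
  have h2 : ∑ j, mpd i (fun z => (γ z)⁻¹) y k j * pd j f y
      = -(∑ m, (γ y)⁻¹ k m * ∑ j, christoffel γ j i m y * pd j f y)
        - ∑ j, christoffel γ k i j y * grad γ f j y := by
    have h3 : (mpd i (fun z => (γ z)⁻¹) y).mulVec (fun j => pd j f y)
        = -((γ y)⁻¹.mulVec ((connMat γ i y).transpose.mulVec (fun j => pd j f y)))
          - (connMat γ i y).mulVec (fun j => grad γ f j y) := by
      rw [h.mpd_inv hy, grad_eq_mulVec, Matrix.neg_mulVec, Matrix.add_mulVec,
        Matrix.mulVec_mulVec, Matrix.mulVec_mulVec, neg_add, sub_eq_add_neg]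
    exact congrFun h3 k
  rw [h1, Finset.sum_add_distrib, h2]
  simp only [hess, mul_sub, Finset.sum_sub_distrib]
  ring

theorem IsMetricOn.pd_gradNormSq (h : IsMetricOn γ U) (hf : ContDiffOn ℝ ∞ f U) (hy : y ∈ U)
    (k : Fin n) :
    pd k (gradNormSq γ f) y = 2 * ∑ j, hess γ f k j y * grad γ f j y := by
  have hU := h.isOpen
  have hd := fun j => differentiableAt_of_smooth hU (smooth_pd hU hf j) hy
  have hN := fun j => differentiableAt_of_smooth hU (h.smooth_grad hf j) hy
  have h1 : pd k (gradNormSq γ f) y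
      = ∑ i, (pd k (grad γ f i) y * pd i f y + grad γ f i y * pd k (pd i f) y) := by
    rw [pd_congr_on hU hy (fun z hz => h.gradNormSq_eq hz),
      pd_sum (u := fun i z => grad γ f i z * pd i f z) fun i _ => (hN i).fun_mul (hd i)]
    exact Finset.sum_congr rfl fun i _ => pd_mul (hN i) (hd i) k
  have h2 : ∀ i, pd k (grad γ f i) y = ∑ j, (γ y)⁻¹ i j * hess γ f k j y
      - ∑ j, christoffel γ i k j y * grad γ f j y := fun i => by
    rw [← h.cov_grad hf hy]; ring
  have h3 : ∑ i, (∑ j, (γ y)⁻¹ i j * hess γ f k j y) * pd i f y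
      = ∑ j, hess γ f k j y * grad γ f j y := by
    simp only [grad, Finset.sum_mul, Finset.mul_sum]
    rw [Finset.sum_comm]
    exact Finset.sum_congr rfl fun j _ => Finset.sum_congr rfl fun i _ => by
      rw [h.inv_symm hy i j]; ring
  have h4 : ∑ i, (∑ j, christoffel γ i k j y * grad γ f j y) * pd i f y
      = ∑ j, grad γ f j y * ∑ i, christoffel γ i k j y * pd i f y := by
    simp only [Finset.sum_mul, Finset.mul_sum]
    rw [Finset.sum_comm]
    exact Finset.sum_congr rfl fun j _ => Finset.sum_congr rfl fun i _ => by ring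
  have h5 : ∑ j, hess γ f k j y * grad γ f j y = ∑ j, grad γ f j y * pd k (pd j f) y
      - ∑ j, grad γ f j y * ∑ i, christoffel γ i k j y * pd i f y := by
    rw [← Finset.sum_sub_distrib]
    exact Finset.sum_congr rfl fun j _ => by unfold hess; ring
  rw [h1]
  simp only [h2, Finset.sum_add_distrib, sub_mul, Finset.sum_sub_distrib]
  rw [h3, h4]
  linarith

/-- On vectors tangent to the level set, the second fundamental form is the Hessian divided by
the length of the gradient. -/
theorem IsMetricOn.secondForm_eq (h : IsMetricOn γ U) (hf : ContDiffOn ℝ ∞ f U) (hy : y ∈ U)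
    (hG : 0 < gradNormSq γ f y) (X : Fin n → ℝ) {Y : Fin n → ℝ} (hY : IsTangent f y Y) :
    secondForm γ f y X Y
      = form (fun i j => hess γ f i j y) X Y / Real.sqrt (gradNormSq γ f y) := by
  have hU := h.isOpen
  set s := Real.sqrt (gradNormSq γ f y) with hs
  have hspos : s ≠ 0 := (Real.sqrt_pos.mpr hG).ne'
  have hdN := fun k => differentiableAt_of_smooth hU (h.smooth_grad hf k) hy
  have hdG := differentiableAt_of_smooth hU (h.smooth_gradNormSq hf) hy
  have hds : DifferentiableAt ℝ (fun z => (Real.sqrt (gradNormSq γ f z))⁻¹) y :=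
    (hdG.sqrt hG.ne').inv hspos
  -- Product rule for `ν = |∇f|⁻¹ ∇f`. The term from differentiating `|∇f|⁻¹` is a multiple of `∇f`,
  -- hence disappears when paired with the tangent vector `Y`.
  have h1 : ∀ i k, covNormal γ f i k y = s⁻¹ * ∑ j, (γ y)⁻¹ k j * hess γ f i j y
      + pd i (fun z => (Real.sqrt (gradNormSq γ f z))⁻¹) y * grad γ f k y := by
    intro i k
    have e : unitNormal γ f k = fun z => grad γ f k z * (Real.sqrt (gradNormSq γ f z))⁻¹ := by
      ext z; simp only [unitNormal, div_eq_mul_inv]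
    have e2 : ∑ j, christoffel γ k i j y * unitNormal γ f j y
        = s⁻¹ * ∑ j, christoffel γ k i j y * grad γ f j y := by
      rw [Finset.mul_sum]
      exact Finset.sum_congr rfl fun j _ => by simp only [unitNormal, div_eq_mul_inv]; ring
    rw [covNormal, e2, e, pd_mul (hdN k) hds, ← h.cov_grad hf hy]
    ring
  have h2 : ∀ i, ∑ l, Y l * ∑ k, γ y k l * covNormal γ f i k y
      = s⁻¹ * ∑ l, hess γ f i l y * Y l := by
    intro i
    have hN : ∀ l, ∑ k, γ y k l * grad γ f k y = pd l f y := fun l => by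
      rw [← h.metric_grad hy]
      exact Finset.sum_congr rfl fun k _ => by rw [h.symm hy]
    have hP : ∀ l, ∑ k, γ y k l * ∑ j, (γ y)⁻¹ k j * hess γ f i j y = hess γ f i l y := by
      intro l
      have := congrFun (show (γ y).mulVec ((γ y)⁻¹.mulVec (fun j => hess γ f i j y))
        = fun j => hess γ f i j y by
          rw [Matrix.mulVec_mulVec, h.mul_inv hy, Matrix.one_mulVec]) l
      rw [← this]
      simp only [Matrix.mulVec, dotProduct]
      exact Finset.sum_congr rfl fun k _ => by rw [h.symm hy]
    have hl : ∀ l, ∑ k, γ y k l * covNormal γ f i k y = s⁻¹ * hess γ f i l y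
        + pd i (fun z => (Real.sqrt (gradNormSq γ f z))⁻¹) y * pd l f y := by
      intro l
      rw [← hN l, ← hP l, Finset.mul_sum, Finset.mul_sum, ← Finset.sum_add_distrib]
      exact Finset.sum_congr rfl fun k _ => by rw [h1]; ring
    have hY' : ∑ l, Y l * pd l f y = 0 := hY
    calc ∑ l, Y l * ∑ k, γ y k l * covNormal γ f i k y
        = ∑ l, (s⁻¹ * (hess γ f i l y * Y l)
          + pd i (fun z => (Real.sqrt (gradNormSq γ f z))⁻¹) y * (Y l * pd l f y)) :=
          Finset.sum_congr rfl fun l _ => by rw [hl]; ring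
      _ = _ := by
          rw [Finset.sum_add_distrib, ← Finset.mul_sum, ← Finset.mul_sum, hY', mul_zero, add_zero]
  calc secondForm γ f y X Y
      = ∑ i, X i * ∑ l, Y l * ∑ k, γ y k l * covNormal γ f i k y := by
        rw [secondForm, form_matrix_eq_sum_right]
        simp only [Finset.mul_sum]
        rw [Finset.sum_comm]
        calc _ = ∑ k, ∑ l, ∑ i, Y l * (γ y k l * (X i * covNormal γ f i k y)) := by rfl
          _ = ∑ i, ∑ l, ∑ k, Y l * (γ y k l * (X i * covNormal γ f i k y)) := by
            rw [Finset.sum_comm]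
            conv_rhs => rw [Finset.sum_comm]
            exact Finset.sum_congr rfl fun l _ => Finset.sum_comm
          _ = _ := Finset.sum_congr rfl fun i _ => Finset.sum_congr rfl fun l _ =>
            Finset.sum_congr rfl fun k _ => by ring
    _ = _ := by
        simp only [h2]
        rw [form_eq_sum_left, Finset.sum_div]
        exact Finset.sum_congr rfl fun i _ => by field_simp

end Gradient

/-! ## Contractions -/

section Contraction

variable {n : ℕ}

/-- Contraction of the second Bianchi identity for a Kulkarni–Nomizu product. -/
theorem contracted_bianchi (hn : 3 ≤ n) {g P : Matrix (Fin n) (Fin n) ℝ}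
    (hg : ∀ i j, g i j = g j i) (hP : ∀ i j, P i j = P j i) (hPg : P * g = 1)
    {V : Fin n → Fin n → Fin n → ℝ}
    (hV : ∀ p i j k l,
      (g i k * V p j l - g i l * V p j k - g j k * V p i l + g j l * V p i k)
      + (g j k * V i p l - g j l * V i p k - g p k * V i j l + g p l * V i j k)
      + (g p k * V j i l - g p l * V j i k - g i k * V j p l + g i l * V j p k) = 0) :
    (∀ p, ∑ i, ∑ k, P i k * (V i p k - V p i k) = 0) ∧
      ∀ p j l, ((n : ℝ) - 3) * (V p j l - V j p l) = 0 := by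
  have hδ : ∀ i j, ∑ k, P i k * g k j = if i = j then 1 else 0 := by
    intro i j
    have := congrFun (congrFun hPg i) j
    rwa [Matrix.mul_apply, Matrix.one_apply] at this
  have hA : ∀ (Y : Fin n → ℝ) j, ∑ i, ∑ k, P i k * (g j k * Y i) = Y j := by
    intro Y j
    have : ∀ i, ∑ k, P i k * (g j k * Y i) = (if i = j then 1 else 0) * Y i := by
      intro i
      rw [← hδ, Finset.sum_mul]
      exact Finset.sum_congr rfl fun k _ => by rw [hg j k]; ring
    simp [this]
  have hA' : ∀ (Y : Fin n → ℝ) j, ∑ i, ∑ k, P i k * (g i j * Y k) = Y j := by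
    intro Y j
    rw [Finset.sum_comm, ← hA Y j]
    exact Finset.sum_congr rfl fun i _ => Finset.sum_congr rfl fun k _ => by
      rw [hP i k, hg j k]
  have hB : ∀ c : ℝ, ∑ i, ∑ k, P i k * (g i k * c) = n * c := by
    intro c
    have : ∀ i, ∑ k, P i k * (g i k * c) = c := by
      intro i
      have h1 : ∑ k, P i k * g k i = 1 := by rw [hδ]; simp
      calc _ = (∑ k, P i k * g k i) * c := by
            rw [Finset.sum_mul]
            exact Finset.sum_congr rfl fun k _ => by rw [hg i k]; ring
        _ = c := by rw [h1, one_mul]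
    simp [this]
  -- `T` is the antisymmetrized derivative and `τ` its trace; for the Schouten tensor, `T` is the
  -- Cotton tensor up to the factor `n - 2`.
  set T : Fin n → Fin n → Fin n → ℝ := fun p j l => V p j l - V j p l with hT
  have hTa : ∀ p j l, T j p l = -T p j l := fun p j l => by simp [hT]
  set τ : Fin n → ℝ := fun p => ∑ i, ∑ k, P i k * T i p k with hτ
  have hτ' : ∀ p, ∑ i, ∑ k, P i k * T p i k = -τ p := by
    intro p
    simp only [hτ, ← Finset.sum_neg_distrib]
    exact Finset.sum_congr rfl fun i _ => Finset.sum_congr rfl fun k _ => by rw [hTa i p]; ring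
  have hC : ∀ (c : ℝ) (X : Fin n → Fin n → ℝ),
      ∑ i, ∑ k, P i k * (c * X i k) = c * ∑ i, ∑ k, P i k * X i k := by
    intro c X
    simp only [Finset.mul_sum]
    exact Finset.sum_congr rfl fun i _ => Finset.sum_congr rfl fun k _ => by ring
  -- Contraction of the cyclic identity over `i` and `k`.
  have h1 : ∀ p j l, ((n : ℝ) - 3) * T p j l - g j l * τ p + g p l * τ j = 0 := by
    intro p j l
    have h0 : ∑ i, ∑ k, P i k * (g i k * T p j l - g i l * T p j k + g j k * T i p l
        - g j l * T i p k + g p k * T j i l - g p l * T j i k) = 0 := by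
      refine Finset.sum_eq_zero fun i _ => Finset.sum_eq_zero fun k _ => ?_
      have : g i k * T p j l - g i l * T p j k + g j k * T i p l
        - g j l * T i p k + g p k * T j i l - g p l * T j i k = 0 := by
        rw [← hV p i j k l]; simp only [hT]; ring
      rw [this, mul_zero]
    simp only [mul_add, mul_sub, Finset.sum_add_distrib, Finset.sum_sub_distrib] at h0
    rw [hB, hA' (fun k => T p j k) l, hA (fun i => T i p l) j, hA (fun i => T j i l) p,
      hC (g j l) (fun i k => T i p k), hC (g p l) (fun i k => T j i k), hτ' j, hTa p j l] at h0
    change _ - _ + _ - g j l * τ p + _ - _ = 0 at h0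
    linarith
  -- A second contraction, over `j` and `l`, leaves a nonzero multiple of `(n - 2) τ`; with `τ = 0`
  -- the first contraction reduces to `(n - 3) T = 0`.
  have h2 : ∀ p, τ p = 0 := by
    intro p
    have h0 : ∑ j, ∑ l, P j l * (((n : ℝ) - 3) * T p j l - g j l * τ p + g p l * τ j) = 0 :=
      Finset.sum_eq_zero fun j _ => Finset.sum_eq_zero fun l _ => by rw [h1, mul_zero]
    simp only [mul_add, mul_sub, Finset.sum_add_distrib, Finset.sum_sub_distrib] at h0
    rw [hC ((n : ℝ) - 3) (fun j l => T p j l), hτ', hB, hA τ p] at h0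
    have h3 : ((n : ℝ) - 2) * τ p = 0 := by linarith
    have h4 : (3 : ℝ) ≤ n := by exact_mod_cast hn
    rcases mul_eq_zero.mp h3 with h5 | h5
    · linarith
    · exact h5
  refine ⟨h2, fun p j l => ?_⟩
  have := h1 p j l
  rw [h2, h2] at this
  simpa using this

/-- Full contraction of a 3-tensor with the inverse metric, computed in an orthonormal frame. -/
theorem contraction_eq_sum_sq {ι : Type*} [Fintype ι] {P : Matrix (Fin n) (Fin n) ℝ}
    {e : ι → Fin n → ℝ} (hP : ∀ i j, P i j = ∑ α, e α i * e α j)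
    (C : Fin n → Fin n → Fin n → ℝ) :
    ∑ i, ∑ j, ∑ k, ∑ a, ∑ b, ∑ c, P i a * P j b * P k c * C i j k * C a b c
      = ∑ α, ∑ β, ∑ δ, (∑ i, ∑ j, ∑ k, C i j k * e α i * e β j * e δ k) ^ 2 := by
  -- The case of a single index: the quadratic form of `E Eᵀ` is a sum of squares. It is applied
  -- with triples as indices.
  have key : ∀ (κ μ : Type _) [Fintype κ] [Fintype μ] (E : κ → μ → ℝ) (F : μ → ℝ),
      ∑ x, ∑ z, (∑ A, E A x * E A z) * F x * F z = ∑ A, (∑ x, F x * E A x) ^ 2 := by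
    intro κ μ _ _ E F
    have hsq : ∀ A, (∑ x, F x * E A x) ^ 2 = ∑ x, ∑ z, F x * E A x * (F z * E A z) := fun A => by
      rw [sq, Finset.sum_mul_sum]
    simp only [hsq, Finset.sum_mul]
    calc _ = ∑ x, ∑ A, ∑ z, E A x * E A z * F x * F z :=
          Finset.sum_congr rfl fun z _ => Finset.sum_comm
      _ = ∑ A, ∑ x, ∑ z, E A x * E A z * F x * F z := Finset.sum_comm
      _ = _ := Finset.sum_congr rfl fun A _ => Finset.sum_congr rfl fun x _ =>
        Finset.sum_congr rfl fun z _ => by ring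
  have h := key (ι × ι × ι) (Fin n × Fin n × Fin n)
    (fun A x => e A.1 x.1 * e A.2.1 x.2.1 * e A.2.2 x.2.2) (fun x => C x.1 x.2.1 x.2.2)
  simp only [Fintype.sum_prod_type] at h
  have h2 : ∀ i j k a b c, ∑ α, ∑ β, ∑ δ, e α i * e β j * e δ k * (e α a * e β b * e δ c)
      = P i a * P j b * P k c := by
    intro i j k a b c
    rw [hP, hP, hP, Finset.sum_mul_sum, Finset.sum_mul]
    refine Finset.sum_congr rfl fun α _ => ?_
    rw [Finset.sum_mul_sum]
    exact Finset.sum_congr rfl fun β _ => Finset.sum_congr rfl fun δ _ => by ring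
  simp only [h2] at h
  rw [h]
  simp only [mul_assoc]

end Contraction

/-! ## Gradient Ricci solitons with vanishing Weyl tensor, in coordinates -/

/-- `(γ, f)` is a gradient Ricci soliton with vanishing Weyl tensor on the open set `U`. -/
structure IsFlatSolitonOn {n : ℕ} (γ : EuclideanSpace ℝ (Fin n) → Matrix (Fin n) (Fin n) ℝ)
    (f : EuclideanSpace ℝ (Fin n) → ℝ) (ρ : ℝ) (U : Set (EuclideanSpace ℝ (Fin n))) : Prop where
  three_le : 3 ≤ n
  metric : IsMetricOn γ U
  smooth : ContDiffOn ℝ ∞ f U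
  eqn : ∀ y ∈ U, ∀ i j, ric γ i j y = hess γ f i j y + ρ * γ y i j
  weyl_eq_zero : ∀ y ∈ U, ∀ i j k l, weyl γ i j k l y = 0

/-- The matrix of the Ricci tensor. -/
noncomputable def ricMat {n : ℕ} (γ : EuclideanSpace ℝ (Fin n) → Matrix (Fin n) (Fin n) ℝ)
    (y : EuclideanSpace ℝ (Fin n)) : Matrix (Fin n) (Fin n) ℝ :=
  Matrix.of fun i j => ric γ i j y

/-- The Schouten tensor. -/
noncomputable def schouten {n : ℕ} (γ : EuclideanSpace ℝ (Fin n) → Matrix (Fin n) (Fin n) ℝ)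
    (y : EuclideanSpace ℝ (Fin n)) : Matrix (Fin n) (Fin n) ℝ :=
  Matrix.of fun i j => 1 / ((n : ℝ) - 2) * (ric γ i j y - scal γ y / (2 * ((n : ℝ) - 1)) * γ y i j)

section FlatSoliton

variable {n : ℕ} {γ : EuclideanSpace ℝ (Fin n) → Matrix (Fin n) (Fin n) ℝ}
  {U : Set (EuclideanSpace ℝ (Fin n))} {y : EuclideanSpace ℝ (Fin n)}
  {f : EuclideanSpace ℝ (Fin n) → ℝ} {ρ : ℝ}

theorem IsFlatSolitonOn.two_lt (h : IsFlatSolitonOn γ f ρ U) : (2 : ℝ) < n := by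
  have := h.three_le
  have h' : (3 : ℝ) ≤ n := by exact_mod_cast this
  linarith

theorem covRic_eq_covMat (k i j : Fin n) : covRic γ k i j y = covMat γ (ricMat γ) k y i j := by
  rw [covMat_apply]; rfl

/-- Read off from the symmetry of the Hessian through the soliton equation, which bypasses the pair
symmetry of the Riemann tensor. -/
theorem IsFlatSolitonOn.ric_symm (h : IsFlatSolitonOn γ f ρ U) (hy : y ∈ U) (i j : Fin n) :
    ric γ i j y = ric γ j i y := by
  rw [h.eqn y hy, h.eqn y hy, h.metric.hess_symm h.smooth hy, h.metric.symm hy]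

theorem IsFlatSolitonOn.smooth_ricMat (h : IsFlatSolitonOn γ f ρ U) : SmoothMat U (ricMat γ) := by
  intro i j
  refine ContDiffOn.congr (f := fun z => hess γ f i j z + ρ * γ z i j) ?_ fun z hz => h.eqn z hz i j
  exact (h.metric.smooth_hessMat h.smooth i j).add (contDiffOn_const.mul (h.metric.smooth i j))

theorem IsFlatSolitonOn.smooth_scal (h : IsFlatSolitonOn γ f ρ U) :
    ContDiffOn ℝ ∞ (scal γ) U := by
  unfold scal
  exact ContDiffOn.sum fun i _ => ContDiffOn.sum fun k _ =>
    (h.metric.smooth_inv i k).mul (h.smooth_ricMat i k)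

theorem IsFlatSolitonOn.smooth_schouten (h : IsFlatSolitonOn γ f ρ U) :
    SmoothMat U (schouten γ) := fun i j =>
  contDiffOn_const.mul ((h.smooth_ricMat i j).sub
    ((h.smooth_scal.div_const _).mul (h.metric.smooth i j)))

/-- The term `ρ g` is parallel and contributes nothing. -/
theorem IsFlatSolitonOn.covMat_ricMat (h : IsFlatSolitonOn γ f ρ U) (hy : y ∈ U) (k i j : Fin n) :
    covMat γ (ricMat γ) k y i j = covMat γ (hessMat γ f) k y i j := by
  have hU := h.metric.isOpen
  have hh : DifferentiableAt ℝ (fun z => hess γ f i j z) y :=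
    differentiableAt_of_smooth hU (h.metric.smooth_hessMat h.smooth i j) hy
  simp only [covMat_apply, ricMat, hessMat, Matrix.of_apply]
  rw [pd_congr_on hU hy (fun z hz => h.eqn z hz i j),
    pd_add hh ((differentiableAt_of_smooth hU (h.metric.smooth i j) hy).const_mul ρ),
    pd_const_mul ρ (differentiableAt_of_smooth hU (h.metric.smooth i j) hy), h.metric.pd_metric hy,
    Finset.mul_sum]
  simp only [h.eqn y hy]
  have e : ∀ a b c d : ℝ, b - c = -d → a + b - c = a - d := by intros; linarith
  apply e
  rw [← Finset.sum_sub_distrib, ← Finset.sum_neg_distrib]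
  exact Finset.sum_congr rfl fun m _ => by ring

theorem IsFlatSolitonOn.covMat_schouten (h : IsFlatSolitonOn γ f ρ U) (hy : y ∈ U)
    (k i j : Fin n) :
    covMat γ (schouten γ) k y i j = 1 / ((n : ℝ) - 2) * (covRic γ k i j y
      - pd k (scal γ) y / (2 * ((n : ℝ) - 1)) * γ y i j) := by
  have hU := h.metric.isOpen
  have hr : DifferentiableAt ℝ (ric γ i j) y :=
    differentiableAt_of_smooth hU (h.smooth_ricMat i j) hy
  have hs := differentiableAt_of_smooth hU h.smooth_scal hy
  have hγ := differentiableAt_of_smooth hU (h.metric.smooth i j) hy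
  set c := 2 * ((n : ℝ) - 1)
  have h1 : pd k (fun z => schouten γ z i j) y = 1 / ((n : ℝ) - 2) * (pd k (ric γ i j) y
      - (c⁻¹ * pd k (scal γ) y * γ y i j + c⁻¹ * scal γ y * pd k (fun z => γ z i j) y)) := by
    have e : (fun z => schouten γ z i j)
        = fun z => 1 / ((n : ℝ) - 2) * (ric γ i j z - c⁻¹ * scal γ z * γ z i j) := by
      ext z; simp only [schouten, Matrix.of_apply, c]; ring
    rw [e, pd_const_mul _ (DifferentiableAt.fun_sub hr ((hs.const_mul _).fun_mul hγ)),
      pd_sub hr ((hs.const_mul _).fun_mul hγ), pd_mul (hs.const_mul _) hγ, pd_const_mul _ hs]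
  rw [covMat_apply, h1, h.metric.pd_metric hy]
  simp only [schouten, Matrix.of_apply, covRic]
  rw [Finset.mul_sum]
  have e : ∀ a d s t u v : ℝ, -(a * s) - t = -(a * u) →
      a * (d - (v + s)) - t = a * (d - u - v) := by
    intros; linarith
  have hv : c⁻¹ * pd k (scal γ) y * γ y i j = pd k (scal γ) y / c * γ y i j := by ring
  rw [hv]
  apply e
  rw [Finset.mul_sum, Finset.mul_sum, ← Finset.sum_neg_distrib, ← Finset.sum_neg_distrib,
    ← Finset.sum_sub_distrib]
  exact Finset.sum_congr rfl fun m _ => by ring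

/-- The equation `W = 0` with the scalar curvature term shared equally among the four Schouten
terms. -/
theorem IsFlatSolitonOn.riem_eq (h : IsFlatSolitonOn γ f ρ U) (hy : y ∈ U) (i j k l : Fin n) :
    riem γ i j k l y = γ y i k * schouten γ y j l - γ y i l * schouten γ y j k
      - γ y j k * schouten γ y i l + γ y j l * schouten γ y i k := by
  have h1 := h.weyl_eq_zero y hy i j k l
  have h2 := h.two_lt
  have h3 : (n : ℝ) - 2 ≠ 0 := by linarith
  have h4 : (n : ℝ) - 1 ≠ 0 := by linarith
  unfold weyl at h1
  simp only [schouten, Matrix.of_apply]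
  field_simp at h1 ⊢
  linarith

theorem IsFlatSolitonOn.covRic_symm (h : IsFlatSolitonOn γ f ρ U) (hy : y ∈ U) (k i j : Fin n) :
    covRic γ k i j y = covRic γ k j i y := by
  unfold covRic
  rw [pd_congr_on h.metric.isOpen hy (fun z hz => h.ric_symm hz i j)]
  congr 1
  refine Finset.sum_congr rfl fun m _ => ?_
  rw [h.ric_symm hy m j, h.ric_symm hy i m]
  ring

theorem IsFlatSolitonOn.cotton_eq_schouten (h : IsFlatSolitonOn γ f ρ U) (hy : y ∈ U)
    (i j k : Fin n) :
    cotton γ i j k y = ((n : ℝ) - 2) *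
      (covMat γ (schouten γ) k y j i - covMat γ (schouten γ) j y k i) := by
  have h2 := h.two_lt
  have h3 : (n : ℝ) - 2 ≠ 0 := by linarith
  have h4 : (n : ℝ) - 1 ≠ 0 := by linarith
  rw [h.covMat_schouten hy, h.covMat_schouten hy, h.covRic_symm hy k, h.covRic_symm hy j, cotton,
    h.metric.symm hy j, h.metric.symm hy k]
  field_simp
  ring

/-- The second Bianchi identity only involves `∇S`, since the curvature is a product of the parallel
metric with `S`. -/
theorem IsFlatSolitonOn.schouten_bianchi (h : IsFlatSolitonOn γ f ρ U) (hy : y ∈ U) :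
    (∀ p, ∑ i, ∑ k, (γ y)⁻¹ i k *
        (covMat γ (schouten γ) i y p k - covMat γ (schouten γ) p y i k) = 0) ∧
      ∀ p j l, ((n : ℝ) - 3) *
        (covMat γ (schouten γ) p y j l - covMat γ (schouten γ) j y p l) = 0 := by
  refine contracted_bianchi h.three_le (h.metric.symm hy) (h.metric.inv_symm hy)
    (h.metric.inv_mul hy) (V := fun p j l => covMat γ (schouten γ) p y j l) ?_
  intro p i j k l
  have hR : ∀ z ∈ U, ∀ i j k l, riem γ i j k l z = _ := fun z hz i j k l => h.riem_eq hz i j k l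
  have h1 := h.metric.bianchi hy p i j k l
  rw [h.metric.covRiem_of_kulkarniNomizu hy h.smooth_schouten hR,
    h.metric.covRiem_of_kulkarniNomizu hy h.smooth_schouten hR,
    h.metric.covRiem_of_kulkarniNomizu hy h.smooth_schouten hR] at h1
  exact h1

/-- In dimension at least four the Cotton tensor vanishes together with the Weyl tensor. -/
theorem IsFlatSolitonOn.cotton_eq_zero (h : IsFlatSolitonOn γ f ρ U) (hn : n ≠ 3) (hy : y ∈ U)
    (i j k : Fin n) : cotton γ i j k y = 0 := by
  have h1 := (h.schouten_bianchi hy).2 k j i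
  have h2 : (n : ℝ) - 3 ≠ 0 := by
    intro h0
    exact hn (by exact_mod_cast (sub_eq_zero.mp h0 : (n : ℝ) = 3))
  rw [h.cotton_eq_schouten hy, (mul_eq_zero.mp h1).resolve_left h2, mul_zero]

/-- Equivalent to the contracted Bianchi identity `div Rc = dR / 2`, obtained here from the
Kulkarni–Nomizu form of the curvature. -/
theorem IsFlatSolitonOn.trace_cotton (h : IsFlatSolitonOn γ f ρ U) (hy : y ∈ U) (k : Fin n) :
    ∑ j, ∑ i, (γ y)⁻¹ j i * cotton γ i j k y = 0 := by
  have h1 := (h.schouten_bianchi hy).1 k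
  have h2 : ∑ j, ∑ i, (γ y)⁻¹ j i * cotton γ i j k y = -((n : ℝ) - 2) * ∑ i, ∑ k', (γ y)⁻¹ i k' *
        (covMat γ (schouten γ) i y k k' - covMat γ (schouten γ) k y i k') := by
    simp only [Finset.mul_sum]
    exact Finset.sum_congr rfl fun j _ => Finset.sum_congr rfl fun i _ => by
      rw [h.cotton_eq_schouten hy]; ring
  rw [h2, h1, mul_zero]

/-! ### The Cotton tensor of a soliton, expressed through the gradient. -/

/-- The 1-form `Rc(∇f, ·)`. -/
noncomputable def ricGrad (γ : EuclideanSpace ℝ (Fin n) → Matrix (Fin n) (Fin n) ℝ)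
    (f : EuclideanSpace ℝ (Fin n) → ℝ) (k : Fin n) (y : EuclideanSpace ℝ (Fin n)) : ℝ :=
  ∑ m, ric γ k m y * grad γ f m y

theorem IsMetricOn.sum_curvOp_mul_pd (h : IsMetricOn γ U) (hy : y ∈ U) (i j k : Fin n) :
    ∑ t, curvOp γ t k j i y * pd t f y = ∑ m, riem γ k j m i y * grad γ f m y := by
  simp only [riem, Finset.sum_mul]
  rw [Finset.sum_comm]
  refine Finset.sum_congr rfl fun t _ => ?_
  rw [← h.metric_grad hy, Finset.mul_sum]
  exact Finset.sum_congr rfl fun m _ => by rw [h.symm hy]; ring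

/-- The derivatives of `Rc` are those of the Hessian, and the Ricci identity evaluates their
antisymmetrization. -/
theorem IsFlatSolitonOn.cotton_eq_riem (h : IsFlatSolitonOn γ f ρ U) (hy : y ∈ U)
    (i j k : Fin n) :
    cotton γ i j k y = -∑ m, riem γ k j m i y * grad γ f m y
      - 1 / (2 * ((n : ℝ) - 1)) * (γ y i j * pd k (scal γ) y - γ y i k * pd j (scal γ) y) := by
  rw [cotton, covRic_eq_covMat, covRic_eq_covMat, h.covMat_ricMat hy, h.covMat_ricMat hy,
    h.metric.covMat_hess_sub h.smooth hy, h.metric.sum_curvOp_mul_pd hy]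

theorem IsMetricOn.sum_inv_mul_metric (h : IsMetricOn γ U) (hy : y ∈ U) (i j : Fin n) :
    ∑ k, (γ y)⁻¹ i k * γ y k j = if i = j then 1 else 0 := by
  have := congrFun (congrFun (h.inv_mul hy) i) j
  rwa [Matrix.mul_apply, Matrix.one_apply] at this

theorem IsMetricOn.trace_metric (h : IsMetricOn γ U) (hy : y ∈ U) :
    ∑ i, ∑ k, (γ y)⁻¹ i k * γ y i k = n := by
  have : ∀ i, ∑ k, (γ y)⁻¹ i k * γ y i k = 1 := fun i => by
    simp only [h.symm hy i, h.sum_inv_mul_metric hy, if_true]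
  simp [this]

/-- `∇R = -2 Rc(∇f)` on a gradient Ricci soliton `Rc = ∇²f + ρ g`. -/
theorem IsFlatSolitonOn.pd_scal (h : IsFlatSolitonOn γ f ρ U) (hy : y ∈ U) (k : Fin n) :
    pd k (scal γ) y = -2 * ricGrad γ f k y := by
  have h2 := h.two_lt
  have h4 : (n : ℝ) - 1 ≠ 0 := by linarith
  -- In the trace over `i`, `j` the curvature term becomes `-Rc(∇f)`, and the scalar terms add up to
  -- `-(n - 1) ∇R / (2 (n - 1))`.
  have h1 := h.trace_cotton hy k
  simp only [h.cotton_eq_riem hy] at h1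
  have e1 : ∑ j, ∑ i, (γ y)⁻¹ j i * ∑ m, riem γ k j m i y * grad γ f m y = ricGrad γ f k y := by
    simp only [ricGrad, ric, Finset.mul_sum, Finset.sum_mul]
    calc _ = ∑ j, ∑ m, ∑ i, (γ y)⁻¹ j i * (riem γ k j m i y * grad γ f m y) :=
          Finset.sum_congr rfl fun j _ => Finset.sum_comm
      _ = ∑ m, ∑ j, ∑ i, (γ y)⁻¹ j i * (riem γ k j m i y * grad γ f m y) := Finset.sum_comm
      _ = _ := Finset.sum_congr rfl fun m _ => Finset.sum_congr rfl fun j _ =>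
          Finset.sum_congr rfl fun i _ => by ring
  have e2 : ∑ j, ∑ i, (γ y)⁻¹ j i * (γ y i j * pd k (scal γ) y) = n * pd k (scal γ) y := by
    rw [← h.metric.trace_metric hy]
    simp only [Finset.sum_mul]
    exact Finset.sum_congr rfl fun j _ => Finset.sum_congr rfl fun i _ => by
      rw [h.metric.symm hy i j]; ring
  have e3 : ∑ j, ∑ i, (γ y)⁻¹ j i * (γ y i k * pd j (scal γ) y) = pd k (scal γ) y := by
    have : ∀ j, ∑ i, (γ y)⁻¹ j i * (γ y i k * pd j (scal γ) y)
        = (if j = k then 1 else 0) * pd j (scal γ) y := fun j => by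
      rw [← h.metric.sum_inv_mul_metric hy, Finset.sum_mul]
      exact Finset.sum_congr rfl fun i _ => by ring
    simp [this]
  have e4 : ∀ (Q B C : Fin n → Fin n → ℝ) (c : ℝ),
      ∑ j, ∑ i, (γ y)⁻¹ j i * (-Q j i - c * (B j i - C j i))
        = -∑ j, ∑ i, (γ y)⁻¹ j i * Q j i
          - c * (∑ j, ∑ i, (γ y)⁻¹ j i * B j i - ∑ j, ∑ i, (γ y)⁻¹ j i * C j i) := by
    intro Q B C c
    simp only [Finset.mul_sum, ← Finset.sum_neg_distrib, ← Finset.sum_sub_distrib]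
    exact Finset.sum_congr rfl fun j _ => Finset.sum_congr rfl fun i _ => by ring
  rw [e4 (fun j i => ∑ m, riem γ k j m i y * grad γ f m y) (fun j i => γ y i j * pd k (scal γ) y)
    (fun j i => γ y i k * pd j (scal γ) y), e1, e2, e3] at h1
  field_simp at h1
  linarith

/-- The Cotton tensor in terms of the Ricci tensor and the gradient. -/
theorem IsFlatSolitonOn.cotton_eq (h : IsFlatSolitonOn γ f ρ U) (hy : y ∈ U) (i j k : Fin n) :
    cotton γ i j k y = 1 / ((n : ℝ) - 2) * (pd j f y * ric γ i k y - pd k f y * ric γ i j y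
      + 1 / ((n : ℝ) - 1) * (γ y i k * ricGrad γ f j y - γ y i j * ricGrad γ f k y)
      - scal γ y / ((n : ℝ) - 1) * (γ y i k * pd j f y - γ y i j * pd k f y)) := by
  have h2 := h.two_lt
  have h3 : (n : ℝ) - 2 ≠ 0 := by linarith
  have h4 : (n : ℝ) - 1 ≠ 0 := by linarith
  set S := schouten γ y with hS
  have hSg : ∀ j, ∑ m, S j m * grad γ f m y = 1 / ((n : ℝ) - 2) * (ricGrad γ f j y
      - scal γ y / (2 * ((n : ℝ) - 1)) * pd j f y) := by
    intro j
    rw [← h.metric.metric_grad hy, ricGrad, Finset.mul_sum, ← Finset.sum_sub_distrib,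
      Finset.mul_sum]
    exact Finset.sum_congr rfl fun m _ => by simp only [hS, schouten, Matrix.of_apply]; ring
  -- The Kulkarni–Nomizu form of the curvature contracted with `∇f`: the metric turns `∇f` into
  -- `df`, and `S` turns it into the 1-form computed in `hSg`.
  have h5 : ∑ m, riem γ k j m i y * grad γ f m y
      = pd k f y * S j i - γ y k i * (∑ m, S j m * grad γ f m y)
        - pd j f y * S k i + γ y j i * (∑ m, S k m * grad γ f m y) := by
    rw [← h.metric.metric_grad hy k, ← h.metric.metric_grad hy j]
    simp only [Finset.sum_mul, Finset.mul_sum, ← Finset.sum_sub_distrib, ← Finset.sum_add_distrib]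
    exact Finset.sum_congr rfl fun m _ => by rw [h.riem_eq hy]; ring
  rw [h.cotton_eq_riem hy, h5, hSg, hSg, h.pd_scal hy, h.pd_scal hy, h.metric.symm hy k i,
    h.metric.symm hy j i, hS]
  simp only [schouten, Matrix.of_apply]
  rw [h.ric_symm hy j i, h.ric_symm hy k i, h.metric.symm hy k i, h.metric.symm hy j i]
  field_simp
  ring

end FlatSoliton

/-! ## The norm of the Cotton tensor in an adapted frame -/

section Frame

variable {n : ℕ}

/-- Completeness of an orthonormal basis. -/
theorem inv_eq_sum_of_orthonormal {ι : Type*} [Fintype ι] [DecidableEq ι]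
    (hι : Fintype.card ι = n) {g : Matrix (Fin n) (Fin n) ℝ} {e : ι → Fin n → ℝ}
    (he : ∀ a b, form g (e a) (e b) = if a = b then 1 else 0) (i j : Fin n) :
    g⁻¹ i j = ∑ a, e a i * e a j := by
  set B : Matrix (Fin n) ι ℝ := Matrix.of fun i a => e a i with hB
  -- Orthonormality is `Bᵀ g B = 1`. As `B` is square up to relabelling, the factors commute and `B
  -- Bᵀ` is the inverse of `g`.
  have h1 : B.transpose * g * B = 1 := by
    ext a b
    rw [Matrix.one_apply, ← he, form_matrix_eq_sum_right]
    simp only [Matrix.mul_apply, Matrix.transpose_apply, hB, Matrix.of_apply, Finset.sum_mul,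
      Finset.mul_sum]
    exact Finset.sum_congr rfl fun k _ => Finset.sum_congr rfl fun l _ => by ring
  have heq : ι ≃ Fin n := Fintype.equivFinOfCardEq hι
  have h2 : B * (B.transpose * g) = 1 := (Matrix.mul_eq_one_comm_of_equiv heq).mp h1
  rw [← Matrix.mul_assoc] at h2
  rw [Matrix.inv_eq_left_inv h2]
  simp [Matrix.mul_apply, hB]

theorem sum_mul_form_mid (a : Fin n → ℝ) (T : Fin n → Fin n → ℝ) (X Y Z : Fin n → ℝ) :
    ∑ i, ∑ j, ∑ k, a j * T i k * X i * Y j * Z k = (∑ j, Y j * a j) * form T X Z := by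
  rw [form, Finset.sum_comm, Finset.sum_mul]
  refine Finset.sum_congr rfl fun j _ => ?_
  simp only [Finset.mul_sum]
  exact Finset.sum_congr rfl fun i _ => Finset.sum_congr rfl fun k _ => by ring

theorem sum_mul_form_last (a : Fin n → ℝ) (T : Fin n → Fin n → ℝ) (X Y Z : Fin n → ℝ) :
    ∑ i, ∑ j, ∑ k, a k * T i j * X i * Y j * Z k = (∑ k, Z k * a k) * form T X Y := by
  rw [← sum_mul_form_mid]
  refine Finset.sum_congr rfl fun i _ => ?_
  rw [Finset.sum_comm]
  exact Finset.sum_congr rfl fun i _ => Finset.sum_congr rfl fun k _ => by ring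

theorem sum_sq_delta_sub_delta {κ : Type*} [Fintype κ] [DecidableEq κ] (u : κ → ℝ) :
    ∑ a : κ, ∑ b : κ, ∑ c : κ,
        ((if a = c then 1 else 0) * u b - (if a = b then 1 else 0) * u c) ^ 2
      = 2 * ((Fintype.card κ : ℝ) - 1) * ∑ a, u a ^ 2 := by
  have h : ∀ a b c : κ, ((if a = c then 1 else 0) * u b - (if a = b then 1 else 0) * u c) ^ 2
      = (if a = c then u b ^ 2 else 0) + (if a = b then u c ^ 2 else 0)
        - 2 * (if a = c then (if a = b then u b * u c else 0) else 0) := by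
    intro a b c
    split_ifs <;> ring
  simp only [h, Finset.sum_add_distrib, Finset.sum_sub_distrib, ← Finset.mul_sum]
  simp
  simp only [sq]
  ring

/-- The norm of the Cotton tensor in a frame consisting of the unit normal (`none`) and an
orthonormal basis of the level set: `r` is the Ricci tensor and `s = |∇f|`. -/
theorem sum_sq_cotton_frame {κ : Type*} [Fintype κ] [DecidableEq κ] {N : ℝ}
    (hN : N = Fintype.card κ + 1) (hN2 : 2 < N) (s : ℝ) (r : Option κ → Option κ → ℝ)
    (hr : ∀ α β, r α β = r β α) :
    ∑ α, ∑ β, ∑ δ, (1 / (N - 2) * ((if β = none then s else 0) * r α δ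
        - (if δ = none then s else 0) * r α β
        + 1 / (N - 1) * ((if α = δ then 1 else 0) * (s * r β none)
          - (if α = β then 1 else 0) * (s * r δ none))
        - (∑ α, r α α) / (N - 1) * ((if α = δ then 1 else 0) * (if β = none then s else 0)
          - (if α = β then 1 else 0) * (if δ = none then s else 0)))) ^ 2
      = 2 * s ^ 2 / (N - 2) ^ 2 * ∑ a : κ, ∑ b : κ, (r (some a) (some b)
          - (∑ c, r (some c) (some c)) / (N - 1) * (if a = b then 1 else 0)) ^ 2
        + 2 * s ^ 2 / ((N - 1) * (N - 2)) * ∑ a, r (some a) none ^ 2 := by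
  have h1 : N - 1 ≠ 0 := by linarith
  have h2 : N - 2 ≠ 0 := by linarith
  -- `t` is the trace of Ricci along the level set, `q` its mixed part and `w` its trace-free
  -- tangential part.
  set t := ∑ c, r (some c) (some c) with ht
  set q : κ → ℝ := fun a => r (some a) none with hq
  have hq' : ∀ a, r none (some a) = q a := fun a => hr _ _
  set w : κ → κ → ℝ := fun a b => r (some a) (some b) - t / (N - 1) * (if a = b then 1 else 0)
  have e1 : ∀ a b : κ, 1 / (N - 2) * (s * r (some a) (some b)
      + 1 / (N - 1) * ((if a = b then 1 else 0) * (s * r none none))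
      - (r none none + t) / (N - 1) * ((if a = b then 1 else 0) * s)) = s / (N - 2) * w a b := by
    intro a b
    simp only [w]
    split_ifs <;> field_simp <;> ring
  have e2 : ∀ a b c : κ, 1 / (N - 2) * (1 / (N - 1) * ((if a = c then 1 else 0) * (s * q b)
      - (if a = b then 1 else 0) * (s * q c)))
      = s / ((N - 1) * (N - 2)) * ((if a = c then 1 else 0) * q b
        - (if a = b then 1 else 0) * q c) := by
    intro a b c
    field_simp
  have e3 : ∀ c, 1 / (N - 2) * (s * q c - 1 / (N - 1) * (s * q c)) = s / (N - 1) * q c := by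
    intro c; field_simp; ring
  -- The squared components by type of index. Those with one tangential index next to two normal
  -- ones (`f1`, `f2`) and the purely tangential ones (`f5`) see `q`; those with the normal in the
  -- second or third slot only (`f3`, `f4`) see `w`; `g1`, `g2`, `g3` vanish.
  have f1 : ∀ c, (1 / (N - 2) * (s * r none (some c) - 0 * r none none
      + 1 / (N - 1) * (0 * (s * r none none) - 1 * (s * r (some c) none))
      - (r none none + t) / (N - 1) * (0 * s - 1 * 0))) ^ 2 = s ^ 2 / (N - 1) ^ 2 * q c ^ 2 := by
    intro c
    rw [hq', show r (some c) none = q c from rfl]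
    calc _ = (1 / (N - 2) * (s * q c - 1 / (N - 1) * (s * q c))) ^ 2 := by ring
      _ = _ := by rw [e3, mul_pow, div_pow]
  have f2 : ∀ c, (1 / (N - 2) * (0 * r none none - s * r none (some c)
      + 1 / (N - 1) * (1 * (s * r (some c) none) - 0 * (s * r none none))
      - (r none none + t) / (N - 1) * (1 * 0 - 0 * s))) ^ 2 = s ^ 2 / (N - 1) ^ 2 * q c ^ 2 := by
    intro c
    rw [hq', show r (some c) none = q c from rfl]
    calc _ = (1 / (N - 2) * (s * q c - 1 / (N - 1) * (s * q c))) ^ 2 := by ring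
      _ = _ := by rw [e3, mul_pow, div_pow]
  have f3 : ∀ a b, (1 / (N - 2) * (s * r (some a) (some b) - 0 * r (some a) none
      + 1 / (N - 1) * ((if a = b then 1 else 0) * (s * r none none) - 0 * (s * r (some b) none))
      - (r none none + t) / (N - 1) * ((if a = b then 1 else 0) * s - 0 * 0))) ^ 2
      = s ^ 2 / (N - 2) ^ 2 * w a b ^ 2 := by
    intro a b
    calc _ = (1 / (N - 2) * (s * r (some a) (some b)
      + 1 / (N - 1) * ((if a = b then 1 else 0) * (s * r none none))
      - (r none none + t) / (N - 1) * ((if a = b then 1 else 0) * s))) ^ 2 := by ring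
      _ = _ := by rw [e1, mul_pow, div_pow]
  have f4 : ∀ a b, (1 / (N - 2) * (0 * r (some a) none - s * r (some a) (some b)
      + 1 / (N - 1) * (0 * (s * r (some b) none) - (if a = b then 1 else 0) * (s * r none none))
      - (r none none + t) / (N - 1) * (0 * 0 - (if a = b then 1 else 0) * s))) ^ 2
      = s ^ 2 / (N - 2) ^ 2 * w a b ^ 2 := by
    intro a b
    calc _ = (1 / (N - 2) * (s * r (some a) (some b)
      + 1 / (N - 1) * ((if a = b then 1 else 0) * (s * r none none))
      - (r none none + t) / (N - 1) * ((if a = b then 1 else 0) * s))) ^ 2 := by ring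
      _ = _ := by rw [e1, mul_pow, div_pow]
  have f5 : ∀ a b c, (1 / (N - 2) * (0 * r (some a) (some c) - 0 * r (some a) (some b)
      + 1 / (N - 1) * ((if a = c then 1 else 0) * (s * r (some b) none)
        - (if a = b then 1 else 0) * (s * r (some c) none))
      - (r none none + t) / (N - 1) * ((if a = c then 1 else 0) * 0
        - (if a = b then 1 else 0) * 0))) ^ 2
      = s ^ 2 / ((N - 1) * (N - 2)) ^ 2 * ((if a = c then 1 else 0) * q b
        - (if a = b then 1 else 0) * q c) ^ 2 := by
    intro a b c
    calc _ = (1 / (N - 2) * (1 / (N - 1) * ((if a = c then 1 else 0) * (s * q b)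
      - (if a = b then 1 else 0) * (s * q c)))) ^ 2 := by simp only [hq]; ring
      _ = _ := by rw [e2, mul_pow, div_pow]
  have g1 : (1 / (N - 2) * (s * r none none - s * r none none
      + 1 / (N - 1) * (1 * (s * r none none) - 1 * (s * r none none))
      - (r none none + t) / (N - 1) * (1 * s - 1 * s))) ^ 2 = 0 := by ring
  have g2 : ∀ a, (1 / (N - 2) * (s * r (some a) none - s * r (some a) none
      + 1 / (N - 1) * (0 * (s * r none none) - 0 * (s * r none none))
      - (r none none + t) / (N - 1) * (0 * s - 0 * s))) ^ 2 = 0 := by intro a; ring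
  have g3 : ∀ b c, (1 / (N - 2) * (0 * r none (some c) - 0 * r none (some b)
      + 1 / (N - 1) * (0 * (s * r (some b) none) - 0 * (s * r (some c) none))
      - (r none none + t) / (N - 1) * (0 * 0 - 0 * 0))) ^ 2 = 0 := by intro b c; ring
  have hn1 : ∀ a : κ, (some a = none) = False := fun a => by simp
  have hn2 : ∀ a : κ, (none = some a) = False := fun a => by simp
  have hn3 : ∀ a b : κ, (some a = some b) = (a = b) := fun a b => by simp
  simp only [Fintype.sum_option, hn1, hn2, hn3, if_true, if_false, ← ht]
  simp only [f1, f2, f3, f4, f5, g1, g2, g3, Finset.sum_add_distrib, ← Finset.mul_sum,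
    sum_sq_delta_sub_delta, Finset.sum_const_zero]
  -- The coefficients of `|q|²` combine by `1 / (N - 1)² + 1 / ((N - 1)² (N - 2)) = 1 / ((N - 1) (N
  -- - 2))`.
  have hc : (Fintype.card κ : ℝ) = N - 1 := by linarith
  rw [hc]
  change _ = 2 * s ^ 2 / (N - 2) ^ 2 * ∑ a, ∑ b, w a b ^ 2
    + 2 * s ^ 2 / ((N - 1) * (N - 2)) * ∑ a, q a ^ 2
  generalize ∑ a, ∑ b, w a b ^ 2 = A
  generalize ∑ a, q a ^ 2 = B
  field_simp
  ring

end Frame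

/-! ### The norm of the Cotton tensor through the geometry of the level set. -/

section LevelSet

variable {n : ℕ} {γ : EuclideanSpace ℝ (Fin n) → Matrix (Fin n) (Fin n) ℝ}
  {U : Set (EuclideanSpace ℝ (Fin n))} {y : EuclideanSpace ℝ (Fin n)}
  {f : EuclideanSpace ℝ (Fin n) → ℝ} {ρ : ℝ}

theorem form_smul_right (T : Fin n → Fin n → ℝ) (c : ℝ) (X Y : Fin n → ℝ) :
    form T X (fun i => c * Y i) = c * form T X Y := by
  simp only [form, Finset.mul_sum]
  exact Finset.sum_congr rfl fun i _ => Finset.sum_congr rfl fun j _ => by ring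

theorem form_comm {T : Fin n → Fin n → ℝ} (hT : ∀ i j, T i j = T j i) (X Y : Fin n → ℝ) :
    form T X Y = form T Y X := by
  rw [form_eq_sum_left, form_eq_sum_right]
  simp only [hT]

theorem IsFlatSolitonOn.form_ric (h : IsFlatSolitonOn γ f ρ U) (hy : y ∈ U) (X Y : Fin n → ℝ) :
    form (fun i j => ric γ i j y) X Y
      = form (fun i j => hess γ f i j y) X Y + ρ * form (γ y) X Y := by
  simp only [form, Finset.mul_sum, ← Finset.sum_add_distrib, h.eqn y hy]
  exact Finset.sum_congr rfl fun i _ => Finset.sum_congr rfl fun j _ => by ring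

theorem sum_mul_ricGrad (X : Fin n → ℝ) :
    ∑ k, X k * ricGrad γ f k y
      = form (fun i j => ric γ i j y) X (fun i => grad γ f i y) := by
  rw [form_eq_sum_left]; rfl

/-- The Cotton tensor evaluated on three vectors. -/
theorem IsFlatSolitonOn.sum_cotton (h : IsFlatSolitonOn γ f ρ U) (hy : y ∈ U)
    (X Y Z : Fin n → ℝ) :
    ∑ i, ∑ j, ∑ k, cotton γ i j k y * X i * Y j * Z k
      = 1 / ((n : ℝ) - 2) * ((∑ j, Y j * pd j f y) * form (fun i j => ric γ i j y) X Z
        - (∑ j, Z j * pd j f y) * form (fun i j => ric γ i j y) X Y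
        + 1 / ((n : ℝ) - 1) * (form (γ y) X Z * (∑ k, Y k * ricGrad γ f k y)
          - form (γ y) X Y * (∑ k, Z k * ricGrad γ f k y))
        - scal γ y / ((n : ℝ) - 1) * (form (γ y) X Z * (∑ j, Y j * pd j f y)
          - form (γ y) X Y * (∑ j, Z j * pd j f y))) := by
  have e1 := sum_mul_form_mid (fun j => pd j f y) (fun i j => ric γ i j y) X Y Z
  have e2 := sum_mul_form_last (fun j => pd j f y) (fun i j => ric γ i j y) X Y Z
  have e3 := sum_mul_form_mid (fun j => ricGrad γ f j y) (γ y) X Y Z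
  have e4 := sum_mul_form_last (fun j => ricGrad γ f j y) (γ y) X Y Z
  have e5 := sum_mul_form_mid (fun j => pd j f y) (γ y) X Y Z
  have e6 := sum_mul_form_last (fun j => pd j f y) (γ y) X Y Z
  rw [mul_comm (form (γ y) X Z), mul_comm (form (γ y) X Y), mul_comm (form (γ y) X Z),
    mul_comm (form (γ y) X Y)]
  beta_reduce at e1 e2 e3 e4 e5 e6
  rw [← e1, ← e2, ← e3, ← e4, ← e5, ← e6]
  simp only [Finset.mul_sum, ← Finset.sum_add_distrib, ← Finset.sum_sub_distrib]
  exact Finset.sum_congr rfl fun i _ => Finset.sum_congr rfl fun j _ =>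
    Finset.sum_congr rfl fun k _ => by rw [h.cotton_eq hy]; ring

/-- The formula for `|C|²` in terms of the geometry of the level set. -/
theorem IsFlatSolitonOn.cottonNormSq_eq (h : IsFlatSolitonOn γ f ρ U) (hy : y ∈ U)
    (hG : 0 < gradNormSq γ f y) {e : Fin (n - 1) → Fin n → ℝ} (he : IsTangentFrame γ f y e) :
    cottonNormSq γ y =
      2 * gradNormSq γ f y ^ 2 / ((n : ℝ) - 2) ^ 2 * tracelessNormSq γ f y e
        + 1 / (2 * ((n : ℝ) - 1) * ((n : ℝ) - 2)) * tangentialGradNormSq γ f y e := by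
  have hn2 := h.two_lt
  have hn3 := h.three_le
  have h1 : (n : ℝ) - 1 ≠ 0 := by linarith
  have h2 : (n : ℝ) - 2 ≠ 0 := by linarith
  set N : Fin n → ℝ := fun i => grad γ f i y with hN
  set s := Real.sqrt (gradNormSq γ f y) with hs
  have hs0 : s ≠ 0 := (Real.sqrt_pos.mpr hG).ne'
  have hss : gradNormSq γ f y = s ^ 2 := (Real.sq_sqrt hG.le).symm
  set ν : Fin n → ℝ := fun i => s⁻¹ * N i with hν
  have hNν : N = fun i => s * ν i := by
    ext i; simp only [hν]; field_simp
  -- The adapted frame: `none` labels the unit normal, `some a` the tangent vector `e a`.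
  set E : Option (Fin (n - 1)) → Fin n → ℝ := fun α => α.elim ν e with hE
  have hfν : ∑ i, ν i * pd i f y = s := by
    have : ∑ i, ν i * pd i f y = s⁻¹ * gradNormSq γ f y := by
      rw [h.metric.gradNormSq_eq hy, Finset.mul_sum]
      exact Finset.sum_congr rfl fun i _ => by simp only [hν, hN]; ring
    rw [this, hss]; field_simp
  have hfe : ∀ a, ∑ i, e a i * pd i f y = 0 := he.1
  have hgν : ∀ X, form (γ y) X ν = s⁻¹ * ∑ i, X i * pd i f y := fun X => by
    have := form_smul_right (γ y) s⁻¹ X N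
    rw [← h.metric.form_grad hy]
    exact this
  have hf : ∀ α, ∑ i, E α i * pd i f y = if α = none then s else 0 := by
    rintro (_ | a)
    · simpa [hE] using hfν
    · simpa [hE] using hfe a
  have hg : ∀ α β, form (γ y) (E α) (E β) = if α = β then 1 else 0 := by
    rintro (_ | a) (_ | b)
    · have : form (γ y) ν ν = 1 := by rw [hgν, hfν]; field_simp
      simpa [hE] using this
    · have : form (γ y) ν (e b) = 0 := by rw [h.metric.form_symm hy, hgν, hfe, mul_zero]
      simpa [hE] using this
    · have : form (γ y) (e a) ν = 0 := by rw [hgν, hfe, mul_zero]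
      simpa [hE] using this
    · have := he.2 a b
      simpa [hE] using this
  have hP := inv_eq_sum_of_orthonormal (g := γ y) (e := E)
    (by rw [Fintype.card_option, Fintype.card_fin]; omega) hg
  set r : Option (Fin (n - 1)) → Option (Fin (n - 1)) → ℝ :=
    fun α β => form (fun i j => ric γ i j y) (E α) (E β) with hr
  have hrs : ∀ α β, r α β = r β α := fun α β => form_comm (h.ric_symm hy) _ _
  have hv : ∀ α, ∑ k, E α k * ricGrad γ f k y = s * r α none := by
    intro α
    rw [sum_mul_ricGrad]
    change form _ _ N = _
    rw [hNν, form_smul_right]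
    rfl
  have hR : scal γ y = ∑ α, r α α := by
    simp only [scal, hP, hr, form, Finset.sum_mul]
    calc _ = ∑ i, ∑ α, ∑ k, E α i * E α k * ric γ i k y :=
          Finset.sum_congr rfl fun i _ => Finset.sum_comm
      _ = ∑ α, ∑ i, ∑ k, E α i * E α k * ric γ i k y := Finset.sum_comm
      _ = _ := Finset.sum_congr rfl fun α _ => Finset.sum_congr rfl fun i _ =>
        Finset.sum_congr rfl fun k _ => by ring
  have hcard : (n : ℝ) = Fintype.card (Fin (n - 1)) + 1 := by
    rw [Fintype.card_fin, Nat.cast_sub (by omega)]; simp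
  have key : cottonNormSq γ y = 2 * s ^ 2 / ((n : ℝ) - 2) ^ 2 * ∑ a, ∑ b, (r (some a) (some b)
          - (∑ c, r (some c) (some c)) / ((n : ℝ) - 1) * (if a = b then 1 else 0)) ^ 2
        + 2 * s ^ 2 / (((n : ℝ) - 1) * ((n : ℝ) - 2)) * ∑ a, r (some a) none ^ 2 := by
    rw [← sum_sq_cotton_frame hcard hn2 s r hrs, cottonNormSq,
      contraction_eq_sum_sq hP (fun i j k => cotton γ i j k y)]
    refine Finset.sum_congr rfl fun α _ => Finset.sum_congr rfl fun β _ =>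
      Finset.sum_congr rfl fun δ _ => ?_
    rw [h.sum_cotton hy, hf, hf, hg, hg, hv, hv, hR]
  -- On tangent vectors `h = ∇²f / s`, with `∇²f = Rc - ρ g`.
  have hsec : ∀ a b, secondForm γ f y (e a) (e b)
      = s⁻¹ * (r (some a) (some b) - ρ * (if a = b then 1 else 0)) := by
    intro a b
    rw [h.metric.secondForm_eq h.smooth hy hG _ (he.1 b)]
    have h3 := h.form_ric hy (e a) (e b)
    rw [he.2] at h3
    change r (some a) (some b) = _ at h3
    rw [h3, add_sub_cancel_right, div_eq_inv_mul]
  have hH : meanCurv γ f y e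
      = s⁻¹ * (∑ c, r (some c) (some c) - ρ * ((n : ℝ) - 1)) := by
    simp only [meanCurv, hsec, if_true, ← Finset.mul_sum, Finset.sum_sub_distrib]
    simp only [Finset.sum_const, Finset.card_univ, nsmul_eq_mul, mul_one]
    rw [show (Fintype.card (Fin (n - 1)) : ℝ) = n - 1 by linarith]
  -- Removing the trace removes `ρ g`, so the trace-free parts of `h` and of Ricci differ only by
  -- the factor `1 / s`.
  have htr : tracelessNormSq γ f y e = (s ^ 2)⁻¹ * ∑ a, ∑ b, (r (some a) (some b)
      - (∑ c, r (some c) (some c)) / ((n : ℝ) - 1) * (if a = b then 1 else 0)) ^ 2 := by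
    simp only [tracelessNormSq, Finset.mul_sum]
    refine Finset.sum_congr rfl fun a _ => Finset.sum_congr rfl fun b _ => ?_
    rw [hsec, hH, he.2]
    field_simp
    ring
  -- `∇_a G = 2 ∇²f(e_a, ∇f) = 2 s Rc(e_a, ν)`, as `g(e_a, ∇f) = 0`.
  have htan : tangentialGradNormSq γ f y e = 4 * s ^ 2 * ∑ a, r (some a) none ^ 2 := by
    simp only [tangentialGradNormSq, Finset.mul_sum]
    refine Finset.sum_congr rfl fun a _ => ?_
    have h3 : ∑ i, e a i * pd i (gradNormSq γ f) y = 2 * (s * r (some a) none) := by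
      have h4 := h.form_ric hy (e a) N
      rw [h.metric.form_grad hy, hfe, mul_zero, add_zero] at h4
      have h5 : form (fun i j => ric γ i j y) (e a) N = s * r (some a) none := by
        rw [hNν, form_smul_right]; rfl
      rw [← h5, h4, form_eq_sum_left, Finset.mul_sum]
      exact Finset.sum_congr rfl fun i _ => by rw [h.metric.pd_gradNormSq h.smooth hy]; ring
    rw [h3]; ring
  rw [key, htr, htan, hss]
  generalize ∑ a, ∑ b, (r (some a) (some b)
      - (∑ c, r (some c) (some c)) / ((n : ℝ) - 1) * (if a = b then 1 else 0)) ^ 2 = A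
  generalize ∑ a, r (some a) none ^ 2 = B
  field_simp
  ring

end LevelSet

/-! ## Consequences of the vanishing of the Cotton tensor -/

/-- `Rc(∇f, ∇f) / |∇f|²`. -/
noncomputable def radialRic {n : ℕ} (γ : EuclideanSpace ℝ (Fin n) → Matrix (Fin n) (Fin n) ℝ)
    (f : EuclideanSpace ℝ (Fin n) → ℝ) (y : EuclideanSpace ℝ (Fin n)) : ℝ :=
  form (fun i j => ric γ i j y) (fun i => grad γ f i y) (fun i => grad γ f i y) / gradNormSq γ f y

section ConformallyFlat

variable {n : ℕ} {γ : EuclideanSpace ℝ (Fin n) → Matrix (Fin n) (Fin n) ℝ}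
  {U : Set (EuclideanSpace ℝ (Fin n))} {y : EuclideanSpace ℝ (Fin n)}
  {f : EuclideanSpace ℝ (Fin n) → ℝ} {ρ : ℝ}

/-- Contraction of `cotton_eq` with `∇f` in the second index. All eigenvalue statements follow from
this one identity. -/
theorem IsFlatSolitonOn.contract_cotton (h : IsFlatSolitonOn γ f ρ U) (hy : y ∈ U)
    (hC : ∀ i j k, cotton γ i j k y = 0) (i k : Fin n) :
    gradNormSq γ f y * ric γ i k y - pd k f y * ricGrad γ f i y
      + 1 / ((n : ℝ) - 1) * (γ y i k * (∑ j, grad γ f j y * ricGrad γ f j y)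
        - pd i f y * ricGrad γ f k y)
      - scal γ y / ((n : ℝ) - 1) * (γ y i k * gradNormSq γ f y - pd i f y * pd k f y) = 0 := by
  have hn := h.two_lt
  have h2 : (n : ℝ) - 2 ≠ 0 := by linarith
  have h0 : ∀ j, pd j f y * ric γ i k y - pd k f y * ric γ i j y
      + 1 / ((n : ℝ) - 1) * (γ y i k * ricGrad γ f j y - γ y i j * ricGrad γ f k y)
      - scal γ y / ((n : ℝ) - 1) * (γ y i k * pd j f y - γ y i j * pd k f y) = 0 := by
    intro j
    have h3 := hC i j k
    rw [h.cotton_eq hy] at h3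
    exact (mul_eq_zero.mp h3).resolve_left (one_div_ne_zero h2)
  have h4 : ∑ j, grad γ f j y * (pd j f y * ric γ i k y - pd k f y * ric γ i j y
      + 1 / ((n : ℝ) - 1) * (γ y i k * ricGrad γ f j y - γ y i j * ricGrad γ f k y)
      - scal γ y / ((n : ℝ) - 1) * (γ y i k * pd j f y - γ y i j * pd k f y)) = 0 :=
    Finset.sum_eq_zero fun j _ => by rw [h0, mul_zero]
  rw [← h4, h.metric.gradNormSq_eq hy, ← h.metric.metric_grad hy i]
  simp only [ricGrad]
  -- The sums inside `Rc(∇f, ·)` are hidden so that only the outer contraction is distributed; the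
  -- one with index `i` is reopened because it is itself that contraction.
  generalize hv : (fun j => ∑ m, ric γ j m y * grad γ f m y) = v
  have hv' : ∀ j, ∑ m, ric γ j m y * grad γ f m y = v j := fun j => congrFun hv j
  simp only [hv' k, hv']
  rw [← hv' i]
  have hS : ∀ (a b c d e g x : ℝ) (s1 s2 s3 s4 : Fin n → ℝ),
      (∑ j, s1 j) * a - b * (∑ j, s2 j) + c * (d * (∑ j, s3 j) - (∑ j, s4 j) * e)
        - g * (d * (∑ j, s1 j) - (∑ j, s4 j) * x)
      = ∑ j, (s1 j * a - b * s2 j + c * (d * s3 j - s4 j * e) - g * (d * s1 j - s4 j * x)) := by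
    intros
    simp only [Finset.sum_sub_distrib, Finset.sum_add_distrib, ← Finset.mul_sum, ← Finset.sum_mul]
  rw [hS]
  exact Finset.sum_congr rfl fun j _ => by ring

theorem sum_grad_mul_ricGrad :
    ∑ j, grad γ f j y * ricGrad γ f j y
      = form (fun i j => ric γ i j y) (fun i => grad γ f i y) (fun i => grad γ f i y) :=
  sum_mul_ricGrad (fun i => grad γ f i y)

theorem sum_grad_mul_ricGrad_eq (hG : gradNormSq γ f y ≠ 0) :
    ∑ j, grad γ f j y * ricGrad γ f j y = radialRic γ f y * gradNormSq γ f y := by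
  rw [sum_grad_mul_ricGrad, radialRic, div_mul_cancel₀ _ hG]

/-- The gradient is an eigenvector of the Ricci tensor. -/
theorem IsFlatSolitonOn.ricGrad_eq (h : IsFlatSolitonOn γ f ρ U) (hy : y ∈ U)
    (hC : ∀ i j k, cotton γ i j k y = 0) (hG : gradNormSq γ f y ≠ 0) (k : Fin n) :
    ricGrad γ f k y = radialRic γ f y * pd k f y := by
  have hn := h.two_lt
  have h1 : (n : ℝ) - 1 ≠ 0 := by linarith
  have h2 : (n : ℝ) - 2 ≠ 0 := by linarith
  -- The part of the contracted identity antisymmetric in `i`, `k` is `(n - 2) / (n - 1)` times `df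
  -- ∧ Rc(∇f, ·)`.
  have h3 : ∀ i, pd i f y * ricGrad γ f k y = pd k f y * ricGrad γ f i y := by
    intro i
    have e1 := h.contract_cotton hy hC i k
    have e2 := h.contract_cotton hy hC k i
    rw [h.ric_symm hy k i, h.metric.symm hy k i] at e2
    field_simp at e1 e2
    have e3 : ((n : ℝ) - 2) * (pd i f y * ricGrad γ f k y - pd k f y * ricGrad γ f i y) = 0 := by
      linarith
    exact sub_eq_zero.mp ((mul_eq_zero.mp e3).resolve_left h2)
  have h4 : gradNormSq γ f y * ricGrad γ f k y
      = pd k f y * (radialRic γ f y * gradNormSq γ f y) := by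
    rw [← sum_grad_mul_ricGrad_eq hG, h.metric.gradNormSq_eq hy, Finset.sum_mul, Finset.mul_sum]
    exact Finset.sum_congr rfl fun i _ => by
      rw [mul_assoc, h3 i]; ring
  exact mul_left_cancel₀ hG (by rw [h4]; ring)

/-- The Ricci tensor is `μ g` up to a multiple of `df ⊗ df`. -/
theorem IsFlatSolitonOn.ric_eq (h : IsFlatSolitonOn γ f ρ U) (hy : y ∈ U)
    (hC : ∀ i j k, cotton γ i j k y = 0) (hG : gradNormSq γ f y ≠ 0) :
    ∃ κ : ℝ, ∀ i k, ric γ i k y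
      = (scal γ y - radialRic γ f y) / ((n : ℝ) - 1) * γ y i k + κ * (pd i f y * pd k f y) := by
  have hn := h.two_lt
  have h1 : (n : ℝ) - 1 ≠ 0 := by linarith
  -- The coefficient of `df ⊗ df` is forced by evaluation on `∇f`: it is `(λ - μ) / |∇f|²` with `μ =
  -- (R - λ) / (n - 1)`.
  refine ⟨(radialRic γ f y * n - scal γ y) / (((n : ℝ) - 1) * gradNormSq γ f y), fun i k => ?_⟩
  have e1 := h.contract_cotton hy hC i k
  rw [sum_grad_mul_ricGrad_eq hG, h.ricGrad_eq hy hC hG, h.ricGrad_eq hy hC hG] at e1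
  field_simp at e1 ⊢
  linarith

/-- Tested against every `Y`, which by nondegeneracy of the metric is the eigenvector equation for
Ricci as an endomorphism. -/
theorem IsFlatSolitonOn.form_ric_grad (h : IsFlatSolitonOn γ f ρ U) (hy : y ∈ U)
    (hC : ∀ i j k, cotton γ i j k y = 0) (hG : gradNormSq γ f y ≠ 0) (Y : Fin n → ℝ) :
    form (fun i j => ric γ i j y) (fun i => grad γ f i y) Y
      = radialRic γ f y * form (γ y) (fun i => grad γ f i y) Y := by
  rw [form_comm (h.ric_symm hy), ← sum_mul_ricGrad, h.metric.form_symm hy, h.metric.form_grad hy,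
    Finset.mul_sum]
  exact Finset.sum_congr rfl fun k _ => by rw [h.ricGrad_eq hy hC hG]; ring

theorem IsFlatSolitonOn.form_ric_tangent (h : IsFlatSolitonOn γ f ρ U) (hy : y ∈ U)
    (hC : ∀ i j k, cotton γ i j k y = 0) (hG : gradNormSq γ f y ≠ 0) {X : Fin n → ℝ}
    (hX : IsTangent f y X) (Y : Fin n → ℝ) :
    form (fun i j => ric γ i j y) X Y
      = (scal γ y - radialRic γ f y) / ((n : ℝ) - 1) * form (γ y) X Y := by
  obtain ⟨κ, hκ⟩ := h.ric_eq hy hC hG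
  set μ := (scal γ y - radialRic γ f y) / ((n : ℝ) - 1)
  have hX' : ∑ i, X i * pd i f y = 0 := hX
  have e : ∀ j, ∑ i, ric γ i j y * X i = μ * ∑ i, γ y i j * X i := by
    intro j
    have : ∑ i, ric γ i j y * X i
        = μ * ∑ i, γ y i j * X i + κ * pd j f y * ∑ i, X i * pd i f y := by
      rw [Finset.mul_sum, Finset.mul_sum, ← Finset.sum_add_distrib]
      exact Finset.sum_congr rfl fun i _ => by rw [hκ]; ring
    rw [this, hX', mul_zero, add_zero]
  rw [form_eq_sum_right, form_matrix_eq_sum_right, Finset.mul_sum]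
  exact Finset.sum_congr rfl fun j _ => by rw [e]; ring

/-- On tangent vectors `∇²f = Rc - ρ g = (μ - ρ) g`, and `h` is this divided by `|∇f|`. -/
theorem IsFlatSolitonOn.secondForm_umbilic (h : IsFlatSolitonOn γ f ρ U) (hy : y ∈ U)
    (hC : ∀ i j k, cotton γ i j k y = 0) (hG : 0 < gradNormSq γ f y) {X Y : Fin n → ℝ}
    (hX : IsTangent f y X) (hY : IsTangent f y Y) :
    secondForm γ f y X Y = ((scal γ y - radialRic γ f y) / ((n : ℝ) - 1) - ρ)
      / Real.sqrt (gradNormSq γ f y) * form (γ y) X Y := by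
  have h1 := h.form_ric hy X Y
  rw [h.form_ric_tangent hy hC hG.ne' hX] at h1
  rw [h.metric.secondForm_eq h.smooth hy hG X hY,
    show form (fun i j => hess γ f i j y) X Y = _ from (sub_eq_of_eq_add h1).symm]
  ring

/-- The mean curvature is a function of the scalar curvature, the radial Ricci curvature and
the length of the gradient. -/
theorem IsFlatSolitonOn.meanCurv_eq (h : IsFlatSolitonOn γ f ρ U) (hy : y ∈ U)
    (hC : ∀ i j k, cotton γ i j k y = 0) (hG : 0 < gradNormSq γ f y)
    {e : Fin (n - 1) → Fin n → ℝ} (he : IsTangentFrame γ f y e) :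
    meanCurv γ f y e = ((n : ℝ) - 1) * (((scal γ y - radialRic γ f y) / ((n : ℝ) - 1) - ρ)
      / Real.sqrt (gradNormSq γ f y)) := by
  have hn := h.three_le
  have hcard : ((n - 1 : ℕ) : ℝ) = n - 1 := by rw [Nat.cast_sub (by omega)]; simp
  have : ∀ a, secondForm γ f y (e a) (e a) = ((scal γ y - radialRic γ f y) / ((n : ℝ) - 1) - ρ)
      / Real.sqrt (gradNormSq γ f y) := fun a => by
    rw [h.secondForm_umbilic hy hC hG (he.1 a) (he.1 a), he.2, if_pos rfl, mul_one]
  simp only [meanCurv, this, Finset.sum_const, Finset.card_univ, Fintype.card_fin, nsmul_eq_mul,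
    hcard]

theorem fderiv_eq_smul_of_pd {u : EuclideanSpace ℝ (Fin n) → ℝ} {a : ℝ}
    (hu : ∀ i, pd i u y = a * pd i f y) : fderiv ℝ u y = a • fderiv ℝ f y := by
  ext v
  rw [_root_.smul_apply, fderiv_eq_sum_pd, fderiv_eq_sum_pd, smul_eq_mul, Finset.mul_sum]
  exact Finset.sum_congr rfl fun i _ => by rw [hu]; ring

theorem eventually_eq_of_pd_proportional {V : Set (EuclideanSpace ℝ (Fin n))} (hV : IsOpen V)
    (hf : ContDiffOn ℝ ∞ f V) {u : EuclideanSpace ℝ (Fin n) → ℝ} (hu : ContDiffOn ℝ ∞ u V)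
    (hy : y ∈ V) {i : Fin n} (hi : pd i f y ≠ 0)
    (h : ∀ z ∈ V, ∃ a : ℝ, ∀ i, pd i u z = a * pd i f z) :
    ∀ᶠ z in nhds y, f z = f y → u z = u y := by
  refine eventually_eq_of_fderiv_proportional
    ((hf.contDiffAt (hV.mem_nhds hy)).of_le (by simp)) (fun h0 => hi ?_) ?_
  · simp [pd, h0]
  · filter_upwards [hV.mem_nhds hy] with z hz
    obtain ⟨a, ha⟩ := h z hz
    exact ⟨differentiableAt_of_smooth hV hu hz, a, fderiv_eq_smul_of_pd ha⟩

/-- `|∇f|²`, the scalar curvature and the radial Ricci curvature are locally constant on the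
regular part of the level sets. -/
theorem IsFlatSolitonOn.eventually_const (h : IsFlatSolitonOn γ f ρ U)
    (hC : ∀ z ∈ U, ∀ i j k, cotton γ i j k z = 0) (hy : y ∈ U) (hG : gradNormSq γ f y ≠ 0) :
    ∀ᶠ z in nhds y, f z = f y → gradNormSq γ f z = gradNormSq γ f y ∧ scal γ z = scal γ y ∧
      radialRic γ f z = radialRic γ f y := by
  have hU := h.metric.isOpen
  have hGs := h.metric.smooth_gradNormSq h.smooth
  -- The regular points, where `radialRic` is a quotient with nonzero denominator and hence smooth.
  set V := U ∩ {z | gradNormSq γ f z ≠ 0} with hV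
  have hVo : IsOpen V := hGs.continuousOn.isOpen_inter_preimage hU isOpen_ne
  have hVU : V ⊆ U := Set.inter_subset_left
  have hfV := h.smooth.mono hVU
  have hGV := hGs.mono hVU
  have hRV := h.smooth_scal.mono hVU
  have hyV : y ∈ V := ⟨hy, hG⟩
  obtain ⟨i, hi⟩ := exists_pd_ne_zero_of_gradNormSq_ne_zero hG
  have hLV : ContDiffOn ℝ ∞ (radialRic γ f) V := by
    refine ContDiffOn.div (ContDiffOn.mono ?_ hVU) hGV fun z hz => hz.2
    unfold form
    exact ContDiffOn.sum fun i _ => ContDiffOn.sum fun j _ =>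
      ((h.smooth_ricMat i j).mul (h.metric.smooth_grad h.smooth i)).mul
        (h.metric.smooth_grad h.smooth j)
  -- `dG = 2 ∇²f(∇f, ·) = 2 (Rc - ρ g)(∇f, ·)`, and `∇f` is an eigenvector.
  have hdG : ∀ z ∈ V, ∀ k, pd k (gradNormSq γ f) z
      = 2 * ((radialRic γ f z - ρ) * pd k f z) := by
    intro z hz k
    have e : ricGrad γ f k z = ∑ j, hess γ f k j z * grad γ f j z + ρ * pd k f z := by
      rw [← h.metric.metric_grad hz.1, ricGrad, Finset.mul_sum, ← Finset.sum_add_distrib]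
      exact Finset.sum_congr rfl fun j _ => by rw [h.eqn z hz.1]; ring
    rw [h.ricGrad_eq hz.1 (hC z hz.1) hz.2] at e
    rw [h.metric.pd_gradNormSq h.smooth hz.1]
    linarith
  have hdR : ∀ z ∈ V, ∀ k, pd k (scal γ) z = -2 * radialRic γ f z * pd k f z := by
    intro z hz k
    rw [h.pd_scal hz.1, h.ricGrad_eq hz.1 (hC z hz.1) hz.2]
    ring
  -- Differentiating `dG = 2 (λ - ρ) df` once more and using symmetry of second derivatives of `G`
  -- and `f` gives `dλ ∧ df = 0`; dividing by a nonzero `∂_j f` yields the factor.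
  have hdL : ∀ z ∈ V, ∃ a : ℝ, ∀ k, pd k (radialRic γ f) z = a * pd k f z := by
    intro z hz
    have hf1 := fun k => differentiableAt_of_smooth hVo (smooth_pd hVo hfV k) hz
    have hL1 := differentiableAt_of_smooth hVo hLV hz
    have e : ∀ k l, pd l (pd k (gradNormSq γ f)) z
        = 2 * (pd l (radialRic γ f) z * pd k f z + (radialRic γ f z - ρ) * pd l (pd k f) z) := by
      intro k l
      rw [pd_congr_on hVo hz (fun w hw => hdG w hw k),
        pd_const_mul _ ((hL1.sub_const ρ).fun_mul (hf1 k)),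
        pd_mul (hL1.sub_const ρ) (hf1 k), pd_sub hL1 (differentiableAt_const ρ), pd_const, sub_zero]
    obtain ⟨j, hj⟩ := exists_pd_ne_zero_of_gradNormSq_ne_zero hz.2
    refine ⟨pd j (radialRic γ f) z / pd j f z, fun k => ?_⟩
    have h1 := pd_comm hVo hGV hz j k
    rw [e, e, pd_comm hVo hfV hz j k] at h1
    field_simp
    linarith
  filter_upwards [eventually_eq_of_pd_proportional hVo hfV hGV hyV hi
      (fun z hz => ⟨2 * (radialRic γ f z - ρ), fun k => by rw [hdG z hz k]; ring⟩),
    eventually_eq_of_pd_proportional hVo hfV hRV hyV hi (fun z hz => ⟨_, hdR z hz⟩),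
    eventually_eq_of_pd_proportional hVo hfV hLV hyV hi hdL] with z h1 h2 h3 hz
  exact ⟨h1 hz, h2 hz, h3 hz⟩

end ConformallyFlat

/-! ## Change of coordinates -/

/-- `γ'` and `f'` are the pullbacks of `γ` and `f` by the smooth map `τ : U' → U`. -/
structure IsPullbackOn {n : ℕ} (γ' γ : EuclideanSpace ℝ (Fin n) → Matrix (Fin n) (Fin n) ℝ)
    (f' f : EuclideanSpace ℝ (Fin n) → ℝ) (τ : EuclideanSpace ℝ (Fin n) → EuclideanSpace ℝ (Fin n))
    (U' U : Set (EuclideanSpace ℝ (Fin n))) : Prop where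
  smooth : ContDiffOn ℝ ∞ τ U'
  mapsTo : Set.MapsTo τ U' U
  metric : ∀ x ∈ U', ∀ a b, γ' x a b
    = ∑ i, ∑ j, pd a (fun z => τ z i) x * pd b (fun z => τ z j) x * γ (τ x) i j
  func : ∀ x ∈ U', f' x = f (τ x)

section Pullback

variable {n : ℕ} {γ γ' : EuclideanSpace ℝ (Fin n) → Matrix (Fin n) (Fin n) ℝ}
  {U U' : Set (EuclideanSpace ℝ (Fin n))} {x y : EuclideanSpace ℝ (Fin n)}
  {f f' : EuclideanSpace ℝ (Fin n) → ℝ}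
  {τ : EuclideanSpace ℝ (Fin n) → EuclideanSpace ℝ (Fin n)} {ρ : ℝ}

/-- With the inverse metric absorbed into `∇f`, the Christoffel part of the Hessian involves only
`∇f` and first derivatives of `g`, whose behaviour under pullback is explicit. -/
theorem IsMetricOn.sum_christoffel_mul_pd (h : IsMetricOn γ U) (hy : y ∈ U) (i j : Fin n) :
    ∑ k, christoffel γ k i j y * pd k f y = 1 / 2 * ∑ l, grad γ f l y *
      (pd i (fun z => γ z j l) y + pd j (fun z => γ z i l) y - pd l (fun z => γ z i j) y) := by
  simp only [christoffel, grad, Finset.sum_mul, Finset.mul_sum]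
  rw [Finset.sum_comm]
  exact Finset.sum_congr rfl fun l _ => Finset.sum_congr rfl fun k _ => by
    rw [h.inv_symm hy k l]; ring

/-- The Koszul combination of first derivatives of a pulled back metric. -/
theorem sum_koszul_pullback {T : Fin n → Fin n → Fin n → ℝ} {J g : Fin n → Fin n → ℝ}
    {D : Fin n → Fin n → Fin n → ℝ} {N w v : Fin n → ℝ} {X : Fin n → Fin n → Fin n → ℝ}
    (hT : ∀ i a b, T i a b = T i b a) (hg : ∀ i j, g i j = g j i)
    (hw : ∀ j, w j = ∑ c, J j c * N c) (hv : ∀ i, v i = ∑ j, g i j * w j)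
    (hX : ∀ c a b, X c a b = ∑ i, ∑ j, (T i c a * J j b * g i j + J i a * T j c b * g i j
      + J i a * J j b * ∑ k, J k c * D k i j)) (a b : Fin n) :
    ∑ c, N c * (X a b c + X b a c - X c a b) = 2 * ∑ i, T i a b * v i
      + ∑ i, ∑ j, J i a * J j b * ∑ k, w k * (D i j k + D j i k - D k i j) := by
  -- In the application `T` is the second derivative of `τ`, `J` its Jacobian and `D` the derivative
  -- of `g`. The terms containing `Q` occur once in each of the first two Koszul summands and both
  -- in the third, so they cancel; only `T i a b` survives.
  set Q : Fin n → Fin n → ℝ := fun i a => ∑ c, T i a c * N c with hQ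
  have hswap : ∀ Y : Fin n → Fin n → Fin n → ℝ,
      ∑ c, N c * ∑ i, ∑ j, Y c i j = ∑ i, ∑ j, ∑ c, N c * Y c i j := by
    intro Y
    simp only [Finset.mul_sum]
    rw [Finset.sum_comm]
    exact Finset.sum_congr rfl fun i _ => Finset.sum_comm
  have h1 : ∀ a b, ∑ c, N c * X a b c = ∑ i, T i a b * v i + ∑ i, ∑ j, J i b * Q j a * g i j
      + ∑ i, ∑ j, J i a * J j b * ∑ k, w k * D i j k := by
    intro a b
    have e : ∑ i, ∑ j, J i a * J j b * ∑ k, w k * D i j k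
        = ∑ i, ∑ j, J i b * w j * ∑ k, J k a * D k i j := by
      simp only [Finset.mul_sum]
      calc _ = ∑ j, ∑ i, ∑ k, J i a * J j b * (w k * D i j k) := Finset.sum_comm
        _ = ∑ j, ∑ k, ∑ i, J i a * J j b * (w k * D i j k) :=
          Finset.sum_congr rfl fun j _ => Finset.sum_comm
        _ = _ := Finset.sum_congr rfl fun j _ => Finset.sum_congr rfl fun k _ =>
          Finset.sum_congr rfl fun i _ => by ring
    have e2 : ∑ i, T i a b * v i = ∑ i, ∑ j, T i a b * g i j * w j :=
      Finset.sum_congr rfl fun i _ => by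
        rw [hv, Finset.mul_sum]
        exact Finset.sum_congr rfl fun j _ => by ring
    simp only [hX]
    rw [hswap, e, e2, ← Finset.sum_add_distrib, ← Finset.sum_add_distrib]
    refine Finset.sum_congr rfl fun i _ => ?_
    rw [← Finset.sum_add_distrib, ← Finset.sum_add_distrib]
    refine Finset.sum_congr rfl fun j _ => ?_
    generalize ∑ k, J k a * D k i j = d
    rw [hw, hQ]
    simp only [Finset.mul_sum, Finset.sum_mul, ← Finset.sum_add_distrib]
    exact Finset.sum_congr rfl fun c _ => by ring
  have h3 : ∑ c, N c * X c a b = ∑ i, ∑ j, J i b * Q j a * g i j + ∑ i, ∑ j, J i a * Q j b * g i j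
      + ∑ i, ∑ j, J i a * J j b * ∑ k, w k * D k i j := by
    have e : ∑ i, ∑ j, J i b * Q j a * g i j = ∑ i, ∑ j, J j b * Q i a * g i j := by
      rw [Finset.sum_comm]
      exact Finset.sum_congr rfl fun i _ => Finset.sum_congr rfl fun j _ => by rw [hg]
    simp only [hX]
    rw [hswap, e, ← Finset.sum_add_distrib, ← Finset.sum_add_distrib]
    refine Finset.sum_congr rfl fun i _ => ?_
    rw [← Finset.sum_add_distrib, ← Finset.sum_add_distrib]
    refine Finset.sum_congr rfl fun j _ => ?_
    have e3 : ∑ k, w k * D k i j = ∑ c, N c * ∑ k, J k c * D k i j := by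
      simp only [hw, Finset.mul_sum, Finset.sum_mul]
      rw [Finset.sum_comm]
      exact Finset.sum_congr rfl fun c _ => Finset.sum_congr rfl fun k _ => by ring
    rw [e3, hQ]
    obtain ⟨d, hd⟩ : ∃ d : Fin n → ℝ, ∀ c, ∑ k, J k c * D k i j = d c := ⟨_, fun _ => rfl⟩
    simp only [hd, Finset.mul_sum, Finset.sum_mul, ← Finset.sum_add_distrib]
    exact Finset.sum_congr rfl fun c _ => by rw [hT i a c, hT j b c]; ring
  have h2 := h1 b a
  have e4 : ∑ i, ∑ j, J i b * J j a * ∑ k, w k * D i j k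
      = ∑ i, ∑ j, J i a * J j b * ∑ k, w k * D j i k := by
    rw [Finset.sum_comm]
    exact Finset.sum_congr rfl fun i _ => Finset.sum_congr rfl fun j _ => by ring
  rw [e4] at h2
  have e5 : ∑ i, T i b a * v i = ∑ i, T i a b * v i :=
    Finset.sum_congr rfl fun i _ => by rw [hT]
  rw [e5] at h2
  simp only [mul_add, mul_sub, Finset.sum_add_distrib, Finset.sum_sub_distrib] at h1 h2 h3 ⊢
  rw [h1 a b, h2, h3]
  ring

theorem IsPullbackOn.smooth_coord (hp : IsPullbackOn γ' γ f' f τ U' U) (i : Fin n) :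
    ContDiffOn ℝ ∞ (fun z => τ z i) U' :=
  contDiffOn_euclidean.mp hp.smooth i

theorem IsPullbackOn.pd_comp (hp : IsPullbackOn γ' γ f' f τ U' U) (hU : IsOpen U)
    (hU' : IsOpen U') {u : EuclideanSpace ℝ (Fin n) → ℝ} (hu : ContDiffOn ℝ ∞ u U) (hx : x ∈ U')
    (a : Fin n) : pd a (fun z => u (τ z)) x = ∑ k, pd a (fun z => τ z k) x * pd k u (τ x) :=
  RicciSoliton.pd_comp (differentiableAt_of_smooth hU hu (hp.mapsTo hx))
    ((hp.smooth.contDiffAt (hU'.mem_nhds hx)).differentiableAt (by simp)) a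

/-- The Jacobian matrix of `τ`. -/
noncomputable def jacobian (τ : EuclideanSpace ℝ (Fin n) → EuclideanSpace ℝ (Fin n))
    (x : EuclideanSpace ℝ (Fin n)) : Matrix (Fin n) (Fin n) ℝ :=
  Matrix.of fun i a => pd a (fun z => τ z i) x

/-- From `γ' = Jᵀ γ J`. Invertibility of `J` comes from `det γ' ≠ 0`, so `τ` need not be assumed a
diffeomorphism. -/
theorem IsPullbackOn.jacobian_mul (hp : IsPullbackOn γ' γ f' f τ U' U)
    (h' : IsMetricOn γ' U') (hx : x ∈ U') :
    jacobian τ x * (γ' x)⁻¹ * (jacobian τ x).transpose = (γ (τ x))⁻¹ := by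
  set J := jacobian τ x with hJ
  have h1 : γ' x = J.transpose * γ (τ x) * J := by
    ext a b
    rw [hp.metric x hx]
    simp only [Matrix.mul_apply, Matrix.transpose_apply, hJ, jacobian, Matrix.of_apply,
      Finset.sum_mul]
    rw [Finset.sum_comm]
    exact Finset.sum_congr rfl fun i _ => Finset.sum_congr rfl fun j _ => by ring
  have hJu : IsUnit J.det := by
    have h2 := h'.det_ne_zero hx
    rw [h1, Matrix.det_mul] at h2
    exact (right_ne_zero_of_mul h2).isUnit
  symm
  apply Matrix.inv_eq_left_inv
  have h3 : J * (γ' x)⁻¹ * J.transpose * γ (τ x) * J = J := by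
    rw [Matrix.mul_assoc, Matrix.mul_assoc, ← Matrix.mul_assoc J.transpose, ← h1, Matrix.mul_assoc,
      h'.inv_mul hx, Matrix.mul_one]
  calc _ = J * (γ' x)⁻¹ * J.transpose * γ (τ x) * J * J⁻¹ := by
        rw [Matrix.mul_assoc _ J, Matrix.mul_nonsing_inv _ hJu, Matrix.mul_one]
    _ = 1 := by rw [h3, Matrix.mul_nonsing_inv _ hJu]

theorem IsPullbackOn.pd_func (hp : IsPullbackOn γ' γ f' f τ U' U) (h : IsMetricOn γ U)
    (h' : IsMetricOn γ' U') (hf : ContDiffOn ℝ ∞ f U) (hx : x ∈ U') (a : Fin n) :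
    pd a f' x = ∑ i, pd a (fun z => τ z i) x * pd i f (τ x) := by
  rw [pd_congr_on h'.isOpen hx hp.func, hp.pd_comp h.isOpen h'.isOpen hf hx]

theorem IsPullbackOn.grad (hp : IsPullbackOn γ' γ f' f τ U' U) (h : IsMetricOn γ U)
    (h' : IsMetricOn γ' U') (hf : ContDiffOn ℝ ∞ f U) (hx : x ∈ U') (j : Fin n) :
    RicciSoliton.grad γ f j (τ x)
      = ∑ c, pd c (fun z => τ z j) x * RicciSoliton.grad γ' f' c x := by
  have h1 : (fun c => pd c f' x) = (jacobian τ x).transpose.mulVec (fun i => pd i f (τ x)) := by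
    ext c
    rw [hp.pd_func h h' hf hx]
    rfl
  have h2 : (fun j => RicciSoliton.grad γ f j (τ x))
      = (jacobian τ x).mulVec (fun c => RicciSoliton.grad γ' f' c x) := by
    rw [grad_eq_mulVec, grad_eq_mulVec, h1, Matrix.mulVec_mulVec, Matrix.mulVec_mulVec,
      hp.jacobian_mul h' hx]
  exact congrFun h2 j

/-- The Hessian is a tensor. -/
theorem IsPullbackOn.hess (hp : IsPullbackOn γ' γ f' f τ U' U) (h : IsMetricOn γ U)
    (h' : IsMetricOn γ' U') (hf : ContDiffOn ℝ ∞ f U) (hx : x ∈ U') (a b : Fin n) :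
    RicciSoliton.hess γ' f' a b x = ∑ i, ∑ j, pd a (fun z => τ z i) x * pd b (fun z => τ z j) x
      * RicciSoliton.hess γ f i j (τ x) := by
  have hU := h.isOpen
  have hU' := h'.isOpen
  have hy := hp.mapsTo hx
  have hJ : ∀ i a, DifferentiableAt ℝ (pd a (fun z => τ z i)) x := fun i a =>
    differentiableAt_of_smooth hU' (smooth_pd hU' (hp.smooth_coord i) a) hx
  have hτd : DifferentiableAt ℝ τ x :=
    (hp.smooth.contDiffAt (hU'.mem_nhds hx)).differentiableAt (by simp)
  have hγd : ∀ i j, DifferentiableAt ℝ (fun z => γ (τ z) i j) x := fun i j =>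
    DifferentiableAt.comp (g := fun z => γ z i j) x
      (differentiableAt_of_smooth hU (h.smooth i j) hy) hτd
  have hfd : ∀ i, DifferentiableAt ℝ (fun z => pd i f (τ z)) x := fun i =>
    DifferentiableAt.comp (g := pd i f) x
      (differentiableAt_of_smooth hU (smooth_pd hU hf i) hy) hτd
  have hX : ∀ c a b, pd c (fun z => γ' z a b) x = ∑ i, ∑ j,
      (pd c (pd a (fun z => τ z i)) x * pd b (fun z => τ z j) x * γ (τ x) i j
        + pd a (fun z => τ z i) x * pd c (pd b (fun z => τ z j)) x * γ (τ x) i j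
        + pd a (fun z => τ z i) x * pd b (fun z => τ z j) x
          * ∑ k, pd c (fun z => τ z k) x * pd k (fun z => γ z i j) (τ x)) := by
    intro c a b
    rw [pd_congr_on hU' hx (fun z hz => hp.metric z hz a b),
      pd_sum (u := fun i z => ∑ j, pd a (fun z => τ z i) z * pd b (fun z => τ z j) z
        * γ (τ z) i j) fun i _ => DifferentiableAt.fun_sum fun j _ =>
          ((hJ i a).fun_mul (hJ j b)).fun_mul (hγd i j)]
    refine Finset.sum_congr rfl fun i _ => ?_
    rw [pd_sum (u := fun j z => pd a (fun z => τ z i) z * pd b (fun z => τ z j) z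
        * γ (τ z) i j) fun j _ => ((hJ i a).fun_mul (hJ j b)).fun_mul (hγd i j)]
    refine Finset.sum_congr rfl fun j _ => ?_
    rw [pd_mul ((hJ i a).fun_mul (hJ j b)) (hγd i j), pd_mul (hJ i a) (hJ j b),
      hp.pd_comp hU hU' (h.smooth i j) hx]
    ring
  have hff : pd a (pd b f') x = ∑ i, pd a (pd b (fun z => τ z i)) x * pd i f (τ x)
      + ∑ i, ∑ j, pd a (fun z => τ z i) x * pd b (fun z => τ z j) x * pd i (pd j f) (τ x) := by
    rw [pd_congr_on hU' hx (fun z hz => hp.pd_func h h' hf hz b),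
      pd_sum (u := fun i z => pd b (fun z => τ z i) z * pd i f (τ z)) fun i _ =>
        (hJ i b).fun_mul (hfd i), Finset.sum_comm, ← Finset.sum_add_distrib]
    refine Finset.sum_congr rfl fun i _ => ?_
    rw [pd_mul (hJ i b) (hfd i), hp.pd_comp hU hU' (smooth_pd hU hf i) hx, Finset.mul_sum]
    congr 1
    exact Finset.sum_congr rfl fun j _ => by ring
  -- The second derivatives of `τ` produced here cancel those in `hff`, which is why the Hessian
  -- transforms as a tensor.
  have hK := sum_koszul_pullback (T := fun i a b => pd a (pd b (fun z => τ z i)) x)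
    (J := fun i a => pd a (fun z => τ z i) x) (g := γ (τ x))
    (D := fun k i j => pd k (fun z => γ z i j) (τ x)) (N := fun c => RicciSoliton.grad γ' f' c x)
    (w := fun j => RicciSoliton.grad γ f j (τ x)) (v := fun i => pd i f (τ x))
    (X := fun c a b => pd c (fun z => γ' z a b) x)
    (fun i a b => pd_comm hU' (hp.smooth_coord i) hx a b) (h.symm hy) (hp.grad h h' hf hx)
    (fun i => (h.metric_grad hy i).symm) hX a b
  have e : ∑ i, ∑ j, pd a (fun z => τ z i) x * pd b (fun z => τ z j) x
      * RicciSoliton.hess γ f i j (τ x)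
      = ∑ i, ∑ j, pd a (fun z => τ z i) x * pd b (fun z => τ z j) x * pd i (pd j f) (τ x)
        - 1 / 2 * ∑ i, ∑ j, pd a (fun z => τ z i) x * pd b (fun z => τ z j) x
          * ∑ l, RicciSoliton.grad γ f l (τ x) * (pd i (fun z => γ z j l) (τ x)
            + pd j (fun z => γ z i l) (τ x) - pd l (fun z => γ z i j) (τ x)) := by
    rw [Finset.mul_sum, ← Finset.sum_sub_distrib]
    refine Finset.sum_congr rfl fun i _ => ?_
    rw [Finset.mul_sum, ← Finset.sum_sub_distrib]
    refine Finset.sum_congr rfl fun j _ => ?_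
    rw [RicciSoliton.hess, h.sum_christoffel_mul_pd hy]
    ring
  beta_reduce at hK
  rw [RicciSoliton.hess, h'.sum_christoffel_mul_pd hx, hK, hff, e]
  ring

theorem IsPullbackOn.gradNormSq (hp : IsPullbackOn γ' γ f' f τ U' U) (h : IsMetricOn γ U)
    (h' : IsMetricOn γ' U') (hf : ContDiffOn ℝ ∞ f U) (hx : x ∈ U') :
    RicciSoliton.gradNormSq γ' f' x = RicciSoliton.gradNormSq γ f (τ x) := by
  rw [h'.gradNormSq_eq hx, h.gradNormSq_eq (hp.mapsTo hx)]
  simp only [hp.grad h h' hf hx, hp.pd_func h h' hf hx, Finset.mul_sum, Finset.sum_mul]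
  rw [Finset.sum_comm]
  exact Finset.sum_congr rfl fun i _ => Finset.sum_congr rfl fun j _ => by ring

theorem IsPullbackOn.form_hess_grad (hp : IsPullbackOn γ' γ f' f τ U' U) (h : IsMetricOn γ U)
    (h' : IsMetricOn γ' U') (hf : ContDiffOn ℝ ∞ f U) (hx : x ∈ U') :
    form (fun i j => RicciSoliton.hess γ' f' i j x) (fun i => RicciSoliton.grad γ' f' i x)
        (fun i => RicciSoliton.grad γ' f' i x)
      = form (fun i j => RicciSoliton.hess γ f i j (τ x))
        (fun i => RicciSoliton.grad γ f i (τ x)) (fun i => RicciSoliton.grad γ f i (τ x)) := by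
  simp only [form, hp.hess h h' hf hx, hp.grad h h' hf hx, Finset.sum_mul, Finset.mul_sum]
  set J := fun i a => pd a (fun z => τ z i) x
  set N := fun a => RicciSoliton.grad γ' f' a x
  set H := fun i j => RicciSoliton.hess γ f i j (τ x)
  change ∑ a, ∑ b, ∑ i, ∑ j, J i a * J j b * H i j * N a * N b
    = ∑ i, ∑ j, ∑ b, ∑ a, H i j * (J i a * N a) * (J j b * N b)
  calc _ = ∑ a, ∑ i, ∑ b, ∑ j, J i a * J j b * H i j * N a * N b :=
        Finset.sum_congr rfl fun a _ => Finset.sum_comm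
    _ = ∑ a, ∑ i, ∑ j, ∑ b, J i a * J j b * H i j * N a * N b :=
        Finset.sum_congr rfl fun a _ => Finset.sum_congr rfl fun i _ => Finset.sum_comm
    _ = ∑ i, ∑ a, ∑ j, ∑ b, J i a * J j b * H i j * N a * N b := Finset.sum_comm
    _ = ∑ i, ∑ j, ∑ a, ∑ b, J i a * J j b * H i j * N a * N b :=
        Finset.sum_congr rfl fun i _ => Finset.sum_comm
    _ = ∑ i, ∑ j, ∑ b, ∑ a, J i a * J j b * H i j * N a * N b :=
        Finset.sum_congr rfl fun i _ => Finset.sum_congr rfl fun j _ => Finset.sum_comm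
    _ = _ := Finset.sum_congr rfl fun i _ => Finset.sum_congr rfl fun j _ =>
        Finset.sum_congr rfl fun b _ => Finset.sum_congr rfl fun a _ => by ring

theorem IsPullbackOn.trace_hess (hp : IsPullbackOn γ' γ f' f τ U' U) (h : IsMetricOn γ U)
    (h' : IsMetricOn γ' U') (hf : ContDiffOn ℝ ∞ f U) (hx : x ∈ U') :
    ∑ a, ∑ b, (γ' x)⁻¹ a b * RicciSoliton.hess γ' f' a b x
      = ∑ i, ∑ j, (γ (τ x))⁻¹ i j * RicciSoliton.hess γ f i j (τ x) := by
  rw [← hp.jacobian_mul h' hx]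
  simp only [hp.hess h h' hf hx, Matrix.mul_apply, Matrix.transpose_apply, jacobian,
    Matrix.of_apply, Finset.sum_mul, Finset.mul_sum]
  set J := fun i a => pd a (fun z => τ z i) x
  set P := (γ' x)⁻¹
  set H := fun i j => RicciSoliton.hess γ f i j (τ x)
  change ∑ a, ∑ b, ∑ i, ∑ j, P a b * (J i a * J j b * H i j)
    = ∑ i, ∑ j, ∑ b, ∑ a, J i a * P a b * J j b * H i j
  calc _ = ∑ a, ∑ i, ∑ b, ∑ j, P a b * (J i a * J j b * H i j) :=
        Finset.sum_congr rfl fun a _ => Finset.sum_comm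
    _ = ∑ a, ∑ i, ∑ j, ∑ b, P a b * (J i a * J j b * H i j) :=
        Finset.sum_congr rfl fun a _ => Finset.sum_congr rfl fun i _ => Finset.sum_comm
    _ = ∑ i, ∑ a, ∑ j, ∑ b, P a b * (J i a * J j b * H i j) := Finset.sum_comm
    _ = ∑ i, ∑ j, ∑ a, ∑ b, P a b * (J i a * J j b * H i j) :=
        Finset.sum_congr rfl fun i _ => Finset.sum_comm
    _ = ∑ i, ∑ j, ∑ b, ∑ a, P a b * (J i a * J j b * H i j) :=
        Finset.sum_congr rfl fun i _ => Finset.sum_congr rfl fun j _ => Finset.sum_comm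
    _ = _ := Finset.sum_congr rfl fun i _ => Finset.sum_congr rfl fun j _ =>
        Finset.sum_congr rfl fun b _ => Finset.sum_congr rfl fun a _ => by ring

/-- The trace of the soliton equation. It reduces coordinate independence of `R` to that of the
trace of the Hessian. -/
theorem IsFlatSolitonOn.scal_eq (h : IsFlatSolitonOn γ f ρ U) (hy : y ∈ U) :
    scal γ y = ∑ i, ∑ j, (γ y)⁻¹ i j * RicciSoliton.hess γ f i j y + ρ * n := by
  rw [← h.metric.trace_metric hy, scal]
  simp only [Finset.mul_sum, ← Finset.sum_add_distrib, h.eqn y hy]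
  exact Finset.sum_congr rfl fun i _ => Finset.sum_congr rfl fun j _ => by ring

/-- The scalar invariants of a soliton do not depend on the coordinates. -/
theorem IsPullbackOn.invariants (hp : IsPullbackOn γ' γ f' f τ U' U) (h : IsFlatSolitonOn γ f ρ U)
    (h' : IsFlatSolitonOn γ' f' ρ U') (hx : x ∈ U') :
    RicciSoliton.gradNormSq γ' f' x = RicciSoliton.gradNormSq γ f (τ x) ∧
      scal γ' x = scal γ (τ x) ∧ radialRic γ' f' x = radialRic γ f (τ x) := by
  have hG := hp.gradNormSq h.metric h'.metric h.smooth hx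
  refine ⟨hG, ?_, ?_⟩
  · rw [h'.scal_eq hx, h.scal_eq (hp.mapsTo hx), hp.trace_hess h.metric h'.metric h.smooth hx]
  -- Likewise `Rc(∇f, ∇f) = ∇²f(∇f, ∇f) + ρ |∇f|²`.
  · rw [radialRic, radialRic, h'.form_ric hx, h.form_ric (hp.mapsTo hx),
      hp.form_hess_grad h.metric h'.metric h.smooth hx, hG]
    congr 2
    exact congrArg (ρ * ·) hG

end Pullback

/-! ## Manifolds -/

theorem mdifferentiable_of_mem_maximalAtlas {n : ℕ} {M : Type*} [TopologicalSpace M]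
    [ChartedSpace (EuclideanSpace ℝ (Fin n)) M]
    {φ : OpenPartialHomeomorph M (EuclideanSpace ℝ (Fin n))}
    (hφ : φ ∈ IsManifold.maximalAtlas (𝓡 n) ∞ M) :
    φ.MDifferentiable (𝓡 n) (𝓡 n) :=
  ⟨(contMDiffOn_of_mem_maximalAtlas hφ).mdifferentiableOn (by simp),
    (contMDiffOn_symm_of_mem_maximalAtlas hφ).mdifferentiableOn (by simp)⟩

section Manifold

variable {n : ℕ} {M : Type*} [TopologicalSpace M] [ChartedSpace (EuclideanSpace ℝ (Fin n)) M]
  [IsManifold (𝓡 n) ∞ M] {φ ψ : OpenPartialHomeomorph M (EuclideanSpace ℝ (Fin n))}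
  {F : M → ℝ} {ρ : ℝ}

/-- The coordinate field is the tangent map of `φ.symm` applied to a constant field. -/
theorem contMDiffOn_coordField (hφ : φ ∈ IsManifold.maximalAtlas (𝓡 n) ∞ M) (i : Fin n) :
    ContMDiffOn (𝓡 n) ((𝓡 n).tangent) ∞
      (fun y => (Bundle.TotalSpace.mk' (EuclideanSpace ℝ (Fin n)) (φ.symm y)
        (mfderiv (𝓡 n) (𝓡 n) φ.symm y (EuclideanSpace.single i (1 : ℝ))) :
          TangentBundle (𝓡 n) M)) φ.target := by
  have h1 := (contMDiffOn_symm_of_mem_maximalAtlas hφ).contMDiffOn_tangentMapWithin (m := ∞)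
    (by simp) φ.open_target.uniqueMDiffOn
  have h2 : ContMDiff (𝓡 n) ((𝓡 n).tangent) ∞ (fun y : EuclideanSpace ℝ (Fin n) =>
      (Bundle.TotalSpace.mk' (EuclideanSpace ℝ (Fin n)) y (EuclideanSpace.single i (1 : ℝ)) :
        TangentBundle (𝓡 n) (EuclideanSpace ℝ (Fin n)))) :=
    contMDiff_vectorSpace_iff_contDiff.mpr contDiff_const
  have h3 := h1.comp h2.contMDiffOn (s := φ.target) (fun y hy => hy)
  refine h3.congr fun y hy => ?_
  simp only [Function.comp, tangentMapWithin]
  rw [mfderivWithin_of_isOpen φ.open_target hy]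

theorem smoothMat_metricInChart (g : RicciSoliton.Metric n M)
    (hφ : φ ∈ IsManifold.maximalAtlas (𝓡 n) ∞ M) : SmoothMat φ.target (metricInChart g φ) := by
  intro i j y hy
  have h1 := (g.contMDiff.comp_contMDiffOn (contMDiffOn_symm_of_mem_maximalAtlas hφ)) y hy
  have h2 : ContMDiffWithinAt (𝓡 n) ((𝓡 n).prod 𝓘(ℝ)) ∞
      (fun y => Bundle.TotalSpace.mk' ℝ (E := Bundle.Trivial M ℝ) (φ.symm y)
        (metricInChart g φ y i j)) φ.target y := by
    apply ContMDiffWithinAt.clm_bundle_apply₂ (F₁ := EuclideanSpace ℝ (Fin n))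
      (F₂ := EuclideanSpace ℝ (Fin n)) h1
    · exact contMDiffOn_coordField hφ i y hy
    · exact contMDiffOn_coordField hφ j y hy
  simp only [Bundle.contMDiffWithinAt_totalSpace] at h2
  exact h2.2.contDiffWithinAt

theorem euclidean_eq_sum_single (v : EuclideanSpace ℝ (Fin n)) :
    v = ∑ i, v i • EuclideanSpace.single i (1 : ℝ) := by
  ext j
  simp [Pi.single_apply]

/-- Bilinear expansion of the metric in a chart. -/
theorem inner_mfderiv_eq_sum (g : RicciSoliton.Metric n M)
    (φ : OpenPartialHomeomorph M (EuclideanSpace ℝ (Fin n))) (y v w : EuclideanSpace ℝ (Fin n)) :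
    g.inner (φ.symm y) (mfderiv (𝓡 n) (𝓡 n) φ.symm y v) (mfderiv (𝓡 n) (𝓡 n) φ.symm y w)
      = ∑ i, ∑ j, v i * w j * metricInChart g φ y i j := by
  set L := mfderiv (𝓡 n) (𝓡 n) φ.symm y with hL
  have e : ∀ u : EuclideanSpace ℝ (Fin n),
      L u = ∑ i, u i • L (EuclideanSpace.single i (1 : ℝ)) := by
    intro u
    have h := congrArg L (euclidean_eq_sum_single u)
    refine h.trans ?_
    refine (map_sum L _ _).trans (Finset.sum_congr rfl fun i _ => ?_)
    exact map_smul L _ _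
  rw [e v, e w]
  simp only [map_sum, map_smul, _root_.sum_apply, _root_.smul_apply, smul_eq_mul, Finset.mul_sum]
  rw [Finset.sum_comm]
  exact Finset.sum_congr rfl fun i _ => Finset.sum_congr rfl fun j _ => by
    simp only [metricInChart, ← hL]; ring

theorem isMetricOn_metricInChart (g : RicciSoliton.Metric n M)
    (hφ : φ ∈ IsManifold.maximalAtlas (𝓡 n) ∞ M) : IsMetricOn (metricInChart g φ) φ.target where
  isOpen := φ.open_target
  smooth := smoothMat_metricInChart g hφ
  posDef := by
    intro y hy
    refine Matrix.PosDef.of_dotProduct_mulVec_pos ?_ ?_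
    · ext i j
      simpa [metricInChart] using g.symm _ _ _
    · intro x hx
      set v : EuclideanSpace ℝ (Fin n) := WithLp.toLp 2 x with hv
      have hv0 : v ≠ 0 := by
        intro h0
        exact hx (by ext i; exact congrFun (congrArg WithLp.ofLp h0) i)
      -- The differential of the inverse chart is injective, so positivity of `g` passes to its
      -- matrix.
      have hinj := (mdifferentiable_of_mem_maximalAtlas hφ).symm.mfderiv_injective (x := y) hy
      have hLv : mfderiv (𝓡 n) (𝓡 n) φ.symm y v ≠ 0 := by
        intro h0
        exact hv0 (hinj (h0.trans (map_zero _).symm))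
      have hpos := g.pos _ _ hLv
      rw [inner_mfderiv_eq_sum] at hpos
      simp only [star_trivial, dotProduct, Matrix.mulVec, Finset.mul_sum]
      refine lt_of_lt_of_eq hpos (Finset.sum_congr rfl fun i _ => Finset.sum_congr rfl fun j _ => ?_)
      simp only [hv]
      ring

theorem IsGradientSoliton.isFlatSolitonOn {g : RicciSoliton.Metric n M}
    (hsol : IsGradientSoliton g F ρ) (hW : WeylVanishes g) (hn : 3 ≤ n)
    (hφ : φ ∈ IsManifold.maximalAtlas (𝓡 n) ∞ M) :
    IsFlatSolitonOn (metricInChart g φ) (F ∘ φ.symm) ρ φ.target where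
  three_le := hn
  metric := isMetricOn_metricInChart g hφ
  smooth := (hsol.smooth.comp_contMDiffOn (contMDiffOn_symm_of_mem_maximalAtlas hφ)).contDiffOn
  eqn := fun y hy i j => by
    have := hsol.eqn φ hφ (φ.symm y) (φ.map_target hy) i j
    rwa [φ.right_inv hy] at this
  weyl_eq_zero := fun y hy i j k l => by
    have := hW φ hφ (φ.symm y) (φ.map_target hy) i j k l
    rwa [φ.right_inv hy] at this

theorem IsFlatSolitonOn.mono {γ : EuclideanSpace ℝ (Fin n) → Matrix (Fin n) (Fin n) ℝ}
    {f : EuclideanSpace ℝ (Fin n) → ℝ} {U V : Set (EuclideanSpace ℝ (Fin n))}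
    (h : IsFlatSolitonOn γ f ρ U) (hV : IsOpen V) (hVU : V ⊆ U) : IsFlatSolitonOn γ f ρ V where
  three_le := h.three_le
  metric := ⟨hV, fun i j => (h.metric.smooth i j).mono hVU, fun y hy => h.metric.posDef y (hVU hy)⟩
  smooth := h.smooth.mono hVU
  eqn := fun y hy => h.eqn y (hVU hy)
  weyl_eq_zero := fun y hy => h.weyl_eq_zero y (hVU hy)

theorem fderiv_single_apply {τ : EuclideanSpace ℝ (Fin n) → EuclideanSpace ℝ (Fin n)}
    {x : EuclideanSpace ℝ (Fin n)} (hτ : DifferentiableAt ℝ τ x) (a i : Fin n) :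
    fderiv ℝ τ x (EuclideanSpace.single a 1) i = pd a (fun z => τ z i) x := by
  have := ((EuclideanSpace.proj (𝕜 := ℝ) i).hasFDerivAt.comp x hτ.hasFDerivAt).fderiv
  change _ = fderiv ℝ (EuclideanSpace.proj (𝕜 := ℝ) i ∘ τ) x _
  rw [this]; rfl

/-- Moves `g` between two base points that are equal but not definitionally so, such as `ψ.symm x`
and `φ.symm (φ (ψ.symm x))`. -/
theorem inner_congr (g : RicciSoliton.Metric n M) {p q : M} (hpq : p = q)
    (v w : EuclideanSpace ℝ (Fin n)) :
    g.inner p (show TangentSpace (𝓡 n) p from v) (show TangentSpace (𝓡 n) p from w)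
      = g.inner q (show TangentSpace (𝓡 n) q from v) (show TangentSpace (𝓡 n) q from w) := by
  subst hpq; rfl

/-- The coordinate expressions of the metric in two charts are related by pullback. -/
theorem isPullbackOn_metricInChart (g : RicciSoliton.Metric n M) (F : M → ℝ)
    (hφ : φ ∈ IsManifold.maximalAtlas (𝓡 n) ∞ M) (hψ : ψ ∈ IsManifold.maximalAtlas (𝓡 n) ∞ M) :
    IsPullbackOn (metricInChart g ψ) (metricInChart g φ) (F ∘ ψ.symm) (F ∘ φ.symm) (φ ∘ ψ.symm)
      (ψ.symm.trans φ).source φ.target := by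
  have hU' : IsOpen (ψ.symm.trans φ).source := (ψ.symm.trans φ).open_source
  have hmem : ∀ x ∈ (ψ.symm.trans φ).source, x ∈ ψ.target ∧ ψ.symm x ∈ φ.source := by
    intro x hx
    simpa using hx
  have hτ : ContDiffOn ℝ ∞ (φ ∘ ψ.symm) (ψ.symm.trans φ).source := by
    refine ContMDiffOn.contDiffOn ?_
    exact (contMDiffOn_of_mem_maximalAtlas hφ).comp
      ((contMDiffOn_symm_of_mem_maximalAtlas hψ).mono fun x hx => (hmem x hx).1)
      fun x hx => (hmem x hx).2
  have hpt : ∀ x ∈ (ψ.symm.trans φ).source, ψ.symm x = φ.symm ((φ ∘ ψ.symm) x) :=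
    fun x hx => (φ.left_inv (hmem x hx).2).symm
  refine ⟨hτ, fun x hx => φ.map_source (hmem x hx).2, fun x hx a b => ?_, fun x hx => ?_⟩
  · have hτx : DifferentiableAt ℝ (φ ∘ ψ.symm) x :=
      (hτ.contDiffAt (hU'.mem_nhds hx)).differentiableAt (by simp)
    have hyt : (φ ∘ ψ.symm) x ∈ φ.target := φ.map_source (hmem x hx).2
    -- Chain rule for `ψ.symm = φ.symm ∘ (φ ∘ ψ.symm)` near `x`.
    have hm : ∀ v : EuclideanSpace ℝ (Fin n),
        (mfderiv (𝓡 n) (𝓡 n) ψ.symm x v : EuclideanSpace ℝ (Fin n))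
          = mfderiv (𝓡 n) (𝓡 n) φ.symm ((φ ∘ ψ.symm) x) (fderiv ℝ (φ ∘ ψ.symm) x v) := by
      intro v
      have h1 : mfderiv (𝓡 n) (𝓡 n) ψ.symm x
          = mfderiv (𝓡 n) (𝓡 n) (φ.symm ∘ (φ ∘ ψ.symm)) x :=
        Filter.EventuallyEq.mfderiv_eq (Filter.eventually_of_mem (hU'.mem_nhds hx) hpt)
      rw [h1, mfderiv_comp x
        ((mdifferentiable_of_mem_maximalAtlas hφ).mdifferentiableAt_symm hyt)
        hτx.mdifferentiableAt, mfderiv_eq_fderiv]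
      rfl
    have h2 := inner_mfderiv_eq_sum g φ ((φ ∘ ψ.symm) x)
      (fderiv ℝ (φ ∘ ψ.symm) x (EuclideanSpace.single a 1))
      (fderiv ℝ (φ ∘ ψ.symm) x (EuclideanSpace.single b 1))
    simp only [fderiv_single_apply hτx] at h2
    rw [← h2]
    refine (inner_congr g (hpt x hx) _ _).trans ?_
    rw [hm, hm]
  · change F (ψ.symm x) = F (φ.symm ((φ ∘ ψ.symm) x))
    rw [← hpt x hx]

theorem invariants_eq {g : RicciSoliton.Metric n M} (hsol : IsGradientSoliton g F ρ)
    (hW : WeylVanishes g) (hn : 3 ≤ n) (hφ : φ ∈ IsManifold.maximalAtlas (𝓡 n) ∞ M)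
    (hψ : ψ ∈ IsManifold.maximalAtlas (𝓡 n) ∞ M) {p : M} (hpφ : p ∈ φ.source)
    (hpψ : p ∈ ψ.source) :
    gradNormSq (metricInChart g ψ) (F ∘ ψ.symm) (ψ p)
        = gradNormSq (metricInChart g φ) (F ∘ φ.symm) (φ p) ∧
      scal (metricInChart g ψ) (ψ p) = scal (metricInChart g φ) (φ p) ∧
      radialRic (metricInChart g ψ) (F ∘ ψ.symm) (ψ p)
        = radialRic (metricInChart g φ) (F ∘ φ.symm) (φ p) := by
  have h := hsol.isFlatSolitonOn hW hn hφ
  have h' := (hsol.isFlatSolitonOn hW hn hψ).mono (ψ.symm.trans φ).open_source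
    (fun x hx => by
      have : x ∈ ψ.target ∧ ψ.symm x ∈ φ.source := by simpa using hx
      exact this.1)
  have hx : ψ p ∈ (ψ.symm.trans φ).source := by
    have : ψ p ∈ ψ.target ∧ ψ.symm (ψ p) ∈ φ.source :=
      ⟨ψ.map_source hpψ, by rwa [ψ.left_inv hpψ]⟩
    simpa using this
  have := (isPullbackOn_metricInChart g F hφ hψ).invariants h h' hx
  rwa [show (φ ∘ ψ.symm) (ψ p) = φ p from congrArg φ (ψ.left_inv hpψ)] at this

theorem gradNormSq_pos_of_mfderiv_ne_zero {g : RicciSoliton.Metric n M}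
    (hF : ContMDiff (𝓡 n) 𝓘(ℝ, ℝ) ∞ F) (hφ : φ ∈ IsManifold.maximalAtlas (𝓡 n) ∞ M) {p : M}
    (hp : p ∈ φ.source) (hd : mfderiv (𝓡 n) 𝓘(ℝ, ℝ) F p ≠ 0) :
    0 < gradNormSq (metricInChart g φ) (F ∘ φ.symm) (φ p) := by
  by_contra hG
  apply hd
  have h := isMetricOn_metricInChart g hφ
  have hy := φ.map_source hp
  have hpd : ∀ i, pd i (F ∘ φ.symm) (φ p) = 0 := by
    intro i
    by_contra hi
    exact hG (h.gradNormSq_pos hy hi)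
  have hf : ContDiffOn ℝ ∞ (F ∘ φ.symm) φ.target :=
    (hF.comp_contMDiffOn (contMDiffOn_symm_of_mem_maximalAtlas hφ)).contDiffOn
  have hfd : fderiv ℝ (F ∘ φ.symm) (φ p) = 0 := by
    ext v
    rw [fderiv_eq_sum_pd]
    simp [hpd]
  have h1 : mfderiv (𝓡 n) 𝓘(ℝ, ℝ) F p
      = mfderiv (𝓡 n) 𝓘(ℝ, ℝ) ((F ∘ φ.symm) ∘ φ) p := by
    refine Filter.EventuallyEq.mfderiv_eq ?_
    filter_upwards [φ.open_source.mem_nhds hp] with q hq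
    simp [φ.left_inv hq]
  rw [h1, mfderiv_comp p
    (differentiableAt_of_smooth φ.open_target hf hy).mdifferentiableAt
    ((mdifferentiable_of_mem_maximalAtlas hφ).mdifferentiableAt hp), mfderiv_eq_fderiv, hfd]
  rfl

/-- Local conformal flatness implies that the Cotton tensor vanishes, in every dimension. -/
theorem IsGradientSoliton.cotton_eq_zero {g : RicciSoliton.Metric n M}
    (hsol : IsGradientSoliton g F ρ) (hW : WeylVanishes g) (hn : 3 ≤ n)
    (hC : n = 3 → CottonVanishes g) (hφ : φ ∈ IsManifold.maximalAtlas (𝓡 n) ∞ M)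
    {y : EuclideanSpace ℝ (Fin n)} (hy : y ∈ φ.target) (i j k : Fin n) :
    cotton (metricInChart g φ) i j k y = 0 := by
  by_cases h3 : n = 3
  · have := hC h3 φ hφ (φ.symm y) (φ.map_target hy) i j k
    rwa [φ.right_inv hy] at this
  · exact (hsol.isFlatSolitonOn hW hn hφ).cotton_eq_zero h3 hy i j k

/-- The scalar invariants are constant on connected sets of regular points of a level set. -/
theorem invariants_constant {g : RicciSoliton.Metric n M} (hsol : IsGradientSoliton g F ρ)
    (hW : WeylVanishes g) (hn : 3 ≤ n) (hC : n = 3 → CottonVanishes g) {c : ℝ} {S : Set M}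
    (hS : IsPreconnected S) (hSc : ∀ p ∈ S, F p = c ∧ mfderiv (𝓡 n) 𝓘(ℝ, ℝ) F p ≠ 0)
    (hφ : φ ∈ IsManifold.maximalAtlas (𝓡 n) ∞ M) (hψ : ψ ∈ IsManifold.maximalAtlas (𝓡 n) ∞ M)
    {p q : M} (hp : p ∈ S) (hpφ : p ∈ φ.source) (hq : q ∈ S) (hqψ : q ∈ ψ.source) :
    gradNormSq (metricInChart g φ) (F ∘ φ.symm) (φ p)
        = gradNormSq (metricInChart g ψ) (F ∘ ψ.symm) (ψ q) ∧
      scal (metricInChart g φ) (φ p) = scal (metricInChart g ψ) (ψ q) ∧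
      radialRic (metricInChart g φ) (F ∘ φ.symm) (φ p)
        = radialRic (metricInChart g ψ) (F ∘ ψ.symm) (ψ q) := by
  set ch : M → OpenPartialHomeomorph M (EuclideanSpace ℝ (Fin n)) := fun p =>
    chartAt (EuclideanSpace ℝ (Fin n)) p
  have hch : ∀ p, ch p ∈ IsManifold.maximalAtlas (𝓡 n) ∞ M := fun p =>
    IsManifold.chart_mem_maximalAtlas p
  have hchs : ∀ p, p ∈ (ch p).source := fun p => mem_chart_source _ p
  -- The three invariants, computed at each point in its preferred chart. `hinv` allows any other
  -- chart, in particular the one centred at a nearby point.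
  set I : M → ℝ × ℝ × ℝ := fun p => (gradNormSq (metricInChart g (ch p)) (F ∘ (ch p).symm) (ch p p),
    scal (metricInChart g (ch p)) (ch p p),
    radialRic (metricInChart g (ch p)) (F ∘ (ch p).symm) (ch p p)) with hI
  have hinv : ∀ {φ : OpenPartialHomeomorph M (EuclideanSpace ℝ (Fin n))},
      φ ∈ IsManifold.maximalAtlas (𝓡 n) ∞ M → ∀ {p}, p ∈ φ.source →
      (gradNormSq (metricInChart g φ) (F ∘ φ.symm) (φ p), scal (metricInChart g φ) (φ p),
        radialRic (metricInChart g φ) (F ∘ φ.symm) (φ p)) = I p := by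
    intro φ hφ p hp
    obtain ⟨h1, h2, h3⟩ := invariants_eq hsol hW hn (hch p) hφ (hchs p) hp
    simp only [hI, h1, h2, h3]
  -- Nearby points of `S` lie in one chart and on the same level set there, so the local result
  -- applies; preconnectedness then makes `I` constant.
  have hloc : IsLocallyConstant (fun p : S => I p) := by
    rw [IsLocallyConstant.iff_eventually_eq]
    rintro ⟨p, hp⟩
    have hG := gradNormSq_pos_of_mfderiv_ne_zero (g := g) hsol.smooth (hch p) (hchs p) (hSc p hp).2
    have h1 := (hsol.isFlatSolitonOn hW hn (hch p)).eventually_const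
      (fun z hz => hsol.cotton_eq_zero hW hn hC (hch p) hz)
      ((ch p).map_source (hchs p)) hG.ne'
    have h2 : ∀ᶠ q in nhds p, q ∈ (ch p).source :=
      (ch p).open_source.mem_nhds (hchs p)
    have h3 := ((ch p).continuousAt (hchs p)).eventually h1
    have h4 := (continuous_subtype_val (p := fun q => q ∈ S)).continuousAt (x := ⟨p, hp⟩)
    filter_upwards [h4.eventually h2, h4.eventually h3] with q hq2 hq3
    have hFq : (F ∘ (ch p).symm) (ch p q) = (F ∘ (ch p).symm) (ch p p) := by
      simp only [Function.comp, (ch p).left_inv hq2, (ch p).left_inv (hchs p),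
        (hSc p hp).1, (hSc q q.2).1]
    obtain ⟨e1, e2, e3⟩ := hq3 hFq
    rw [← hinv (hch p) hq2, e1, e2, e3]
  have hSp : PreconnectedSpace S := Subtype.preconnectedSpace hS
  have hpq : I p = I q := hloc.apply_eq_of_preconnectedSpace ⟨p, hp⟩ ⟨q, hq⟩
  rw [← hinv hφ hpφ, ← hinv hψ hqψ] at hpq
  simpa only [Prod.mk.injEq] using hpq

end Manifold

end RicciSoliton

theorem lemma4p4 {n : ℕ} (hn : 3 ≤ n) {M : Type*} [TopologicalSpace M]
    [ChartedSpace (EuclideanSpace ℝ (Fin n)) M] [IsManifold (𝓡 n) ∞ M]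
    (g : RicciSoliton.Metric n M) (F : M → ℝ) (ρ : ℝ)
    (hsol : IsGradientSoliton g F ρ) (hW : WeylVanishes g) :
    -- the formula for `|C|²` at every regular point, in every chart and every tangent frame
    (∀ φ ∈ IsManifold.maximalAtlas (𝓡 n) ∞ M, ∀ p ∈ φ.source,
      mfderiv (𝓡 n) 𝓘(ℝ, ℝ) F p ≠ 0 →
      ∀ e, IsTangentFrame (metricInChart g φ) (F ∘ φ.symm) (φ p) e →
        cottonNormSq (metricInChart g φ) (φ p) =
          2 * gradNormSq (metricInChart g φ) (F ∘ φ.symm) (φ p) ^ 2 / ((n : ℝ) - 2) ^ 2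
              * tracelessNormSq (metricInChart g φ) (F ∘ φ.symm) (φ p) e
            + 1 / (2 * ((n : ℝ) - 1) * ((n : ℝ) - 2))
              * tangentialGradNormSq (metricInChart g φ) (F ∘ φ.symm) (φ p) e) ∧
    -- the consequences, when `g` is locally conformally flat
    ((n = 3 → CottonVanishes g) →
      (∀ φ ∈ IsManifold.maximalAtlas (𝓡 n) ∞ M, ∀ p ∈ φ.source,
        mfderiv (𝓡 n) 𝓘(ℝ, ℝ) F p ≠ 0 →
        -- `∇F` is an eigenvector of the Ricci tensor, and so is every nonzero vector tangent to
        -- the level set, the latter all with the same eigenvalue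
        (∃ lam mu : ℝ,
          (∀ Y, form (fun i j => ric (metricInChart g φ) i j (φ p))
              (fun i => grad (metricInChart g φ) (F ∘ φ.symm) i (φ p)) Y =
            lam * form (metricInChart g φ (φ p))
              (fun i => grad (metricInChart g φ) (F ∘ φ.symm) i (φ p)) Y) ∧
          (∀ X, IsTangent (F ∘ φ.symm) (φ p) X →
            ∀ Y, form (fun i j => ric (metricInChart g φ) i j (φ p)) X Y =
              mu * form (metricInChart g φ (φ p)) X Y)) ∧
        -- `h_ab = H / (n - 1) g_ab`
        (∀ e, IsTangentFrame (metricInChart g φ) (F ∘ φ.symm) (φ p) e →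
          ∀ X Y, IsTangent (F ∘ φ.symm) (φ p) X → IsTangent (F ∘ φ.symm) (φ p) Y →
            secondForm (metricInChart g φ) (F ∘ φ.symm) (φ p) X Y =
              meanCurv (metricInChart g φ) (F ∘ φ.symm) (φ p) e / ((n : ℝ) - 1)
                * form (metricInChart g φ (φ p)) X Y)) ∧
      -- `G = |∇F|²`, the scalar curvature and the mean curvature take the same value at any two
      -- points of a connected set of regular points in a level set, whatever the charts and
      -- frames they are computed in
      (∀ (c : ℝ) (S : Set M), IsPreconnected S →
        (∀ p ∈ S, F p = c ∧ mfderiv (𝓡 n) 𝓘(ℝ, ℝ) F p ≠ 0) →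
        ∀ φ ∈ IsManifold.maximalAtlas (𝓡 n) ∞ M, ∀ ψ ∈ IsManifold.maximalAtlas (𝓡 n) ∞ M,
        ∀ p ∈ S, p ∈ φ.source → ∀ q ∈ S, q ∈ ψ.source →
          gradNormSq (metricInChart g φ) (F ∘ φ.symm) (φ p) =
            gradNormSq (metricInChart g ψ) (F ∘ ψ.symm) (ψ q) ∧
          scal (metricInChart g φ) (φ p) = scal (metricInChart g ψ) (ψ q) ∧
          ∀ e e', IsTangentFrame (metricInChart g φ) (F ∘ φ.symm) (φ p) e →
            IsTangentFrame (metricInChart g ψ) (F ∘ ψ.symm) (ψ q) e' →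
            meanCurv (metricInChart g φ) (F ∘ φ.symm) (φ p) e =
              meanCurv (metricInChart g ψ) (F ∘ ψ.symm) (ψ q) e')) := by
  have hpos : ∀ φ ∈ IsManifold.maximalAtlas (𝓡 n) ∞ M, ∀ p ∈ φ.source,
      mfderiv (𝓡 n) 𝓘(ℝ, ℝ) F p ≠ 0 →
        0 < gradNormSq (metricInChart g φ) (F ∘ φ.symm) (φ p) :=
    fun φ hφ p hp hd => gradNormSq_pos_of_mfderiv_ne_zero hsol.smooth hφ hp hd
  have hflat := fun φ hφ => hsol.isFlatSolitonOn hW hn (φ := φ) hφ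
  refine ⟨fun φ hφ p hp hd e he =>
    (hflat φ hφ).cottonNormSq_eq (φ.map_source hp) (hpos φ hφ p hp hd) he, fun hC3 => ?_⟩
  have hC : ∀ φ ∈ IsManifold.maximalAtlas (𝓡 n) ∞ M, ∀ p ∈ φ.source, ∀ i j k,
      cotton (metricInChart g φ) i j k (φ p) = 0 :=
    fun φ hφ p hp => hsol.cotton_eq_zero hW hn hC3 hφ (φ.map_source hp)
  refine ⟨fun φ hφ p hp hd => ⟨⟨_, _, fun Y => (hflat φ hφ).form_ric_grad (φ.map_source hp)
      (hC φ hφ p hp) (hpos φ hφ p hp hd).ne' Y, fun X hX Y => (hflat φ hφ).form_ric_tangent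
      (φ.map_source hp) (hC φ hφ p hp) (hpos φ hφ p hp hd).ne' hX Y⟩,
      fun e he X Y hX hY => ?_⟩, ?_⟩
  · have hn1 : (n : ℝ) - 1 ≠ 0 := by linarith [(hflat φ hφ).two_lt]
    rw [(hflat φ hφ).secondForm_umbilic (φ.map_source hp) (hC φ hφ p hp) (hpos φ hφ p hp hd) hX hY,
      (hflat φ hφ).meanCurv_eq (φ.map_source hp) (hC φ hφ p hp) (hpos φ hφ p hp hd) he,
      mul_div_cancel_left₀ _ hn1]
  · intro c S hS hSc φ hφ ψ hψ p hp hpφ q hq hqψ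
    obtain ⟨h1, h2, h3⟩ := invariants_constant hsol hW hn hC3 hS hSc hφ hψ hp hpφ hq hqψ
    refine ⟨h1, h2, fun e e' he he' => ?_⟩
    -- The mean curvature is determined by `G`, `R` and the auxiliary invariant `radialRic`, in
    -- whatever frame it is computed.
    rw [(hflat φ hφ).meanCurv_eq (φ.map_source hpφ) (hC φ hφ p hpφ)
        (hpos φ hφ p hpφ (hSc p hp).2) he,
      (hflat ψ hψ).meanCurv_eq (ψ.map_source hqψ) (hC ψ hψ q hqψ)
        (hpos ψ hψ q hqψ (hSc q hq).2) he', h1, h2, h3]
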